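/- **Setting.** Let $\Lambda_\circ \hookleftarrow \Gamma \hookrightarrow \Lambda_\bullet$ be a span of even, positive definite lattices of equal finite rank. Put $\mathfrak h=\Gamma\otimes\mathbb R$ and regard $\Gamma\subseteq\Lambda_\circ,\Lambda_\bullet\subset\mathfrak h$; put $H=\mathfrak h/\Gamma$, $T_\circ=\mathfrak h/\Lambda_\circ$, $T_\bullet=\mathfrak h/\Lambda_\bullet$. Write $S^1=\mathbb R/\mathbb Z$, $q=0$, $p=\tfrac12$. *The loop group.* $L(T_\circ,H,T_\bullet)$ is the abelian group of quadruples $\gamma=(\gamma_\circ,\gamma_\bullet,\gamma_{\mathrm m}(p),\gamma_{\mathrm m}(q))$ of smooth paths $\gamma_\circ:[\tfrac12,1]\to T_\circ$, $\gamma_\bullet:[0,\tfrac12]\to T_\bullet$ and points $\gamma_{\mathrm m}(p),\gamma_{\mathrm m}(q)\in H$ which project to the end points of $\gamma_\circ,\gamma_\bullet$ at $p$, resp. $q$, such that all derivatives of order $\ge1$ of $\gamma_\circ$ and $\gamma_\bullet$ agree at $p$ and at $q$. Lifting $\gamma_\circ,\gamma_\bullet$ to $H$ through the value $\gamma_{\mathrm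 m}(p)$ gives a path $[0,1]\to H$, which has a smooth lift $\hat\xi:\mathbb R\to\mathfrak h$, unique up to addition of an element of $\Gamma$, with $\hat\xi(t+1)=\hat\xi(t)+\Delta(\gamma)$, where $\Delta(\gamma)=\hat\xi(1)-\hat\xi(0)\in\Lambda_\circ-\Lambda_\bullet=\{\lambda_\circ-\lambda_\bullet\}$ defines a homomorphism $\Delta$. *The central extension.* Let $\varepsilon$ be a normalised $\mathbb T$-valued 2-cocycle on $\Lambda_\circ-\Lambda_\bullet$ with $\varepsilon(\lambda,\mu)\varepsilon(\mu,\lambda)^{-1}=e^{2\pi i(\frac12\langle\mu,\lambda\rangle+\langle\mu,\lambda_\bullet\rangle)}$ for $\lambda=\lambda_\circ-\lambda_\bullet$. Then $\widetilde L=\widetilde L(T_\circ,H,T_\bullet)$ is $L(T_\circ,H,T_\bullet)\times\mathbb T$ with the central extension structure given by the cocycle $$c(\gamma,\rho)=\varepsilon(\Delta(\gamma),\Delta(\rho))\,e^{2\pi iS'(\hat\xi,\hat\eta)},\qquad S'(\hat\xi,\hat\eta)=\tfrac12\int_0^1\langle\hat\xi'(t),\hat\eta(t)\rangle\,dt+\tfrac12\langle\Delta(\gamma),\hat\eta(0)\rangle,$$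 where $\hat\xi,\hat\eta$ are lifts of $\gamma,\rho$. Let $n$ be the least positive integer with $n(\Lambda_\circ-\Lambda_\bullet)\subseteq\Gamma$. The rotation $\Phi_\theta$ sends $\gamma$ to the bicoloured loop with lift $\hat\xi(\cdot-\theta)$ and with value $\gamma_{\mathrm m}(q)+[\hat\xi(-\theta)-\hat\xi(0)]$ at $q$, and it acts on $\widetilde L$ by $\Phi_\theta\cdot(\gamma,z)=(\Phi_\theta\cdot\gamma,\ e^{\pi i\langle\hat\xi(-\theta)-\hat\xi(0),\Delta(\gamma)\rangle}z)$. This is an action of $\mathrm{Rot}^{(k)}(S^1)=\mathbb R/k\mathbb Z$ whenever $n\mid k$. Let $\widetilde{\ker}\subseteq\widetilde L$ be the preimage of $\ker\Delta$. *The representation $W_{\chi,l}$.* Let $\mathcal K$ be the Hilbert space of square-summable sequences $(x_k)_{k\ge1}$ in $\mathfrak h\otimes\mathbb C$, and embed the smooth periodic functions $\xi:\mathbb R\to\mathfrak h$ of mean zero into $\mathcal K$ by $x_k=2\pi\sqrt k\int_0^1e^{2\pi ikt}\xi(t)\,dt$. Let $\mathcal S$ be the bosonic Fock space of $\mathcal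 K$, that is, the completion of $\mathrm{Sym}^*(\mathcal K)$ for $\langle x_1\cdots x_k,y_1\cdots y_k\rangle=\sum_{\sigma\in S_k}\prod_i\langle x_i,y_{\sigma(i)}\rangle$, and put $e^\kappa=\sum_k\kappa^k/k!$. With inner products antilinear in the first argument, let $W(\xi,z)$ be the unitary operator with $W(\xi,z)e^\kappa=z\,e^{-\frac12\langle\xi,\xi\rangle-\langle\xi,\kappa\rangle}e^{\kappa+\xi}$, and let $R[\Phi_\theta]$ act on monomials factorwise by $(x_k)_k\mapsto(e^{2\pi ik\theta}x_k)_k$. For a character $\chi$ of $(\Lambda_\circ\cap\Lambda_\bullet)/\Gamma$ and a character $l$ of $H$, regarded as a vector $l\in\mathfrak h$ with $\langle l,\Gamma\rangle\subseteq\mathbb Z$, put, for $(\gamma,z)\in\widetilde{\ker}$, $$W_{\chi,l}(\gamma,z)=\chi\bigl(\gamma_{\mathrm m}(q)-[\hat\xi(1)]\bigr)\,e^{2\pi i\langle l,\bar\xi\rangle}\,W(\hat\xi-\bar\xi,z),\quad \bar\xi=\int_0^1\hat\xi(t)\,dt,\qquad R_{\chi,l}[\Phi_\theta]=e^{\pi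 i\langle l,l\rangle\theta}R[\Phi_\theta].$$ *Induction.* Let $m$ be the least positive integer with $n\mid m$ and $m\langle l,l\rangle\in2\mathbb Z$. Let $\mathrm{Ind}\,\mathcal S_{\chi,l}$ be the Hilbert space direct sum of $\sigma\times_{\widetilde{\ker}}\mathcal S$ over the cosets $\sigma\in\widetilde L/\widetilde{\ker}$; its vectors $[x,v]$ satisfy $[xh,v]=[x,W_{\chi,l}(h)v]$ for $h\in\widetilde{\ker}$. **Proposition.** The formulas $$(\mathrm{Ind}\,W_{\chi,l})(g)[x,v]=[gx,v],\qquad(\mathrm{Ind}\,R_{\chi,l})[\Phi_\theta][x,v]=[\Phi_\theta\cdot x,\ R_{\chi,l}[\Phi_\theta]v]$$ define a unitary representation of $\widetilde L$ and a strongly continuous unitary representation of $\mathrm{Rot}^{(m)}(S^1)=\mathbb R/m\mathbb Z$ on $\mathrm{Ind}\,\mathcal S_{\chi,l}$, which satisfy $$(\mathrm{Ind}\,R_{\chi,l})[\Phi_\theta]\,(\mathrm{Ind}\,W_{\chi,l})(g)\,(\mathrm{Ind}\,R_{\chi,l})[\Phi_\theta]^*=(\mathrm{Ind}\,W_{\chi,l})(\Phi_\theta\cdot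 g).$$ The representation $\mathrm{Ind}\,R_{\chi,l}$ has positive energy: for $a\in\frac1m\mathbb Z$ the eigenspace $$\{v:(\mathrm{Ind}\,R_{\chi,l})[\Phi_\theta]v=e^{2\pi ia\theta}v\ \text{for all }\theta\}$$ is zero if $a<0$ and finite-dimensional if $a\ge0$. Its graded character $\mathrm{ch}(q)$, the sum over $a\in\frac1m\mathbb Z_{\ge0}$ of $q^a$ times the dimension of the $a$-th eigenspace, is, as a formal series in real powers of $q$, $$\mathrm{ch}_{\mathrm{Ind}\,R_{\chi,l}}(q)=q^{\operatorname{rank}\Gamma/24}\;\theta_{l+(\Lambda_\circ-\Lambda_\bullet)}(q)\;\eta(q)^{-\operatorname{rank}\Gamma},$$ where $\theta_{l+(\Lambda_\circ-\Lambda_\bullet)}(q)=\sum_{x\in l+(\Lambda_\circ-\Lambda_\bullet)}q^{\langle x,x\rangle/2}$ and $\eta(q)=q^{1/24}\prod_{j\ge1}(1-q^j)$. -/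

import Mathlib

open Set
open scoped ContDiff InnerProductSpace

noncomputable section

namespace BicolouredTorus

/-- `e^{2πix}`. -/
def expI (x : ℝ) : Circle := Circle.exp (2 * Real.pi * x)

theorem expI_add (x y : ℝ) : expI (x + y) = expI x * expI y := by
  simp [expI, mul_add, Circle.exp_add]

theorem expI_int (k : ℤ) : expI k = 1 := by
  rw [expI, mul_comm]
  exact Circle.exp_int_mul_two_pi k

/-- A span `Λ○ ↩ Γ ↪ Λ●` of even positive definite lattices of equal rank. The ambient Euclidean
space `E` is the Lie algebra `𝔥 = Γ ⊗ ℝ`, and `Λ○`, `Λ●` are regarded as subgroups of `𝔥` through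
the isomorphisms `ℝπ○`, `ℝπ●`; then `π○`, `π●` are inclusions. Evenness and positive definiteness
make the subgroups discrete, hence lattices of full rank. -/
structure LatticeSpan (E : Type*) [NormedAddCommGroup E] [InnerProductSpace ℝ E] where
  Γ : AddSubgroup E
  Λw : AddSubgroup E
  Λb : AddSubgroup E
  le_w : Γ ≤ Λw
  le_b : Γ ≤ Λb
  even_w : ∀ x ∈ Λw, ∃ k : ℤ, ⟪x, x⟫_ℝ = 2 * k
  even_b : ∀ x ∈ Λb, ∃ k : ℤ, ⟪x, x⟫_ℝ = 2 * k
  span_eq_top : Submodule.span ℝ (Γ : Set E) = ⊤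

variable {E : Type*} [NormedAddCommGroup E] [InnerProductSpace ℝ E]

namespace LatticeSpan

variable (L : LatticeSpan E)

/-- `Λ○ - Λ● = {λ○ - λ●}`. -/
def diff : AddSubgroup E where
  carrier := {x | ∃ a ∈ L.Λw, ∃ b ∈ L.Λb, x = a - b}
  zero_mem' := ⟨0, zero_mem _, 0, zero_mem _, by simp⟩
  add_mem' := by
    rintro _ _ ⟨a, ha, b, hb, rfl⟩ ⟨c, hc, d, hd, rfl⟩
    exact ⟨a + c, add_mem ha hc, b + d, add_mem hb hd, by abel⟩
  neg_mem' := by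
    rintro _ ⟨a, ha, b, hb, rfl⟩
    exact ⟨-a, neg_mem ha, -b, neg_mem hb, by abel⟩

/-- `Λ○ ∩ Λ●`. -/
def inter : AddSubgroup E := L.Λw ⊓ L.Λb

/-- The finite group `(Λ○ ∩ Λ●)/Γ`, as a subgroup of the torus `H = 𝔥/Γ`. -/
def interQuot : AddSubgroup (E ⧸ L.Γ) := L.inter.map (QuotientAddGroup.mk' L.Γ)

theorem polar {A : AddSubgroup E} (h : ∀ x ∈ A, ∃ k : ℤ, ⟪x, x⟫_ℝ = 2 * k) {x y : E}
    (hx : x ∈ A) (hy : y ∈ A) : ∃ k : ℤ, ⟪x, y⟫_ℝ = k := by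
  obtain ⟨i, hi⟩ := h x hx
  obtain ⟨j, hj⟩ := h y hy
  obtain ⟨k, hk⟩ := h (x + y) (add_mem hx hy)
  refine ⟨k - i - j, ?_⟩
  rw [inner_add_add_self, hi, hj, real_inner_comm x y] at hk
  push_cast
  linarith

theorem int_diff_inter {x y : E} (hx : x ∈ L.diff) (hy : y ∈ L.inter) :
    ∃ k : ℤ, ⟪x, y⟫_ℝ = k := by
  obtain ⟨a, ha, b, hb, rfl⟩ := hx
  obtain ⟨i, hi⟩ := polar L.even_w ha hy.1
  obtain ⟨j, hj⟩ := polar L.even_b hb hy.2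
  exact ⟨i - j, by rw [inner_sub_left, hi, hj]; push_cast; ring⟩

theorem Γ_le_inter : L.Γ ≤ L.inter := le_inf L.le_w L.le_b

end LatticeSpan

/-! ### Gluing smooth maps -/

section Gluing

variable {F : Type*} [NormedAddCommGroup F] [NormedSpace ℝ F]

theorem glue_contDiffOn_nat (n : ℕ) : ∀ {f g : ℝ → F} {a b c : ℝ}, a < b → b < c →
    ContDiffOn ℝ ∞ f (Icc a b) → ContDiffOn ℝ ∞ g (Icc b c) →
    (∀ k, iteratedDerivWithin k f (Icc a b) b = iteratedDerivWithin k g (Icc b c) b) →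
    ContDiffOn ℝ n (fun t => if t ≤ b then f t else g t) (Icc a c) := by
  induction n with
  | zero =>
    intro f g a b c hab hbc hf hg h
    have h0 : f b = g b := by simpa using h 0
    refine contDiffOn_zero.2 ?_
    have : Icc a c = Icc a b ∪ Icc b c := (Icc_union_Icc_eq_Icc hab.le hbc.le).symm
    rw [this]
    refine ContinuousOn.union_of_isClosed ?_ ?_ isClosed_Icc isClosed_Icc
    · exact hf.continuousOn.congr fun t ht => by simp [ht.2]
    · refine hg.continuousOn.congr fun t ht => ?_
      rcases ht.1.eq_or_lt with rfl | h'
      · simp [h0]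
      · simp [not_le.2 h']
  | succ n ih =>
    intro f g a b c hab hbc hf hg h
    have h0 : f b = g b := by simpa using h 0
    have h1 : derivWithin f (Icc a b) b = derivWithin g (Icc b c) b := by
      simpa [iteratedDerivWithin_one] using h 1
    have uab := uniqueDiffOn_Icc hab
    have ubc := uniqueDiffOn_Icc hbc
    have uac := uniqueDiffOn_Icc (hab.trans hbc)
    set p : ℝ → F := fun t => if t ≤ b then f t else g t with hp
    have pf : EqOn p f (Icc a b) := fun t ht => by simp [hp, ht.2]
    have pg : EqOn p g (Icc b c) := fun t ht => by
      rcases ht.1.eq_or_lt with rfl | h'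
      · simp [hp, h0]
      · simp [hp, not_le.2 h']
    have key : ∀ t ∈ Icc a c, HasDerivWithinAt p
        (if t ≤ b then derivWithin f (Icc a b) t else derivWithin g (Icc b c) t) (Icc a c) t := by
      intro t ht
      have hfd : ∀ s ∈ Icc a b, HasDerivWithinAt p (derivWithin f (Icc a b) s) (Icc a b) s :=
        fun s hs => ((hf.differentiableOn (by simp) s hs).hasDerivWithinAt).congr pf (pf hs)
      have hgd : ∀ s ∈ Icc b c, HasDerivWithinAt p (derivWithin g (Icc b c) s) (Icc b c) s :=
        fun s hs => ((hg.differentiableOn (by simp) s hs).hasDerivWithinAt).congr pg (pg hs)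
      rcases lt_trichotomy t b with hlt | rfl | hgt
      · rw [if_pos hlt.le]
        refine (hfd t ⟨ht.1, hlt.le⟩).mono_of_mem_nhdsWithin ?_
        filter_upwards [self_mem_nhdsWithin, mem_nhdsWithin_of_mem_nhds (Iio_mem_nhds hlt)]
          with s hs hs'
        exact ⟨hs.1, le_of_lt hs'⟩
      · rw [if_pos le_rfl, ← Icc_union_Icc_eq_Icc hab.le hbc.le]
        refine (hfd t ⟨hab.le, le_rfl⟩).union ?_
        rw [h1]
        exact hgd t ⟨le_rfl, hbc.le⟩
      · rw [if_neg (not_le.2 hgt)]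
        refine (hgd t ⟨hgt.le, ht.2⟩).mono_of_mem_nhdsWithin ?_
        filter_upwards [self_mem_nhdsWithin, mem_nhdsWithin_of_mem_nhds (Ioi_mem_nhds hgt)]
          with s hs hs'
        exact ⟨le_of_lt hs', hs.2⟩
    have := (contDiffOn_succ_iff_derivWithin (n := (n : WithTop ℕ∞)) (f := p) uac).2
      ⟨fun t ht => (key t ht).differentiableWithinAt, by simp, ?_⟩
    · exact_mod_cast this
    · refine (ih hab hbc ((hf.derivWithin uab (m := ∞) (by simp)))
        ((hg.derivWithin ubc (m := ∞) (by simp))) fun k => ?_).congr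
        fun t ht => (key t ht).derivWithin (uac t ht)
      rw [← iteratedDerivWithin_succ', ← iteratedDerivWithin_succ']
      exact h (k + 1)

theorem glue_contDiffOn {f g : ℝ → F} {a b c : ℝ} (hab : a < b) (hbc : b < c)
    (hf : ContDiffOn ℝ ∞ f (Icc a b)) (hg : ContDiffOn ℝ ∞ g (Icc b c))
    (h : ∀ k, iteratedDerivWithin k f (Icc a b) b = iteratedDerivWithin k g (Icc b c) b) :
    ContDiffOn ℝ ∞ (fun t => if t ≤ b then f t else g t) (Icc a c) :=
  contDiffOn_infty.2 fun n => glue_contDiffOn_nat n hab hbc hf hg h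

theorem iteratedDerivWithin_mono_Icc {f : ℝ → F} {a b c d t : ℝ} (hab : a < b)
    (hcd : c < d) (hs : Icc a b ⊆ Icc c d) (hf : ContDiffOn ℝ ∞ f (Icc c d)) (ht : t ∈ Icc a b)
    (k : ℕ) : iteratedDerivWithin k f (Icc a b) t = iteratedDerivWithin k f (Icc c d) t := by
  unfold iteratedDerivWithin
  rw [iteratedFDerivWithin_subset hs (uniqueDiffOn_Icc hab) (uniqueDiffOn_Icc hcd)
    (hf.of_le (by exact_mod_cast le_top)) ht]

theorem iteratedDerivWithin_Icc_shift {f g : ℝ → F} {a b s : ℝ} {v : F}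
    (h : ∀ t ∈ Icc a b, g t = f (t - s) + v) {k : ℕ} (hk : 1 ≤ k) {t : ℝ} (ht : t ∈ Icc a b) :
    iteratedDerivWithin k g (Icc a b) t = iteratedDerivWithin k f (Icc (a - s) (b - s)) (t - s) := by
  rw [iteratedDerivWithin_congr (g := fun t => v + f (t - s))
    (fun t ht => by rw [h t ht, add_comm]) ht, iteratedDerivWithin_const_add hk,
    iteratedDerivWithin_comp_sub_const]
  rw [← Set.image_vadd]
  simp [sub_eq_neg_add]

/-- Two smooth arcs with matching derivatives of all orders at both pairs of end points glue to a
smooth quasi-periodic map on the line. -/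
theorem exists_quasiperiodic {f g : ℝ → F} (hf : ContDiffOn ℝ ∞ f (Icc 0 (1 / 2)))
    (hg : ContDiffOn ℝ ∞ g (Icc (1 / 2) 1)) (h0 : f (1 / 2) = g (1 / 2))
    (hp : ∀ k, 1 ≤ k → iteratedDerivWithin k g (Icc (1 / 2) 1) (1 / 2) =
      iteratedDerivWithin k f (Icc 0 (1 / 2)) (1 / 2))
    (hq : ∀ k, 1 ≤ k → iteratedDerivWithin k g (Icc (1 / 2) 1) 1 =
      iteratedDerivWithin k f (Icc 0 (1 / 2)) 0) :
    ∃ Ξ : ℝ → F, ContDiff ℝ ∞ Ξ ∧ (∀ t, Ξ (t + 1) = Ξ t + (g 1 - f 0)) ∧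
      EqOn Ξ f (Icc 0 (1 / 2)) ∧ EqOn Ξ g (Icc (1 / 2) 1) := by
  set v := g 1 - f 0 with hv
  set h : ℝ → F := fun t => if t ≤ 1 / 2 then f t else g t with hh
  have hsm : ContDiffOn ℝ ∞ h (Icc 0 1) := by
    refine glue_contDiffOn (by norm_num) (by norm_num) hf hg fun k => ?_
    rcases Nat.eq_zero_or_pos k with rfl | hk
    · simpa using h0
    · exact (hp k hk).symm
  have ehf : EqOn h f (Icc 0 (1 / 2)) := fun t ht => by simp only [hh, if_pos ht.2]
  have ehg : EqOn h g (Icc (1 / 2) 1) := fun t ht => by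
    rcases ht.1.eq_or_lt with h' | h'
    · simp only [hh, ← h', le_refl, if_true, h0]
    · simp only [hh, if_neg (not_le.2 h')]
  have h_0 : h 0 = f 0 := ehf ⟨le_rfl, by norm_num⟩
  have h_1 : h 1 = g 1 := ehg ⟨by norm_num, le_rfl⟩
  set H : ℝ → F := fun t => if t ≤ 1 then h t else h (t - 1) + v with hH
  have Hsm : ContDiffOn ℝ ∞ H (Icc 0 2) := by
    refine glue_contDiffOn (g := fun t => h (t - 1) + v) (by norm_num) (by norm_num) hsm ?_ ?_
    · refine ContDiffOn.add (hsm.comp (by fun_prop) fun t ht => ?_) contDiffOn_const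
      constructor <;> linarith [ht.1, ht.2]
    · intro k
      rcases Nat.eq_zero_or_pos k with rfl | hk
      · simp [h_0, h_1, hv]
      · rw [iteratedDerivWithin_Icc_shift (f := h) (s := 1) (v := v) (fun _ _ => rfl) hk
          ⟨le_rfl, by norm_num⟩]
        norm_num only
        rw [← iteratedDerivWithin_mono_Icc (a := 1 / 2) (b := 1) (by norm_num) (by norm_num)
          (Icc_subset_Icc (by norm_num) le_rfl) hsm ⟨by norm_num, le_rfl⟩,
          ← iteratedDerivWithin_mono_Icc (a := 0) (b := 1 / 2) (by norm_num) (by norm_num)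
          (Icc_subset_Icc le_rfl (by norm_num)) hsm ⟨le_rfl, by norm_num⟩,
          iteratedDerivWithin_congr ehg ⟨by norm_num, le_rfl⟩,
          iteratedDerivWithin_congr ehf ⟨le_rfl, by norm_num⟩]
        exact hq k hk
  set Ξ : ℝ → F := fun t => h (Int.fract t) + ⌊t⌋ • v with hΞ
  have fr : ∀ (t : ℝ) (k : ℤ), ⌊t⌋ = k → Ξ t = h (t - k) + k • v := by
    rintro t k rfl
    rfl
  have eΞ : EqOn Ξ h (Icc 0 1) := fun t ht => by
    rcases ht.2.eq_or_lt with rfl | h'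
    · simp [hΞ, h_0, h_1, hv]
    · have : ⌊t⌋ = 0 := Int.floor_eq_zero_iff.2 ⟨ht.1, h'⟩
      simp [fr t 0 this]
  refine ⟨Ξ, contDiff_iff_contDiffAt.2 fun t₀ => ?_, fun t => ?_, ?_, ?_⟩
  · set n := ⌊t₀⌋ with hn
    have hmem : t₀ ∈ Ioo ((n : ℝ) - 1) (n + 1) :=
      ⟨by linarith [Int.floor_le t₀], Int.lt_floor_add_one t₀⟩
    have hloc : Ξ =ᶠ[nhds t₀] fun t => H (t - (n - 1)) + (n - 1) • v := by
      filter_upwards [Ioo_mem_nhds hmem.1 hmem.2] with t ht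
      rcases lt_or_ge t n with hlt | hge
      · have : ⌊t⌋ = n - 1 := Int.floor_eq_iff.2 ⟨by push_cast; linarith [ht.1],
          by push_cast; linarith⟩
        have h1 : t - (n - 1) ≤ 1 := by linarith
        rw [fr t _ this]
        simp [hH, h1]
      · have : ⌊t⌋ = n := Int.floor_eq_iff.2 ⟨hge, ht.2⟩
        have ev : (n : ℤ) • v = v + (n - 1) • v := by rw [sub_smul]; simp
        rcases hge.eq_or_lt with h' | h'
        · rw [fr t _ this, ev]
          simp only [hH, ← h', hv]
          simp [h_0, h_1, ← add_assoc]
        · have h1 : ¬ t - (n - 1) ≤ 1 := by linarith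
          have h2 : t - (n - 1) - 1 = t - n := by ring
          rw [fr t _ this, ev]
          simp only [hH, if_neg h1, h2, add_assoc]
    refine ContDiffAt.congr_of_eventuallyEq ?_ hloc
    have hH' : ContDiffAt ℝ ∞ H (t₀ - (n - 1)) :=
      Hsm.contDiffAt (Icc_mem_nhds (by linarith [hmem.1]) (by linarith [hmem.2]))
    exact (ContDiffAt.comp (f := fun t : ℝ => t - (n - 1)) t₀ hH' (by fun_prop)).add
      contDiffAt_const
  · simp [hΞ, Int.fract_add_one, add_smul, add_assoc]
  · exact (eΞ.mono (Icc_subset_Icc le_rfl (by norm_num))).trans ehf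
  · exact (eΞ.mono (Icc_subset_Icc (by norm_num) le_rfl)).trans ehg

end Gluing

/-! ### Bicoloured loops -/

namespace LatticeSpan

variable (L : LatticeSpan E)

/-- `𝕋π○ : H = 𝔥/Γ → T○ = 𝔥/Λ○`. -/
def projW : E ⧸ L.Γ →+ E ⧸ L.Λw := QuotientAddGroup.map _ _ (AddMonoidHom.id E) L.le_w

/-- `𝕋π● : H = 𝔥/Γ → T● = 𝔥/Λ●`. -/
def projB : E ⧸ L.Γ →+ E ⧸ L.Λb := QuotientAddGroup.map _ _ (AddMonoidHom.id E) L.le_b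

/-- Quadruples `(γ○, γ●, γ_m(p), γ_m(q))`. The circle is `ℝ/ℤ`, with `q = 0` and `p = 1/2`; the
left arc, on which `γ○` lives, is `[1/2, 1]` and the right arc, on which `γ●` lives, is
`[0, 1/2]`. -/
abbrev Quad : Type _ :=
  (Icc (1 / 2 : ℝ) 1 → E ⧸ L.Λw) × (Icc (0 : ℝ) (1 / 2) → E ⧸ L.Λb) × (E ⧸ L.Γ) × (E ⧸ L.Γ)

/-- `ξ○`, `ξ●` are smooth lifts of `γ○`, `γ●` to the Lie algebra. (A map from an interval to a
torus is smooth exactly if it has such a lift, and its derivatives of order at least one are those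
of the lift.) -/
structure SmoothLifts (γ : L.Quad) (ξw ξb : ℝ → E) : Prop where
  smooth_w : ContDiffOn ℝ ∞ ξw (Icc (1 / 2) 1)
  smooth_b : ContDiffOn ℝ ∞ ξb (Icc 0 (1 / 2))
  lift_w : ∀ t : Icc (1 / 2 : ℝ) 1, (ξw t : E ⧸ L.Λw) = γ.1 t
  lift_b : ∀ t : Icc (0 : ℝ) (1 / 2), (ξb t : E ⧸ L.Λb) = γ.2.1 t
  deriv_p : ∀ k, 1 ≤ k → iteratedDerivWithin k ξw (Icc (1 / 2) 1) (1 / 2) =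
    iteratedDerivWithin k ξb (Icc 0 (1 / 2)) (1 / 2)
  deriv_q : ∀ k, 1 ≤ k → iteratedDerivWithin k ξw (Icc (1 / 2) 1) 1 =
    iteratedDerivWithin k ξb (Icc 0 (1 / 2)) 0

/-- The bicoloured torus loop group `L(T○, H, T●)`. -/
def loops : AddSubgroup L.Quad where
  carrier := {γ |
    L.projW γ.2.2.1 = γ.1 ⟨1 / 2, by norm_num, by norm_num⟩ ∧
    L.projB γ.2.2.1 = γ.2.1 ⟨1 / 2, by norm_num, by norm_num⟩ ∧
    L.projW γ.2.2.2 = γ.1 ⟨1, by norm_num, by norm_num⟩ ∧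
    L.projB γ.2.2.2 = γ.2.1 ⟨0, by norm_num, by norm_num⟩ ∧
    ∃ ξw ξb : ℝ → E, L.SmoothLifts γ ξw ξb}
  zero_mem' := ⟨map_zero _, map_zero _, map_zero _, map_zero _, 0, 0,
    { smooth_w := contDiffOn_const
      smooth_b := contDiffOn_const
      lift_w := fun _ => rfl
      lift_b := fun _ => rfl
      deriv_p := fun k hk => by
        simp [show (0 : ℝ → E) = fun _ => 0 from rfl]
      deriv_q := fun k hk => by
        simp [show (0 : ℝ → E) = fun _ => 0 from rfl] }⟩
  add_mem' := by
    rintro γ ρ ⟨h1, h2, h3, h4, a, b, h⟩ ⟨k1, k2, k3, k4, c, d, k⟩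
    refine ⟨?_, ?_, ?_, ?_, a + c, b + d, ?_⟩
    · simp [h1, k1]
    · simp [h2, k2]
    · simp [h3, k3]
    · simp [h4, k4]
    · have uw := uniqueDiffOn_Icc (show (1 / 2 : ℝ) < 1 by norm_num)
      have ub := uniqueDiffOn_Icc (show (0 : ℝ) < 1 / 2 by norm_num)
      have mw : (1 / 2 : ℝ) ∈ Icc (1 / 2 : ℝ) 1 := ⟨le_rfl, by norm_num⟩
      have mw' : (1 : ℝ) ∈ Icc (1 / 2 : ℝ) 1 := ⟨by norm_num, le_rfl⟩
      have mb : (1 / 2 : ℝ) ∈ Icc (0 : ℝ) (1 / 2) := ⟨by norm_num, le_rfl⟩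
      have mb' : (0 : ℝ) ∈ Icc (0 : ℝ) (1 / 2) := ⟨le_rfl, by norm_num⟩
      refine ⟨h.smooth_w.add k.smooth_w, h.smooth_b.add k.smooth_b, fun t => ?_, fun t => ?_,
        fun n hn => ?_, fun n hn => ?_⟩
      · simp [← h.lift_w, ← k.lift_w]
      · simp [← h.lift_b, ← k.lift_b]
      · have e : (n : WithTop ℕ∞) ≤ ∞ := by exact_mod_cast le_top
        rw [iteratedDerivWithin_add mw uw ((h.smooth_w _ mw).of_le e) ((k.smooth_w _ mw).of_le e),
          iteratedDerivWithin_add mb ub ((h.smooth_b _ mb).of_le e) ((k.smooth_b _ mb).of_le e),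
          h.deriv_p n hn, k.deriv_p n hn]
      · have e : (n : WithTop ℕ∞) ≤ ∞ := by exact_mod_cast le_top
        rw [iteratedDerivWithin_add mw' uw ((h.smooth_w _ mw').of_le e)
          ((k.smooth_w _ mw').of_le e), iteratedDerivWithin_add mb' ub
          ((h.smooth_b _ mb').of_le e) ((k.smooth_b _ mb').of_le e),
          h.deriv_q n hn, k.deriv_q n hn]
  neg_mem' := by
    rintro γ ⟨h1, h2, h3, h4, a, b, h⟩
    refine ⟨?_, ?_, ?_, ?_, -a, -b, ?_⟩
    · simp [h1]
    · simp [h2]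
    · simp [h3]
    · simp [h4]
    · refine ⟨h.smooth_w.neg, h.smooth_b.neg, fun t => ?_, fun t => ?_,
        fun n hn => ?_, fun n hn => ?_⟩
      · simp [← h.lift_w]
      · simp [← h.lift_b]
      · rw [iteratedDerivWithin_neg, iteratedDerivWithin_neg, h.deriv_p n hn]
      · rw [iteratedDerivWithin_neg, iteratedDerivWithin_neg, h.deriv_q n hn]

variable {L}

/-- `γ_m(p)`. -/
abbrev midP (γ : L.loops) : E ⧸ L.Γ := γ.1.2.2.1

/-- `γ_m(q)`. -/
abbrev midQ (γ : L.loops) : E ⧸ L.Γ := γ.1.2.2.2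

/-- `Ξ : ℝ → 𝔥` is the quasi-periodic extension of a lift of the path `Pth(γ) : [0, 1] → H`
obtained by lifting `γ○`, `γ●` to paths in `H` that take the value `γ_m(p)` at `p`. -/
structure IsLift (γ : L.loops) (Ξ : ℝ → E) : Prop where
  smooth : ContDiff ℝ ∞ Ξ
  quasi : ∀ t, Ξ (t + 1) = Ξ t + (Ξ 1 - Ξ 0)
  lift_w : ∀ t : Icc (1 / 2 : ℝ) 1, (Ξ t : E ⧸ L.Λw) = γ.1.1 t
  lift_b : ∀ t : Icc (0 : ℝ) (1 / 2), (Ξ t : E ⧸ L.Λb) = γ.1.2.1 t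
  lift_p : (Ξ (1 / 2) : E ⧸ L.Γ) = midP γ

theorem exists_isLift (γ : L.loops) : ∃ Ξ, IsLift γ Ξ := by
  obtain ⟨γ, h1, h2, h3, h4, a, b, h⟩ := γ
  obtain ⟨x, hx⟩ := QuotientAddGroup.mk_surjective γ.2.2.1
  rw [← hx] at h1 h2
  replace h1 : (x : E ⧸ L.Λw) = _ := h1
  replace h2 : (x : E ⧸ L.Λb) = _ := h2
  rw [← h.lift_w] at h1
  rw [← h.lift_b] at h2
  set u := x - a (1 / 2) with hu
  set v := x - b (1 / 2) with hv
  have hu' : u ∈ L.Λw := by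
    rw [← QuotientAddGroup.eq_zero_iff, hu, QuotientAddGroup.mk_sub, h1, sub_self]
  have hv' : v ∈ L.Λb := by
    rw [← QuotientAddGroup.eq_zero_iff, hv, QuotientAddGroup.mk_sub, h2, sub_self]
  obtain ⟨Ξ, s, q, eb, ea⟩ := exists_quasiperiodic (f := fun t => v + b t) (g := fun t => u + a t)
    (contDiffOn_const.add h.smooth_b) (contDiffOn_const.add h.smooth_w) (by simp [hu, hv])
    (fun k hk => by
      rw [iteratedDerivWithin_const_add hk, iteratedDerivWithin_const_add hk, h.deriv_p k hk])
    (fun k hk => by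
      rw [iteratedDerivWithin_const_add hk, iteratedDerivWithin_const_add hk, h.deriv_q k hk])
  refine ⟨Ξ, s, fun t => ?_, fun t => ?_, fun t => ?_, ?_⟩
  · have e1 : Ξ 1 = u + a 1 := ea ⟨by norm_num, le_rfl⟩
    have e0 : Ξ 0 = v + b 0 := eb ⟨le_rfl, by norm_num⟩
    rw [q t, e1, e0]
  · rw [ea t.2, QuotientAddGroup.mk_add, (QuotientAddGroup.eq_zero_iff u).2 hu', zero_add,
      h.lift_w]
  · rw [eb t.2, QuotientAddGroup.mk_add, (QuotientAddGroup.eq_zero_iff v).2 hv', zero_add,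
      h.lift_b]
  · have e : Ξ (1 / 2) = x := by
      rw [ea ⟨le_rfl, by norm_num⟩]
      simp [hu]
    rw [e]
    exact hx

theorem even_path_const {A : AddSubgroup E} (hA : ∀ x ∈ A, ∃ k : ℤ, ⟪x, x⟫_ℝ = 2 * k)
    {D : ℝ → E} (hD : Continuous D) {s : Set ℝ} (hs : IsPreconnected s)
    (hm : ∀ t ∈ s, D t ∈ A) {t₁ t₂ : ℝ} (h₁ : t₁ ∈ s) (h₂ : t₂ ∈ s) : D t₁ = D t₂ := by
  set φ : ℝ → ℝ := fun t => ⟪D t - D t₁, D t - D t₁⟫_ℝ with hφ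
  have hc : ContinuousOn φ s := by fun_prop
  have hi : ∀ t ∈ s, ∃ k : ℤ, φ t = 2 * k := fun t ht => hA _ (sub_mem (hm t ht) (hm _ h₁))
  have h0 : φ t₁ = 0 := by simp [hφ]
  have h2 : φ t₂ = 0 := by
    by_contra hne
    have hge : 0 ≤ φ t₂ := real_inner_self_nonneg
    obtain ⟨k, hk⟩ := hi t₂ h₂
    have hk1 : (1 : ℤ) ≤ k := by
      by_contra hlt
      have : (k : ℝ) ≤ 0 := by exact_mod_cast (by omega : k ≤ 0)
      exact hne (le_antisymm (by linarith) hge)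
    have hk2 : (1 : ℝ) ≤ k := by exact_mod_cast hk1
    obtain ⟨t, ht, h1⟩ := hs.intermediate_value h₁ h₂ hc
      (show (1 : ℝ) ∈ Icc (φ t₁) (φ t₂) from ⟨by rw [h0]; norm_num, by linarith⟩)
    obtain ⟨j, hj⟩ := hi t ht
    rw [h1] at hj
    have : (1 : ℤ) = 2 * j := by exact_mod_cast hj
    omega
  have := inner_self_eq_zero (𝕜 := ℝ).1 h2
  exact (sub_eq_zero.1 this).symm

theorem IsLift.unique {γ : L.loops} {Ξ Ψ : ℝ → E} (hΞ : IsLift γ Ξ) (hΨ : IsLift γ Ψ) :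
    ∃ ν ∈ L.Γ, ∀ t, Ψ t = Ξ t + ν := by
  set D : ℝ → E := fun t => Ψ t - Ξ t with hD
  have hDc : Continuous D := hΨ.smooth.continuous.sub hΞ.smooth.continuous
  have hp : D (1 / 2) ∈ L.Γ := by
    rw [← QuotientAddGroup.eq_zero_iff, hD, QuotientAddGroup.mk_sub, hΞ.lift_p, hΨ.lift_p,
      sub_self]
  have hw : ∀ t ∈ Icc (1 / 2 : ℝ) 1, D t = D (1 / 2) := fun t ht =>
    even_path_const L.even_w hDc isPreconnected_Icc (fun s hs => by
      rw [← QuotientAddGroup.eq_zero_iff, hD, QuotientAddGroup.mk_sub, hΞ.lift_w ⟨s, hs⟩,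
        hΨ.lift_w ⟨s, hs⟩, sub_self]) ht ⟨le_rfl, by norm_num⟩
  have hb : ∀ t ∈ Icc (0 : ℝ) (1 / 2), D t = D (1 / 2) := fun t ht =>
    even_path_const L.even_b hDc isPreconnected_Icc (fun s hs => by
      rw [← QuotientAddGroup.eq_zero_iff, hD, QuotientAddGroup.mk_sub, hΞ.lift_b ⟨s, hs⟩,
        hΨ.lift_b ⟨s, hs⟩, sub_self]) ht ⟨by norm_num, le_rfl⟩
  have h01 : ∀ t ∈ Icc (0 : ℝ) 1, D t = D (1 / 2) := fun t ht => by
    rcases le_total t (1 / 2) with h | h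
    · exact hb t ⟨ht.1, h⟩
    · exact hw t ⟨h, ht.2⟩
  have hper : Function.Periodic D 1 := fun t => by
    have e1 := h01 1 ⟨by norm_num, le_rfl⟩
    have e0 := h01 0 ⟨le_rfl, by norm_num⟩
    have e : Ψ 1 - Ξ 1 = Ψ 0 - Ξ 0 := by simpa [hD] using e1.trans e0.symm
    have : Ψ 1 - Ψ 0 = Ξ 1 - Ξ 0 := by
      rw [sub_eq_sub_iff_add_eq_add] at e ⊢
      rw [e, add_comm]
    simp only [hD, hΞ.quasi t, hΨ.quasi t, this]
    abel
  refine ⟨D (1 / 2), hp, fun t => ?_⟩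
  have : D t = D (1 / 2) := by
    have e : D (Int.fract t) = D t := by
      simpa using hper.sub_zsmul_eq (x := t) ⌊t⌋
    rw [← e]
    exact h01 _ ⟨Int.fract_nonneg t, (Int.fract_lt_one t).le⟩
  rw [← this]
  simp [hD]

theorem IsLift.add {γ ρ : L.loops} {Ξ Ψ : ℝ → E} (hΞ : IsLift γ Ξ) (hΨ : IsLift ρ Ψ) :
    IsLift (γ + ρ) (fun t => Ξ t + Ψ t) where
  smooth := hΞ.smooth.add hΨ.smooth
  quasi t := by rw [hΞ.quasi, hΨ.quasi]; abel
  lift_w t := by simp [hΞ.lift_w t, hΨ.lift_w t]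
  lift_b t := by simp [hΞ.lift_b t, hΨ.lift_b t]
  lift_p := by rw [QuotientAddGroup.mk_add, hΞ.lift_p, hΨ.lift_p]; rfl

/-- A choice of quasi-periodic lift; it is unique up to addition of a constant in `Γ`. -/
def lift (γ : L.loops) : ℝ → E := (exists_isLift γ).choose

theorem isLift_lift (γ : L.loops) : IsLift γ (lift γ) := (exists_isLift γ).choose_spec

theorem IsLift.diff_eq {γ : L.loops} {Ξ : ℝ → E} (h : IsLift γ Ξ) :
    Ξ 1 - Ξ 0 = lift γ 1 - lift γ 0 := by
  obtain ⟨ν, -, hν⟩ := (isLift_lift γ).unique h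
  simp [hν]

theorem midQ_sub (γ : L.loops) : ∃ y : E, (y : E ⧸ L.Γ) = midQ γ ∧
    y - lift γ 1 ∈ L.Λw ∧ y - lift γ 0 ∈ L.Λb := by
  obtain ⟨y, hy⟩ := QuotientAddGroup.mk_surjective (midQ γ)
  obtain ⟨-, -, h3, h4, -⟩ := γ.2
  rw [show γ.1.2.2.2 = midQ γ from rfl, ← hy] at h3 h4
  replace h3 : (y : E ⧸ L.Λw) = _ := h3
  replace h4 : (y : E ⧸ L.Λb) = _ := h4
  refine ⟨y, hy, ?_, ?_⟩
  · rw [← QuotientAddGroup.eq_zero_iff, QuotientAddGroup.mk_sub, h3,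
      (isLift_lift γ).lift_w ⟨1, by norm_num, by norm_num⟩, sub_self]
  · rw [← QuotientAddGroup.eq_zero_iff, QuotientAddGroup.mk_sub, h4,
      (isLift_lift γ).lift_b ⟨0, by norm_num, by norm_num⟩, sub_self]

/-- The winding element `Δ' ∘ Pth : L(T○, H, T●) → Λ○ - Λ●`. -/
def winding : L.loops →+ L.diff where
  toFun γ := ⟨lift γ 1 - lift γ 0, by
    obtain ⟨y, -, hw, hb⟩ := midQ_sub γ
    exact ⟨-(y - lift γ 1), neg_mem hw, -(y - lift γ 0), neg_mem hb, by abel⟩⟩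
  map_zero' := by
    ext
    have h : IsLift (0 : L.loops) (fun _ => 0) :=
      ⟨contDiff_const, by simp, fun _ => rfl, fun _ => rfl, rfl⟩
    simpa using h.diff_eq.symm
  map_add' γ ρ := by
    ext
    have := ((isLift_lift γ).add (isLift_lift ρ)).diff_eq
    simp only [AddSubgroup.coe_add]
    rw [← this]
    abel

/-! ### Rotations -/

/-- The action of the rotation `Φ_θ : t ↦ t + θ` on bicoloured loops: if `Ξ` is a quasi-periodic
lift of `γ`, then the path of `Φ_θ · γ` has the lift `t ↦ Ξ(t - θ)`, and
`(Φ_θ · γ)_m(q) = γ_m(q) - Ξ(0) + Ξ(-θ)`. -/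
def rotLoop (θ : ℝ) (γ : L.loops) : L.loops :=
  ⟨(fun t => (lift γ (t - θ) : E), fun t => (lift γ (t - θ) : E), (lift γ (1 / 2 - θ) : E),
    midQ γ - (lift γ 0 : E) + (lift γ (-θ) : E)), by
    have hl := isLift_lift γ
    obtain ⟨y, hy, hw, hb⟩ := midQ_sub γ
    have hsm : ContDiff ℝ ∞ (fun t => lift γ (t - θ)) := hl.smooth.comp (by fun_prop)
    refine ⟨rfl, rfl, ?_, ?_, fun t => lift γ (t - θ), fun t => lift γ (t - θ), ?_⟩
    · dsimp only
      rw [← hy, ← QuotientAddGroup.mk_sub, ← QuotientAddGroup.mk_add]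
      change ((_ : E) : E ⧸ L.Λw) = _
      rw [QuotientAddGroup.eq_iff_sub_mem]
      have : lift γ (1 - θ) = lift γ (-θ) + (lift γ 1 - lift γ 0) := by
        rw [← hl.quasi]; ring_nf
      rw [this]
      convert hw using 1
      rw [AddMonoidHom.id_apply]
      abel
    · dsimp only
      rw [← hy, ← QuotientAddGroup.mk_sub, ← QuotientAddGroup.mk_add]
      change ((_ : E) : E ⧸ L.Λb) = _
      rw [QuotientAddGroup.eq_iff_sub_mem, zero_sub]
      convert hb using 1
      rw [AddMonoidHom.id_apply]
      abel
    · refine ⟨hsm.contDiffOn, hsm.contDiffOn, fun _ => rfl, fun _ => rfl, fun k hk => ?_,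
        fun k hk => ?_⟩
      · rw [iteratedDerivWithin_mono_Icc (c := 0) (d := 1) (by norm_num) (by norm_num)
          (Icc_subset_Icc (by norm_num) le_rfl) hsm.contDiffOn ⟨le_rfl, by norm_num⟩,
          iteratedDerivWithin_mono_Icc (c := 0) (d := 1) (by norm_num) (by norm_num)
          (Icc_subset_Icc le_rfl (by norm_num)) hsm.contDiffOn ⟨by norm_num, le_rfl⟩]
      · have e := iteratedDerivWithin_Icc_shift (a := 1) (b := 2) (t := 1) (s := 1)
          (f := fun t => lift γ (t - θ)) (g := fun t => lift γ (t - θ))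
          (v := lift γ 1 - lift γ 0) (fun t _ => by rw [← hl.quasi]; ring_nf) hk
          ⟨le_rfl, by norm_num⟩
        norm_num only at e
        rw [iteratedDerivWithin_mono_Icc (c := 0) (d := 2) (by norm_num) (by norm_num)
          (Icc_subset_Icc (by norm_num) (by norm_num)) hsm.contDiffOn ⟨by norm_num, le_rfl⟩,
          ← iteratedDerivWithin_mono_Icc (a := 1) (b := 2) (by norm_num) (by norm_num)
          (Icc_subset_Icc (by norm_num) le_rfl) hsm.contDiffOn ⟨le_rfl, by norm_num⟩, e]
        rw [iteratedDerivWithin_mono_Icc (a := 0) (b := 1 / 2) (c := 0) (d := 1) (by norm_num)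
          (by norm_num) (Icc_subset_Icc le_rfl (by norm_num)) hsm.contDiffOn
          ⟨le_rfl, by norm_num⟩]⟩

/-! ### The central extension -/

/-- `S'(ξ, η) = ½ ∫₀¹ ⟨ξ'(t), η(t)⟩ dt + ½ ⟨ξ(1) - ξ(0), η(0)⟩`. -/
def actionForm (Ξ Ψ : ℝ → E) : ℝ :=
  1 / 2 * (∫ t in (0 : ℝ)..1, ⟪deriv Ξ t, Ψ t⟫_ℝ) + 1 / 2 * ⟪Ξ 1 - Ξ 0, Ψ 0⟫_ℝ

theorem integrable_deriv_inner {Ξ Ψ : ℝ → E} (hΞ : ContDiff ℝ ∞ Ξ) (hΨ : ContDiff ℝ ∞ Ψ) :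
    IntervalIntegrable (fun t => ⟪deriv Ξ t, Ψ t⟫_ℝ) MeasureTheory.volume 0 1 :=
  ((hΞ.continuous_deriv (by simp)).inner hΨ.continuous).intervalIntegrable _ _

theorem actionForm_add_left {Ξ Ξ' Ψ : ℝ → E} (hΞ : ContDiff ℝ ∞ Ξ) (hΞ' : ContDiff ℝ ∞ Ξ')
    (hΨ : ContDiff ℝ ∞ Ψ) :
    actionForm (fun t => Ξ t + Ξ' t) Ψ = actionForm Ξ Ψ + actionForm Ξ' Ψ := by
  have hd : ∀ t, deriv (fun t => Ξ t + Ξ' t) t = deriv Ξ t + deriv Ξ' t := fun t =>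
    deriv_fun_add (hΞ.differentiable (by simp) t) (hΞ'.differentiable (by simp) t)
  simp only [actionForm, hd, inner_add_left, inner_sub_left]
  rw [intervalIntegral.integral_add (integrable_deriv_inner hΞ hΨ)
    (integrable_deriv_inner hΞ' hΨ)]
  ring

theorem actionForm_add_right {Ξ Ψ Ψ' : ℝ → E} (hΞ : ContDiff ℝ ∞ Ξ) (hΨ : ContDiff ℝ ∞ Ψ)
    (hΨ' : ContDiff ℝ ∞ Ψ') :
    actionForm Ξ (fun t => Ψ t + Ψ' t) = actionForm Ξ Ψ + actionForm Ξ Ψ' := by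
  simp only [actionForm, inner_add_right]
  rw [intervalIntegral.integral_add (integrable_deriv_inner hΞ hΨ)
    (integrable_deriv_inner hΞ hΨ')]
  ring

theorem actionForm_const_left (ν : E) (Ψ : ℝ → E) : actionForm (fun _ => ν) Ψ = 0 := by
  simp [actionForm]

theorem actionForm_const_right {Ξ : ℝ → E} (hΞ : ContDiff ℝ ∞ Ξ) (ν : E) :
    actionForm Ξ (fun _ => ν) = ⟪Ξ 1 - Ξ 0, ν⟫_ℝ := by
  have hd : ∀ t ∈ uIcc (0 : ℝ) 1, HasDerivAt (fun t => ⟪Ξ t, ν⟫_ℝ) ⟪deriv Ξ t, ν⟫_ℝ t :=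
    fun t _ => by
      simpa using (hΞ.differentiable (by simp) t).hasDerivAt.inner ℝ (hasDerivAt_const t ν)
  have := intervalIntegral.integral_eq_sub_of_hasDerivAt hd
    (integrable_deriv_inner hΞ (contDiff_const (c := ν)))
  simp only [actionForm, this, inner_sub_left]
  ring

theorem IsLift.expI_actionForm {γ ρ : L.loops} {Ξ Ψ : ℝ → E} (hΞ : IsLift γ Ξ)
    (hΨ : IsLift ρ Ψ) : expI (actionForm Ξ Ψ) = expI (actionForm (lift γ) (lift ρ)) := by
  obtain ⟨μ, hμ, h⟩ := (isLift_lift γ).unique hΞ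
  obtain ⟨ν, hν, k⟩ := (isLift_lift ρ).unique hΨ
  obtain ⟨j, hj⟩ := L.int_diff_inter (winding γ).2 (L.Γ_le_inter hν)
  rw [show Ξ = fun t => lift γ t + μ from funext h,
    show Ψ = fun t => lift ρ t + ν from funext k,
    actionForm_add_left (isLift_lift γ).smooth contDiff_const
      ((isLift_lift ρ).smooth.add contDiff_const), actionForm_const_left, add_zero,
    actionForm_add_right (isLift_lift γ).smooth (isLift_lift ρ).smooth contDiff_const,
    actionForm_const_right (isLift_lift γ).smooth, expI_add]
  rw [show ⟪lift γ 1 - lift γ 0, ν⟫_ℝ = j from hj, expI_int, mul_one]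

variable (L) in
/-- The choice of a normalised `𝕋`-valued 2-cocycle `ε` on `Λ○ - Λ●` whose commutator map
`ε(λ, μ) ε(μ, λ)⁻¹` equals `exp 2πi(½⟨μ, λ⟩ + ⟨μ, λ●⟩)` for `λ = λ○ - λ●`. -/
structure WindingCocycle where
  ε : L.diff → L.diff → Circle
  zero_left : ∀ x, ε 0 x = 1
  zero_right : ∀ x, ε x 0 = 1
  cocycle : ∀ x y z, ε x y * ε (x + y) z = ε x (y + z) * ε y z
  commutator : ∀ x y : L.diff, ∀ a ∈ L.Λw, ∀ b ∈ L.Λb, (x : E) = a - b →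
    ε x y * (ε y x)⁻¹ = expI (1 / 2 * ⟪(y : E), (x : E)⟫_ℝ + ⟪(y : E), b⟫_ℝ)

/-- The 2-cocycle `c` on `L(T○, H, T●)`. -/
def loopCocycle (ε : L.WindingCocycle) (γ ρ : L.loops) : Circle :=
  ε.ε (winding γ) (winding ρ) * expI (actionForm (lift γ) (lift ρ))

theorem expI_action_add_left (γ ρ σ : L.loops) :
    expI (actionForm (lift (γ + ρ)) (lift σ)) =
      expI (actionForm (lift γ) (lift σ)) * expI (actionForm (lift ρ) (lift σ)) := by
  rw [← ((isLift_lift γ).add (isLift_lift ρ)).expI_actionForm (isLift_lift σ),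
    actionForm_add_left (isLift_lift γ).smooth (isLift_lift ρ).smooth (isLift_lift σ).smooth,
    expI_add]

theorem expI_action_add_right (γ ρ σ : L.loops) :
    expI (actionForm (lift γ) (lift (ρ + σ))) =
      expI (actionForm (lift γ) (lift ρ)) * expI (actionForm (lift γ) (lift σ)) := by
  rw [← (isLift_lift γ).expI_actionForm ((isLift_lift ρ).add (isLift_lift σ)),
    actionForm_add_right (isLift_lift γ).smooth (isLift_lift ρ).smooth (isLift_lift σ).smooth,
    expI_add]

theorem loopCocycle_cocycle (ε : L.WindingCocycle) (γ ρ σ : L.loops) :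
    loopCocycle ε γ ρ * loopCocycle ε (γ + ρ) σ =
      loopCocycle ε γ (ρ + σ) * loopCocycle ε ρ σ := by
  have h := ε.cocycle (winding γ) (winding ρ) (winding σ)
  simp only [loopCocycle, map_add, expI_action_add_left, expI_action_add_right]
  generalize expI (actionForm (lift γ) (lift ρ)) = A
  generalize expI (actionForm (lift γ) (lift σ)) = B
  generalize expI (actionForm (lift ρ) (lift σ)) = C
  rw [mul_mul_mul_comm, h]
  generalize ε.ε (winding γ) (winding ρ + winding σ) = X
  generalize ε.ε (winding ρ) (winding σ) = Y
  ac_rfl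

theorem loopCocycle_zero_left (ε : L.WindingCocycle) (γ : L.loops) : loopCocycle ε 0 γ = 1 := by
  have h := expI_action_add_left 0 0 γ
  rw [add_zero, left_eq_mul] at h
  rw [loopCocycle, map_zero, ε.zero_left, h, one_mul]

theorem loopCocycle_zero_right (ε : L.WindingCocycle) (γ : L.loops) :
    loopCocycle ε γ 0 = 1 := by
  have h := expI_action_add_right γ 0 0
  rw [add_zero, left_eq_mul] at h
  rw [loopCocycle, map_zero, ε.zero_right, h, one_mul]

/-- The central extension of `L(T○, H, T●)` by `𝕋` with underlying set `L(T○, H, T●) × 𝕋`. -/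
@[ext] structure Ext (ε : L.WindingCocycle) where
  loop : L.loops
  phase : Circle

instance (ε : L.WindingCocycle) : Mul (Ext ε) :=
  ⟨fun x y => ⟨x.loop + y.loop, x.phase * y.phase * loopCocycle ε x.loop y.loop⟩⟩

instance (ε : L.WindingCocycle) : One (Ext ε) := ⟨⟨0, 1⟩⟩

instance (ε : L.WindingCocycle) : Inv (Ext ε) :=
  ⟨fun x => ⟨-x.loop, x.phase⁻¹ * (loopCocycle ε (-x.loop) x.loop)⁻¹⟩⟩

theorem Ext.mul_def {ε : L.WindingCocycle} (x y : Ext ε) :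
    x * y = ⟨x.loop + y.loop, x.phase * y.phase * loopCocycle ε x.loop y.loop⟩ := rfl

theorem Ext.one_def {ε : L.WindingCocycle} : (1 : Ext ε) = ⟨0, 1⟩ := rfl

theorem Ext.inv_def {ε : L.WindingCocycle} (x : Ext ε) :
    x⁻¹ = ⟨-x.loop, x.phase⁻¹ * (loopCocycle ε (-x.loop) x.loop)⁻¹⟩ := rfl

instance (ε : L.WindingCocycle) : Group (Ext ε) :=
  Group.ofLeftAxioms
    (fun x y z => by
      have h := loopCocycle_cocycle ε x.loop y.loop z.loop
      simp only [Ext.mul_def, Ext.mk.injEq, add_assoc, true_and]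
      generalize loopCocycle ε x.loop (y.loop + z.loop) = A at *
      generalize loopCocycle ε y.loop z.loop = B at *
      rw [mul_right_comm (x.phase * y.phase), mul_assoc _ _ (loopCocycle ε _ _), h]
      ac_rfl)
    (fun x => by
      simp [Ext.mul_def, Ext.one_def, loopCocycle_zero_left])
    (fun x => by
      simp only [Ext.mul_def, Ext.one_def, Ext.inv_def, neg_add_cancel, Ext.mk.injEq, true_and]
      rw [mul_right_comm, mul_assoc (x.phase⁻¹)]
      simp)

/-- The subgroup of the central extension lying over `ker(Δ' ∘ Pth)`. -/
def Ext.ker (ε : L.WindingCocycle) : Subgroup (Ext ε) where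
  carrier := {x | winding x.loop = 0}
  one_mem' := map_zero winding
  mul_mem' {x y} hx hy := by
    change winding (x.loop + y.loop) = 0
    rw [map_add, show winding x.loop = 0 from hx, show winding y.loop = 0 from hy, add_zero]
  inv_mem' {x} hx := by
    change winding (-x.loop) = 0
    rw [map_neg, show winding x.loop = 0 from hx, neg_zero]

/-- The action of the rotation `Φ_θ` on the central extension:
`Φ_θ · (γ, z) = (Φ_θ · γ, e^{πi⟨Ξ(-θ) - Ξ(0), Δ'⟩} z)`, where `Δ'` is the winding element of
`γ`. -/
def Ext.rot {ε : L.WindingCocycle} (θ : ℝ) (x : Ext ε) : Ext ε :=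
  ⟨rotLoop θ x.loop, expI (1 / 2 * ⟪lift x.loop (-θ) - lift x.loop 0,
    ((winding x.loop : L.diff) : E)⟫_ℝ) * x.phase⟩

end LatticeSpan

/-! ### Bosonic Fock spaces -/

section Fock

variable (H : Type*) [NormedAddCommGroup H] [InnerProductSpace ℂ H]

/-- Formal complex linear combinations of monomials `x₀ x₁ ⋯ x_{k-1}` of degree `k` in vectors
of `H`. -/
def MonomialSpace (k : ℕ) : Type _ := (Fin k → H) →₀ ℂ

instance (k : ℕ) : AddCommGroup (MonomialSpace H k) :=
  inferInstanceAs (AddCommGroup ((Fin k → H) →₀ ℂ))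

instance (k : ℕ) : Module ℂ (MonomialSpace H k) :=
  inferInstanceAs (Module ℂ ((Fin k → H) →₀ ℂ))

variable {H}

/-- The pairing `∑_σ ∏_i ⟨x_i, y_{σ i}⟩` of two monomials of degree `k`. -/
def monomialPairing {k : ℕ} (x y : Fin k → H) : ℂ :=
  ∑ σ : Equiv.Perm (Fin k), ∏ i, ⟪x i, y (σ i)⟫_ℂ

theorem monomialPairing_conj {k : ℕ} (x y : Fin k → H) :
    (starRingEnd ℂ) (monomialPairing y x) = monomialPairing x y := by
  simp only [monomialPairing, map_sum, map_prod, inner_conj_symm]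
  rw [← Equiv.sum_comp (Equiv.inv (Equiv.Perm (Fin k)))]
  refine Finset.sum_congr rfl fun σ _ => ?_
  rw [← Equiv.prod_comp σ]
  simp

open scoped ComplexOrder in
theorem gramKernel_posSemidef {X G : Type*} [NormedAddCommGroup G] [InnerProductSpace ℂ G]
    (v : X → G) : (Matrix.of fun x y : X => ⟪v x, v y⟫_ℂ).PosSemidef := by
  refine ⟨Matrix.ext fun x y => by simp, fun f => ?_⟩
  have : (f.sum fun i a => f.sum fun j b => star a * ⟪v i, v j⟫_ℂ * b) =
      ⟪f.sum fun i a => a • v i, f.sum fun i a => a • v i⟫_ℂ := by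
    simp only [Finsupp.sum, sum_inner, inner_sum, inner_smul_left, inner_smul_right,
      Finset.mul_sum, RCLike.star_def]
    rw [Finset.sum_comm]
    exact Finset.sum_congr rfl fun x _ => Finset.sum_congr rfl fun y _ => by ring
  simp only [Matrix.of_apply, this]
  rw [inner_self_eq_norm_sq_to_K]
  positivity

open scoped ComplexOrder in
theorem tensorKernel_posSemidef (k : ℕ) (s : Finset (Fin k)) :
    (Matrix.of fun x y : Fin k → H => ∏ i ∈ s, ⟪x i, y i⟫_ℂ).PosSemidef := by
  classical
  induction s using Finset.induction_on with
  | empty => simpa using gramKernel_posSemidef (fun _ : Fin k → H => (1 : ℂ))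
  | insert a s ha ih =>
    have h := (gramKernel_posSemidef (fun x : Fin k → H => x a)).hadamard ih
    simp only [Finset.prod_insert ha]
    exact h

/-- The sesquilinear extension of `monomialPairing` to formal linear combinations. -/
def monomialForm {k : ℕ} (f g : (Fin k → H) →₀ ℂ) : ℂ :=
  f.sum fun x a => g.sum fun y b => (starRingEnd ℂ) a * monomialPairing x y * b

theorem monomialForm_conj {k : ℕ} (f g : (Fin k → H) →₀ ℂ) :
    (starRingEnd ℂ) (monomialForm g f) = monomialForm f g := by
  simp only [monomialForm, Finsupp.sum, map_sum, map_mul, monomialPairing_conj,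
    Complex.conj_conj]
  rw [Finset.sum_comm]
  exact Finset.sum_congr rfl fun x _ => Finset.sum_congr rfl fun y _ => by ring

theorem monomialForm_add_left {k : ℕ} (f g h : (Fin k → H) →₀ ℂ) :
    monomialForm (f + g) h = monomialForm f h + monomialForm g h := by
  classical
  refine Finsupp.sum_add_index' (fun x => by simp) fun x a b => ?_
  rw [← Finsupp.sum_add]
  exact Finsupp.sum_congr fun y _ => by rw [map_add]; ring

theorem monomialForm_smul_left {k : ℕ} (f g : (Fin k → H) →₀ ℂ) (r : ℂ) :
    monomialForm (r • f) g = (starRingEnd ℂ) r * monomialForm f g := by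
  refine (Finsupp.sum_smul_index (fun x => by simp)).trans ?_
  simp only [monomialForm, Finsupp.sum, Finset.mul_sum]
  exact Finset.sum_congr rfl fun x _ => Finset.sum_congr rfl fun y _ => by
    rw [map_mul]; ring

open scoped ComplexOrder in
theorem monomialForm_self_nonneg {k : ℕ} (f : (Fin k → H) →₀ ℂ) :
    0 ≤ monomialForm f f := by
  classical
  let T : (Fin k → H) → (Fin k → H) → ℂ := fun x y => ∏ i, ⟪x i, y i⟫_ℂ
  let g : (Fin k → H) →₀ ℂ := ∑ τ : Equiv.Perm (Fin k), f.mapDomain (fun x => x ∘ τ)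
  let B : ((Fin k → H) →₀ ℂ) → ((Fin k → H) →₀ ℂ) → ℂ := fun f g =>
    f.sum fun x a => g.sum fun y b => (starRingEnd ℂ) a * T x y * b
  have hB1 : ∀ (s : Finset (Equiv.Perm (Fin k))) (u : Equiv.Perm (Fin k) → (Fin k → H) →₀ ℂ) v,
      B (∑ τ ∈ s, u τ) v = ∑ τ ∈ s, B (u τ) v := fun s u v => by
    refine (Finsupp.sum_finsetSum_index (fun x => by simp) fun x a b => ?_).symm
    rw [← Finsupp.sum_add]
    exact Finsupp.sum_congr fun y _ => by rw [map_add]; ring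
  have hB2 : ∀ (s : Finset (Equiv.Perm (Fin k))) (u : Equiv.Perm (Fin k) → (Fin k → H) →₀ ℂ) v,
      B v (∑ τ ∈ s, u τ) = ∑ τ ∈ s, B v (u τ) := fun s u v => by
    simp only [B]
    rw [← Finsupp.sum_finsetSum_comm]
    refine Finsupp.sum_congr fun x _ => ?_
    exact (Finsupp.sum_finsetSum_index (fun x => by simp) fun y a b => by ring).symm
  have hg : B g g = (k.factorial : ℂ) *
      f.sum fun x a => f.sum fun y b => (starRingEnd ℂ) a * monomialPairing x y * b := by
    have hst : ∀ σ τ : Equiv.Perm (Fin k),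
        B (f.mapDomain (fun x => x ∘ σ)) (f.mapDomain (fun x => x ∘ τ)) =
        f.sum fun x a => f.sum fun y b =>
          (starRingEnd ℂ) a * (∏ i, ⟪x i, y ((τ * σ⁻¹) i)⟫_ℂ) * b := fun σ τ => by
      simp only [B]
      rw [Finsupp.sum_mapDomain_index (fun x => by simp) fun x a b => by
        rw [← Finsupp.sum_add]
        exact Finsupp.sum_congr fun y _ => by rw [map_add]; ring]
      refine Finsupp.sum_congr fun x _ => ?_
      rw [Finsupp.sum_mapDomain_index (fun x => by simp) fun x a b => by ring]
      refine Finsupp.sum_congr fun y _ => ?_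
      have : T (x ∘ σ) (y ∘ τ) = ∏ i, ⟪x i, y ((τ * σ⁻¹) i)⟫_ℂ := by
        simp only [T]
        rw [← Equiv.prod_comp σ (fun i => ⟪x i, y ((τ * σ⁻¹) i)⟫_ℂ)]
        simp
      rw [this]
    simp only [g]
    rw [hB1]
    have : ∀ σ : Equiv.Perm (Fin k), B (f.mapDomain (fun x => x ∘ σ))
        (∑ τ : Equiv.Perm (Fin k), f.mapDomain (fun x => x ∘ τ)) =
        f.sum fun x a => f.sum fun y b => (starRingEnd ℂ) a * monomialPairing x y * b := by
      intro σ
      rw [hB2]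
      simp only [hst]
      rw [← Equiv.sum_comp (Equiv.mulRight σ)]
      simp only [Equiv.coe_mulRight, mul_inv_cancel_right]
      simp only [monomialPairing, Finsupp.sum, Finset.mul_sum, Finset.sum_mul]
      rw [Finset.sum_comm]
      refine Finset.sum_congr rfl fun x _ => ?_
      rw [Finset.sum_comm]
    simp only [this, Finset.sum_const, Finset.card_univ, Fintype.card_perm, Fintype.card_fin,
      nsmul_eq_mul]
  have hpos : 0 ≤ B g g := by
    have := (tensorKernel_posSemidef (H := H) k Finset.univ).2 g
    simpa [B, T] using this
  rw [hg] at hpos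
  have hk : (0 : ℝ) < (k.factorial : ℝ) := by exact_mod_cast k.factorial_pos
  rw [← Complex.ofReal_natCast, Complex.le_def, Complex.re_ofReal_mul, Complex.im_ofReal_mul,
    Complex.zero_re, Complex.zero_im, zero_eq_mul] at hpos
  exact Complex.le_def.2 ⟨(mul_nonneg_iff_of_pos_left hk).1 hpos.1,
    (hpos.2.resolve_left hk.ne').symm⟩

/-- The semi-inner product on `MonomialSpace H k` extending `monomialPairing`. -/
@[reducible] def monomialCore (k : ℕ) : PreInnerProductSpace.Core ℂ (MonomialSpace H k) where
  inner f g := monomialForm f g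
  conj_inner_symm f g := monomialForm_conj f g
  re_inner_nonneg f := (Complex.le_def.1 (monomialForm_self_nonneg f)).1
  add_left f g h := monomialForm_add_left f g h
  smul_left f g r := monomialForm_smul_left f g r

instance (k : ℕ) : SeminormedAddCommGroup (MonomialSpace H k) :=
  @InnerProductSpace.Core.toSeminormedAddCommGroup ℂ _ _ _ _ (monomialCore k)

instance (k : ℕ) : InnerProductSpace ℂ (MonomialSpace H k) :=
  InnerProductSpace.ofCore (monomialCore k)

/-- A monomial `x₀ x₁ ⋯ x_{k-1}` as an element of `MonomialSpace H k`. -/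
def MonomialSpace.of {k : ℕ} (x : Fin k → H) : MonomialSpace H k := Finsupp.single x 1

variable (H) in
/-- The Hilbert space completion of the `k`-th symmetric power of `H`. Passing to the completion
divides out the null vectors of the form, which are the relations of multilinearity and
commutativity between monomials. -/
abbrev SymPower (k : ℕ) : Type _ := UniformSpace.Completion (MonomialSpace H k)

variable (H) in
/-- The bosonic Fock space: the Hilbert space direct sum of the symmetric powers of `H`. -/
abbrev Fock : Type _ := lp (fun k : ℕ => SymPower H k) 2

/-- The monomial `x₀ x₁ ⋯ x_{k-1}` as a vector of the Fock space. -/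
def Fock.monomial (x : Σ k : ℕ, Fin k → H) : Fock H :=
  lp.single 2 x.1 (MonomialSpace.of x.2 : SymPower H x.1)

/-- The coherent vector `e^κ = ∑_k κ^k / k!`. -/
def Fock.coherent (κ : H) : Fock H :=
  ∑' k : ℕ, ((k.factorial : ℂ)⁻¹) • Fock.monomial ⟨k, fun _ => κ⟩

/-- The Weyl operator `W(ξ, z)`, the bounded operator determined by
`W(ξ, z) e^κ = z exp(-½⟨ξ, ξ⟩ - ⟨ξ, κ⟩) e^{κ + ξ}`, the inner product being antilinear in its first
argument. -/
def Fock.weyl (ξ : H) (z : Circle) : Fock H →L[ℂ] Fock H :=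
  LinearMap.extendOfNorm
    (Finsupp.linearCombination ℂ fun κ : H =>
      ((z : ℂ) * Complex.exp (-(1 / 2) * ⟪ξ, ξ⟫_ℂ - ⟪ξ, κ⟫_ℂ)) • Fock.coherent (κ + ξ))
    (Finsupp.linearCombination ℂ (Fock.coherent : H → Fock H))

/-- The operator on the Fock space that applies the isometry `g` to each factor of a monomial. -/
def Fock.map (g : H →ₗᵢ[ℂ] H) : Fock H →L[ℂ] Fock H :=
  LinearMap.extendOfNorm
    (Finsupp.linearCombination ℂ fun x : (Σ k : ℕ, Fin k → H) =>
      (Fock.monomial ⟨x.1, fun i => g (x.2 i)⟩ : Fock H))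
    (Finsupp.linearCombination ℂ (Fock.monomial : (Σ k : ℕ, Fin k → H) → Fock H))

end Fock

/-! ### The one-particle space

The space `V𝔥` of smooth periodic `ξ : ℝ → 𝔥` of mean zero carries the skew form
`S(ξ, η) = ½ ∫ ⟨ξ', η⟩`. The map `modes` below identifies the completion of `V𝔥`, for the complex
structure that is multiplication by `±i` on the Fourier modes and is positive with respect to `S`,
with `OneParticle E`; the inner product (antilinear in its first argument) satisfies
`Im ⟨modes ξ, modes η⟩ = -2π S(ξ, η)`. -/

section OneParticle

variable [FiniteDimensional ℝ E]

variable (E) in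
/-- The one-particle Hilbert space: sequences `(x_k)_{k ≥ 1}` in the complexification of `E` with
`∑_k ‖x_k‖² < ∞`, written in coordinates with respect to an orthonormal basis of `E`; the index
`(j, i)` stands for the `i`-th coordinate of `x_{j+1}`. -/
abbrev OneParticle : Type _ := lp (fun _ : ℕ × Fin (Module.finrank ℝ E) => ℂ) 2

/-- The coordinates of `x_k = 2π √k ∫₀¹ e^{2πikt} ξ(t) dt`, for `k ≥ 1`. -/
def modeCoord (ξ : ℝ → E) (p : ℕ × Fin (Module.finrank ℝ E)) : ℂ :=
  2 * Real.pi * Real.sqrt (p.1 + 1) * ∫ t in (0 : ℝ)..1,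
    Complex.exp (2 * Real.pi * Complex.I * (p.1 + 1) * t) *
      (⟪stdOrthonormalBasis ℝ E p.2, ξ t⟫_ℝ : ℂ)

theorem integral_exp_mul_periodic {f f' : ℝ → ℂ} (hf : ∀ t, HasDerivAt f (f' t) t)
    (hf' : Continuous f') (hper : f 1 = f 0) (k : ℕ) :
    ∫ t in (0 : ℝ)..1, Complex.exp (2 * Real.pi * Complex.I * (k + 1) * t) * f t =
      -(2 * Real.pi * Complex.I * (k + 1))⁻¹ *
        ∫ t in (0 : ℝ)..1, Complex.exp (2 * Real.pi * Complex.I * (k + 1) * t) * f' t := by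
  set c : ℂ := 2 * Real.pi * Complex.I * (k + 1) with hc
  have hk : (k + 1 : ℂ) ≠ 0 := by exact_mod_cast k.succ_ne_zero
  have hc0 : c ≠ 0 := by
    simp [hc, Real.pi_ne_zero, Complex.I_ne_zero, hk]
  have he : ∀ t : ℝ, HasDerivAt (fun t : ℝ => c⁻¹ * Complex.exp (c * t)) (Complex.exp (c * t)) t :=
    fun t => by
      have h1 : HasDerivAt (fun t : ℝ => c * (t : ℂ)) c t := by
        simpa using (Complex.ofRealCLM.hasDerivAt (x := t)).const_mul c
      have h2 := (h1.cexp).const_mul c⁻¹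
      rwa [mul_comm (Complex.exp _), inv_mul_cancel_left₀ hc0] at h2
  have h := intervalIntegral.integral_mul_deriv_eq_deriv_mul (a := 0) (b := 1)
    (fun t _ => hf t) (fun t _ => he t) (hf'.intervalIntegrable 0 1)
    ((by fun_prop : Continuous fun t : ℝ => Complex.exp (c * t)).intervalIntegrable 0 1)
  have h1 : Complex.exp c = 1 := by
    rw [hc, show (2 * Real.pi * Complex.I * (k + 1) : ℂ) = ((k + 1 : ℕ) : ℂ) *
      (2 * Real.pi * Complex.I) by push_cast; ring]
    exact Complex.exp_nat_mul_two_pi_mul_I _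
  simp only [mul_comm (Complex.exp _)]
  rw [h, hper]
  simp only [Complex.ofReal_one, mul_one, h1, Complex.ofReal_zero, mul_zero, Complex.exp_zero,
    sub_self, zero_sub, neg_mul, neg_inj]
  rw [← intervalIntegral.integral_const_mul]
  exact intervalIntegral.integral_congr fun t _ => by ring

/-- The Fourier modes of a smooth periodic function are square-summable. -/
theorem memℓp_modeCoord {ξ : ℝ → E} (hξ : ContDiff ℝ ∞ ξ) (hper : ∀ t, ξ (t + 1) = ξ t) :
    Memℓp (modeCoord ξ) 2 := by
  let f : Fin (Module.finrank ℝ E) → ℝ → ℝ := fun i t => ⟪stdOrthonormalBasis ℝ E i, ξ t⟫_ℝ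
  have hf : ∀ i, ContDiff ℝ ∞ (f i) := fun i => contDiff_const.inner ℝ hξ
  have hfp : ∀ i, (f i) 1 = f i 0 := fun i => by simp [f, ← hper 0]
  have hf' : ∀ i, ContDiff ℝ ∞ (deriv (f i)) := fun i =>
    ((contDiff_infty_iff_deriv (f := f i)).1 (hf i)).2
  have hf'' : ∀ i, Continuous (deriv (deriv (f i))) := fun i => (hf' i).continuous_deriv (by simp)
  have hfp' : ∀ i, deriv (f i) 1 = deriv (f i) 0 := fun i => by
    have : f i = fun t => f i (t + 1) := funext fun t => by simp [f, hper]
    conv_rhs => rw [this, deriv_comp_add_const]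
    simp
  let C : Fin (Module.finrank ℝ E) → ℝ := fun i => ∫ t in (0 : ℝ)..1, |deriv (deriv (f i)) t|
  have hC : ∀ i, 0 ≤ C i := fun i =>
    intervalIntegral.integral_nonneg zero_le_one fun t _ => abs_nonneg _
  have key : ∀ p, ‖modeCoord ξ p‖ ^ 2 ≤ (1 / ((p.1 : ℝ) + 1) ^ 2) * C p.2 ^ 2 := by
    rintro ⟨k, i⟩
    have d1 : ∀ t, HasDerivAt (fun t => (f i t : ℂ)) ((deriv (f i) t : ℝ) : ℂ) t := fun t =>
      (((hf i).differentiable (by simp) t).hasDerivAt).ofReal_comp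
    have d2 : ∀ t, HasDerivAt (fun t => ((deriv (f i) t : ℝ) : ℂ))
        ((deriv (deriv (f i)) t : ℝ) : ℂ) t :=
      fun t => (((hf' i).differentiable (by simp) t).hasDerivAt).ofReal_comp
    have e1 := integral_exp_mul_periodic d1
      (Complex.continuous_ofReal.comp (hf' i).continuous) (by simp [hfp]) k
    rw [integral_exp_mul_periodic d2
      (Complex.continuous_ofReal.comp (hf'' i)) (by simp [hfp']) k] at e1
    have hb : ‖∫ t in (0 : ℝ)..1, Complex.exp (2 * Real.pi * Complex.I * (k + 1) * t) *
        ((deriv (deriv (f i)) t : ℝ) : ℂ)‖ ≤ C i := by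
      refine (intervalIntegral.norm_integral_le_integral_norm zero_le_one).trans (le_of_eq ?_)
      refine intervalIntegral.integral_congr fun t _ => ?_
      have : Complex.exp (2 * Real.pi * Complex.I * (k + 1) * t) =
          Complex.exp ((2 * Real.pi * (k + 1) * t : ℝ) * Complex.I) := by
        congr 1; push_cast; ring
      simp only [norm_mul, this, Complex.norm_exp_ofReal_mul_I, one_mul, Complex.norm_real,
        Real.norm_eq_abs]
    have hmode : modeCoord ξ (k, i) = 2 * Real.pi * Real.sqrt (k + 1) *
        ∫ t in (0 : ℝ)..1, Complex.exp (2 * Real.pi * Complex.I * (k + 1) * t) * (f i t : ℂ) := rfl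
    set D := ∫ t in (0 : ℝ)..1, Complex.exp (2 * Real.pi * Complex.I * (k + 1) * t) *
        ((deriv (deriv (f i)) t : ℝ) : ℂ) with hD
    have hk : (0 : ℝ) < k + 1 := by positivity
    have hn : ‖(k + 1 : ℂ)‖ = k + 1 := by
      rw [show (k + 1 : ℂ) = ((k + 1 : ℝ) : ℂ) by push_cast; rfl, Complex.norm_real,
        Real.norm_of_nonneg hk.le]
    rw [hmode, e1]
    simp only [norm_mul, norm_neg, norm_inv, Complex.norm_real, Complex.norm_I, hn,
      Real.norm_of_nonneg Real.pi_pos.le, Real.norm_of_nonneg (Real.sqrt_nonneg _),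
      Complex.norm_ofNat, mul_one]
    have hDs : ‖D‖ ^ 2 ≤ C i ^ 2 := pow_le_pow_left₀ (norm_nonneg _) hb 2
    have hpi : 1 ≤ Real.pi := by linarith [Real.pi_gt_three]
    have hs : Real.sqrt ((k : ℝ) + 1) ^ 2 = k + 1 := Real.sq_sqrt hk.le
    have : (2 * Real.pi * √((k : ℝ) + 1) * ((2 * Real.pi * ((k : ℝ) + 1))⁻¹ *
        ((2 * Real.pi * ((k : ℝ) + 1))⁻¹ * ‖D‖))) ^ 2 =
        (1 / ((k : ℝ) + 1) ^ 2) * (1 / (4 * Real.pi ^ 2 * (k + 1)) * ‖D‖ ^ 2) := by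
      rw [mul_pow, mul_pow, hs]
      field_simp
      ring
    rw [this]
    refine mul_le_mul_of_nonneg_left ?_ (by positivity)
    refine le_trans (mul_le_of_le_one_left (by positivity) ?_) hDs
    rw [div_le_one (by positivity)]
    have : (0 : ℝ) ≤ k := k.cast_nonneg
    nlinarith
  refine memℓp_gen ?_
  simp only [ENNReal.toReal_ofNat, Real.rpow_ofNat]
  refine Summable.of_nonneg_of_le (fun p => by positivity) key ?_
  refine Summable.mul_of_nonneg (f := fun k : ℕ => 1 / ((k : ℝ) + 1) ^ 2)
    (g := fun i => C i ^ 2) ?_ (Summable.of_finite) (fun k => by positivity)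
    (fun i => by positivity)
  have := (summable_nat_add_iff 1).2 (Real.summable_one_div_nat_pow.2 (by norm_num : 1 < 2))
  simpa using this

open Classical in
/-- The vector `(2π √k ∫₀¹ e^{2πikt} ξ(t) dt)_{k ≥ 1}` of the one-particle space, for a smooth
1-periodic function `ξ` (junk value `0` if the sequence is not square-summable). -/
def modes (ξ : ℝ → E) : OneParticle E :=
  if h : Memℓp (modeCoord ξ) 2 then ⟨modeCoord ξ, h⟩ else 0

/-- The action of the rotation `Φ_θ` on the one-particle space, multiplying `x_k` by `e^{2πikθ}`;
this corresponds to `ξ ↦ ξ(· - θ)`. -/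
def rotMode (θ : ℝ) : OneParticle E →ₗᵢ[ℂ] OneParticle E where
  toFun x := ⟨fun p => (expI ((p.1 + 1) * θ) : ℂ) * x p, by
    refine memℓp_norm_iff.1 ?_
    simpa only [norm_mul, Circle.norm_coe, one_mul] using memℓp_norm_iff.2 (lp.memℓp x)⟩
  map_add' x y := by
    ext p
    exact mul_add _ _ _
  map_smul' c x := by
    ext p
    simp [mul_left_comm]
  norm_map' x := by
    simp only [LinearMap.coe_mk, AddHom.coe_mk, lp.norm_eq_tsum_rpow (p := 2) (by norm_num), norm_mul,
      Circle.norm_coe, one_mul]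

end OneParticle

/-! ### The representations `W_{χ,l}` and `Ind W_{χ,l}` -/

namespace LatticeSpan

variable {L : LatticeSpan E}

/-- The average `∫₀¹ Ξ(t) dt` of a lift of the path of `γ`. -/
def avg (γ : L.loops) : E := ∫ t in (0 : ℝ)..1, lift γ t

/-- The component `[ν] = γ_m(q) - Pth(γ)(1) ∈ (Λ○ ∩ Λ●)/Γ` of a bicoloured loop `γ` in the kernel
of `Δ' ∘ Pth`. -/
def midDefect (γ : L.loops) (h : winding γ = 0) : L.interQuot :=
  ⟨midQ γ - (lift γ 1 : E), by
    obtain ⟨y, hy, hw, hb⟩ := midQ_sub γ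
    have h1 : lift γ 1 - lift γ 0 = 0 := congrArg Subtype.val h
    refine ⟨y - lift γ 1, ⟨hw, ?_⟩, by rw [← hy]; rfl⟩
    rwa [sub_eq_zero.1 h1]⟩

section Representations

variable [FiniteDimensional ℝ E]

/-- The representation `W_{χ,l}` of the subgroup lying over `ker(Δ' ∘ Pth)`, on `ℂ_χ ⊗ ℂ_l ⊗ 𝒮 = 𝒮`:
for `(γ, z)` with component `[ν] ∈ (Λ○ ∩ Λ●)/Γ` and periodic lift `Ξ`,
`W_{χ,l}(γ, z) = χ([ν]) e^{2πi⟨l, avg Ξ⟩} W(Ξ - avg Ξ, z)`. -/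
def repW {ε : L.WindingCocycle} (χ : AddChar L.interQuot Circle) (l : E) (x : Ext.ker ε) :
    Fock (OneParticle E) →L[ℂ] Fock (OneParticle E) :=
  ((χ (midDefect x.1.loop x.2) * expI ⟪l, avg x.1.loop⟫_ℝ : Circle) : ℂ) •
    Fock.weyl (modes fun t => lift x.1.loop t - avg x.1.loop) x.1.phase

/-- The operators `R_{χ,l}[Φ_θ] = e^{πi⟨l, l⟩θ} R[Φ_θ]` on the Fock space. -/
def repR (l : E) (θ : ℝ) : Fock (OneParticle E) →L[ℂ] Fock (OneParticle E) :=
  (expI (1 / 2 * ⟪l, l⟫_ℝ * θ) : ℂ) • Fock.map (rotMode θ)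

/-- The underlying Hilbert space of `Ind W_{χ,l}`: the Hilbert space direct sum, over the cosets
`σ` of the subgroup lying over `ker(Δ' ∘ Pth)`, of the Hilbert spaces `σ ×_ker 𝒮`. Each of these
is identified with the Fock space `𝒮` by means of a chosen representative `x_σ` of `σ`, through
`[x_σ, v] ↦ v`. -/
abbrev Ind (ε : L.WindingCocycle) : Type _ :=
  lp (fun _ : Ext ε ⧸ Ext.ker ε => Fock (OneParticle E)) 2

open Classical in
/-- The vector `[x, v] = [x_σ, W_{χ,l}(x_σ⁻¹ x) v]` of `σ ×_ker 𝒮 ⊆ Ind 𝒮_{χ,l}`, where `σ` is the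
coset of `x`. -/
def Ind.mk {ε : L.WindingCocycle} (χ : AddChar L.interQuot Circle) (l : E) (x : Ext ε)
    (v : Fock (OneParticle E)) : Ind ε :=
  lp.single 2 (x : Ext ε ⧸ Ext.ker ε) (repW χ l
    ⟨((x : Ext ε ⧸ Ext.ker ε).out)⁻¹ * x, QuotientGroup.eq.1 (QuotientGroup.out_eq' _)⟩ v)

end Representations

end LatticeSpan

/-! ### Positive energy and graded characters -/

section Energy

variable {H : Type*} [NormedAddCommGroup H] [InnerProductSpace ℂ H] {m : ℕ}

/-- The rotation group `Rot^(m)(S¹) = ℝ/mℤ`, written multiplicatively. -/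
abbrev Rot (m : ℕ) : Type := Multiplicative (AddCircle (m : ℝ))

/-- The class `[Φ_θ] ∈ Rot^(m)(S¹)`. -/
def Rot.mk (m : ℕ) (θ : ℝ) : Rot m := Multiplicative.ofAdd (θ : AddCircle (m : ℝ))

/-- The energy eigenspace `H(a) = {v | R[Φ_θ] v = e^{2πiaθ} v for all θ}`. -/
def energySpace (R : Rot m →* (H ≃ₗᵢ[ℂ] H)) (a : ℝ) : Submodule ℂ H where
  carrier := {v | ∀ θ : ℝ, R (Rot.mk m θ) v = (expI (a * θ) : ℂ) • v}
  zero_mem' θ := by simp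
  add_mem' {v w} hv hw θ := by rw [map_add, hv, hw, smul_add]
  smul_mem' c v hv θ := by rw [map_smul, hv, smul_comm]

/-- A unitary representation of `Rot^(m)(S¹)` has positive energy if the energy eigenspaces `H(a)`,
`a ∈ (1/m)ℤ`, vanish for `a < 0` and are finite-dimensional for `a ≥ 0`. -/
def IsPositiveEnergy (R : Rot m →* (H ≃ₗᵢ[ℂ] H)) : Prop :=
  ∀ k : ℤ, (k < 0 → energySpace R (k / m) = ⊥) ∧
    (0 ≤ k → FiniteDimensional ℂ (energySpace R (k / m)))

open Classical in
/-- The graded character `∑_{a ∈ (1/m)ℤ_{≥ 0}} dim H(a) q^a`, a formal series in real powers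
of `q`. -/
def gradedCharacter (R : Rot m →* (H ≃ₗᵢ[ℂ] H)) : HahnSeries ℝ ℚ where
  coeff a := if ∃ k : ℕ, a = k / m then (Module.finrank ℂ (energySpace R a) : ℚ) else 0
  isPWO_support' := by
    have h : (range fun k : ℕ => (k : ℝ) / m).IsPWO := by
      rw [← image_univ]
      exact (isWF_univ_iff.2 inferInstance).isPWO.image_of_monotone
        fun i j hij => div_le_div_of_nonneg_right (by exact_mod_cast hij) m.cast_nonneg
    refine h.mono fun a ha => ?_
    by_contra hn
    refine ha (if_neg fun ⟨k, hk⟩ => hn ⟨k, hk.symm⟩)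

end Energy

/-! ### Theta series and the eta function -/

namespace LatticeSpan

variable [FiniteDimensional ℝ E] (L : LatticeSpan E)

theorem finite_coset_ball (l : E) (r : ℝ) : {x : E | x - l ∈ L.diff ∧ ‖x‖ ≤ r}.Finite := by
  let b := Module.Basis.ofSpan L.span_eq_top.ge
  have hb : ∀ i, b i ∈ L.Γ := fun i =>
    Module.Basis.ofSpan_subset L.span_eq_top.ge (mem_range_self i)
  have hint : ∀ x, x - l ∈ L.diff → ∀ i, ∃ k : ℤ, ⟪x - l, b i⟫_ℝ = k := fun x hx i =>
    L.int_diff_inter hx (L.Γ_le_inter (hb i))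
  have := FiniteDimensional.fintypeBasisIndex b
  refine Finite.of_injOn (f := fun x i => ⌊⟪x - l, b i⟫_ℝ⌋)
    (t := Set.pi univ fun i => Icc ⌊-((r + ‖l‖) * ‖b i‖)⌋ ⌊(r + ‖l‖) * ‖b i‖⌋) ?_ ?_
    (Finite.pi fun i => finite_Icc _ _)
  · rintro x ⟨hx, hr⟩ i -
    have h1 : |⟪x - l, b i⟫_ℝ| ≤ (r + ‖l‖) * ‖b i‖ := (abs_real_inner_le_norm _ _).trans
      (mul_le_mul_of_nonneg_right ((norm_sub_le _ _).trans (by linarith)) (norm_nonneg _))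
    exact ⟨Int.floor_le_floor (abs_le.1 h1).1, Int.floor_le_floor (abs_le.1 h1).2⟩
  · rintro x ⟨hx, -⟩ y ⟨hy, -⟩ hxy
    refine sub_left_injective (b := l) (ext_inner_right ℝ fun v => ?_)
    change ⟪x - l, v⟫_ℝ = ⟪y - l, v⟫_ℝ
    rw [← b.sum_repr v]
    simp only [inner_sum, inner_smul_right]
    refine Finset.sum_congr rfl fun i _ => ?_
    obtain ⟨j, hj⟩ := hint x hx i
    obtain ⟨k, hk⟩ := hint y hy i
    have := congrFun hxy i
    simp only [hj, hk, Int.floor_intCast] at this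
    rw [hj, hk, this]

/-- The theta series `∑_{x ∈ l + (Λ○ - Λ●)} q^{⟨x, x⟩/2}`: the coefficient of `q^a` is the number
of `x ∈ l + (Λ○ - Λ●)` with `⟨x, x⟩/2 = a`. -/
def thetaSeries (l : E) : HahnSeries ℝ ℚ where
  coeff a := (Nat.card {x : E // x - l ∈ L.diff ∧ ⟪x, x⟫_ℝ / 2 = a} : ℚ)
  isPWO_support' := by
    refine IsWF.isPWO ?_
    rw [isWF_iff_no_descending_seq]
    intro f hf hmem
    have hx : ∀ n, ∃ x : E, x - l ∈ L.diff ∧ ⟪x, x⟫_ℝ / 2 = f n := fun n => by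
      by_contra hn
      refine hmem n ?_
      have : IsEmpty {x : E // x - l ∈ L.diff ∧ ⟪x, x⟫_ℝ / 2 = f n} :=
        ⟨fun x => hn ⟨x.1, x.2⟩⟩
      exact (congrArg Nat.cast Nat.card_of_isEmpty).trans Nat.cast_zero
    choose x hx1 hx2 using hx
    refine infinite_of_injective_forall_mem (f := x) (s := {y : E | y - l ∈ L.diff ∧ ‖y‖ ≤ ‖x 0‖})
      (fun i j hij => hf.injective ?_) (fun n => ⟨hx1 n, ?_⟩) (L.finite_coset_ball l _)
    · rw [← hx2, ← hx2, hij]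
    · have h0 := hf.antitone (Nat.zero_le n)
      rw [← hx2, ← hx2, real_inner_self_eq_norm_sq, real_inner_self_eq_norm_sq] at h0
      exact le_of_sq_le_sq (by linarith) (norm_nonneg _)

end LatticeSpan

/-- The Euler product `∏_{j ≥ 1} (1 - q^j)`: its coefficient of `q^n` is that of the partial product
over `1 ≤ j ≤ n`. -/
def eulerProduct : PowerSeries ℚ :=
  PowerSeries.mk fun n => PowerSeries.coeff n
    (∏ j ∈ Finset.Icc 1 n, (1 - (PowerSeries.X : PowerSeries ℚ) ^ j))

/-- Dedekind's eta function `η(q) = q^{1/24} ∏_{j ≥ 1} (1 - q^j)` as a formal series. -/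
def etaSeries : HahnSeries ℝ ℚ :=
  HahnSeries.single (1 / 24 : ℝ) 1 * HahnSeries.ofPowerSeries ℝ ℚ eulerProduct

end BicolouredTorus

end

open Set
open scoped ContDiff InnerProductSpace

noncomputable section

namespace BicolouredTorus

/-! Unitary operators are built from total families: a group acting on the index set of a total
family without changing its Gram matrix acts unitarily on the Hilbert space (`exists_rep_of_gram`).
For the vectors $[x,v]$ the Gram matrix is $\langle v, W_{\chi,l}(x^{-1}y)w\rangle$ if $x^{-1}y$
lies over $\ker\Delta$, and $0$ otherwise (`Ind.inner_mk`, `Ind.inner_mk_of_not_mem`). Left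
multiplication does not change $x^{-1}y$, which gives $\mathrm{Ind}\,W$. Rotations are automorphisms
of $\widetilde L$ that preserve the kernel (`Ext.rot_mul`), and conjugation by
$R_{\chi,l}[\Phi_\theta]$ carries $W_{\chi,l}(h)$ to $W_{\chi,l}(\Phi_\theta\cdot h)$ (`repR_repW`),
which gives $\mathrm{Ind}\,R$. The intertwining relation is then visible on the vectors $[x,v]$.

This needs $W_{\chi,l}$ to be multiplicative (`repW_mul`). Weyl operators multiply with the phase
$e^{-i\,\mathrm{Im}\langle\xi,\eta\rangle}$ (`Fock.weyl_weyl`); over $\ker\Delta$ the cocycle $c$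
reduces to $e^{2\pi iS'}$. The two agree because
$\mathrm{Im}\langle\xi,\eta\rangle=-\pi\int\langle\xi',\eta\rangle$ in the one-particle space, by
Parseval and integration by parts (`im_inner_modes`). Weyl operators are prescribed on coherent
vectors, which are total by polarisation and the identity theorem for power series
(`Fock.total_coherent`).

The spectrum comes from an explicit eigenbasis (`Ind.exists_eigenbasis`). Each coset contains a
geodesic $t\mapsto t\Delta$. Rotating it by $\theta$ multiplies it by the constant loop
$-\theta\Delta$ with phase $e^{\pi i\theta\langle\Delta,\Delta\rangle}$ (`exists_rot_linear`), and
the constant loop acts on $\mathcal S$ by the scalar $e^{-2\pi i\theta\langle l,\Delta\rangle}$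
times that phase. Together with the vacuum energy $\frac12\langle l,l\rangle$ this completes the
square: the vector $[\Delta,\text{monomial}]$ has energy $\frac12\langle
l-\Delta,l-\Delta\rangle+N$, where $N$ is the sum of the mode numbers. These energies lie in
$\frac1m\mathbb Z$ (`exists_int_energy`), so the rotation by $m$ is trivial and the action descends
to $\mathbb R/m\mathbb Z$.

The character therefore counts pairs of a vector of $l+(\Lambda_\circ-\Lambda_\bullet)$ and a
multiset of modes in $\operatorname{rank}\Gamma$ colours. The first factor is the theta series, the
second is $\prod_j(1-q^j)^{-\operatorname{rank}\Gamma}$ (`fockSeries_mul_eulerProduct_pow`). -/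

variable {E : Type*} [NormedAddCommGroup E] [InnerProductSpace ℝ E]

/-! ### Total families in Hilbert spaces -/

section Total

variable {X F F' : Type*} [NormedAddCommGroup F] [InnerProductSpace ℂ F]
  [NormedAddCommGroup F'] [InnerProductSpace ℂ F']

/-- A family of vectors of which only the zero vector is orthogonal to all members. -/
def Total (a : X → F) : Prop := ∀ v, (∀ x, ⟪a x, v⟫_ℂ = 0) → v = 0

theorem Total.orthogonal_eq_bot {a : X → F} (ha : Total a) :
    (Submodule.span ℂ (range a))ᗮ = ⊥ := by
  rw [Submodule.eq_bot_iff]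
  exact fun v hv => ha v fun x =>
    (Submodule.mem_orthogonal _ v).1 hv _ (Submodule.subset_span (mem_range_self x))

theorem Total.denseRange [CompleteSpace F] {a : X → F} (ha : Total a) :
    DenseRange (Finsupp.linearCombination ℂ a) := by
  have h := Submodule.topologicalClosure_eq_top_iff.2 ha.orthogonal_eq_bot
  rw [← Finsupp.range_linearCombination] at h
  rw [DenseRange, dense_iff_closure_eq]
  exact congrArg (fun S : Submodule ℂ F => (S : Set F)) h

theorem Total.ext [CompleteSpace F] {a : X → F} (ha : Total a) {S T : F →L[ℂ] F'}
    (h : ∀ x, S (a x) = T (a x)) : S = T := by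
  refine DFunLike.coe_injective (ha.denseRange.equalizer S.continuous T.continuous ?_)
  funext f
  simp only [Function.comp, Finsupp.linearCombination_apply, Finsupp.sum, map_sum, map_smul, h]

theorem inner_linearCombination_of_gram {a : X → F} {b : X → F'}
    (hab : ∀ x y, ⟪b x, b y⟫_ℂ = ⟪a x, a y⟫_ℂ) (f g : X →₀ ℂ) :
    ⟪Finsupp.linearCombination ℂ b f, Finsupp.linearCombination ℂ b g⟫_ℂ =
      ⟪Finsupp.linearCombination ℂ a f, Finsupp.linearCombination ℂ a g⟫_ℂ := by
  simp only [Finsupp.linearCombination_apply, Finsupp.sum, sum_inner, inner_sum, inner_smul_left,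
    inner_smul_right, hab]

theorem norm_linearCombination_of_gram {a : X → F} {b : X → F'}
    (hab : ∀ x y, ⟪b x, b y⟫_ℂ = ⟪a x, a y⟫_ℂ) (f : X →₀ ℂ) :
    ‖Finsupp.linearCombination ℂ b f‖ = ‖Finsupp.linearCombination ℂ a f‖ := by
  rw [@norm_eq_sqrt_re_inner ℂ, @norm_eq_sqrt_re_inner ℂ, inner_linearCombination_of_gram hab]

/-- Totality gives the dense range, and equality of the Gram matrices gives the norm bound with
constant $1$; these are the conditions under which `extendOfNorm` really extends. All operators on
Fock space and on the induced space are evaluated through this. -/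
theorem extendOfNorm_gram [CompleteSpace F] [CompleteSpace F'] {a : X → F} {b : X → F'}
    (ha : Total a) (hab : ∀ x y, ⟪b x, b y⟫_ℂ = ⟪a x, a y⟫_ℂ) (x : X) :
    LinearMap.extendOfNorm (Finsupp.linearCombination ℂ b) (Finsupp.linearCombination ℂ a) (a x) =
      b x := by
  have := LinearMap.extendOfNorm_eq ha.denseRange (f := Finsupp.linearCombination ℂ b)
    ⟨1, fun f => by rw [one_mul, norm_linearCombination_of_gram hab]⟩ (Finsupp.single x 1)
  simpa using this

theorem inner_map_map_of_gram [CompleteSpace F] {a : X → F} {b : X → F'} (ha : Total a)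
    (hab : ∀ x y, ⟪b x, b y⟫_ℂ = ⟪a x, a y⟫_ℂ) {T : F →L[ℂ] F'} (hT : ∀ x, T (a x) = b x)
    (v w : F) : ⟪T v, T w⟫_ℂ = ⟪v, w⟫_ℂ := by
  have hT' : ∀ f, T (Finsupp.linearCombination ℂ a f) = Finsupp.linearCombination ℂ b f := fun f => by
    simp only [Finsupp.linearCombination_apply, Finsupp.sum, map_sum, map_smul, hT]
  refine ha.denseRange.induction_on₂ (p := fun v w => ⟪T v, T w⟫_ℂ = ⟪v, w⟫_ℂ) ?_ (fun f g => ?_) v w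
  · exact isClosed_eq (by fun_prop) (by fun_prop)
  · rw [hT', hT', inner_linearCombination_of_gram hab]

theorem norm_map_of_inner_map_map {T : F →L[ℂ] F'} (h : ∀ v w, ⟪T v, T w⟫_ℂ = ⟪v, w⟫_ℂ) (v : F) :
    ‖T v‖ = ‖v‖ := by
  rw [@norm_eq_sqrt_re_inner ℂ, @norm_eq_sqrt_re_inner ℂ _ _ _ _ v, h]

/-- An action of a group on the index set of a total family that preserves the Gram matrix extends
to a unitary representation. -/
theorem exists_rep_of_gram [CompleteSpace F] {G : Type*} [Group G] {a : X → F} (ha : Total a)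
    (act : G → X → X) (hgram : ∀ g x y, ⟪a (act g x), a (act g y)⟫_ℂ = ⟪a x, a y⟫_ℂ)
    (hone : ∀ x, a (act 1 x) = a x) (hmul : ∀ g h x, a (act (g * h) x) = a (act g (act h x))) :
    ∃ ρ : G →* (F ≃ₗᵢ[ℂ] F), ∀ g x, ρ g (a x) = a (act g x) := by
  let T : G → F →L[ℂ] F := fun g => LinearMap.extendOfNorm
    (Finsupp.linearCombination ℂ fun x => a (act g x)) (Finsupp.linearCombination ℂ a)
  have hT : ∀ g x, T g (a x) = a (act g x) := fun g x => extendOfNorm_gram ha (hgram g) x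
  have hT1 : T 1 = ContinuousLinearMap.id ℂ F := ha.ext fun x => by rw [hT, hone]; rfl
  have hTm : ∀ g h, T (g * h) = (T g).comp (T h) := fun g h => ha.ext fun x => by
    rw [hT, hmul, ContinuousLinearMap.comp_apply, hT, hT]
  have hinv : ∀ g h v, g * h = 1 → T g (T h v) = v := fun g h v e => by
    rw [← ContinuousLinearMap.comp_apply, ← hTm, e, hT1]; rfl
  let U : G → F ≃ₗᵢ[ℂ] F := fun g =>
    { toFun := T g
      map_add' := map_add _
      map_smul' := map_smul _
      invFun := T g⁻¹
      left_inv := fun v => hinv _ _ v (inv_mul_cancel g)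
      right_inv := fun v => hinv _ _ v (mul_inv_cancel g)
      norm_map' := norm_map_of_inner_map_map (inner_map_map_of_gram ha (hgram g) (hT g)) }
  refine ⟨{ toFun := U, map_one' := ?_, map_mul' := fun g h => ?_ }, fun g x => hT g x⟩
  · ext v
    exact congrFun (congrArg DFunLike.coe hT1) v
  · ext v
    exact congrFun (congrArg DFunLike.coe (hTm g h)) v

/-- Isometries are equicontinuous, so continuity of orbits passes from a dense subspace to every
vector by an $\varepsilon/3$ argument. -/
theorem continuous_orbit_of_total [CompleteSpace F] {Y : Type*} [TopologicalSpace Y]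
    {U : Y → F ≃ₗᵢ[ℂ] F} {a : X → F} (ha : Total a) (h : ∀ x, Continuous fun y => U y (a x))
    (v : F) : Continuous fun y => U y v := by
  have hf : ∀ f, Continuous fun y => U y (Finsupp.linearCombination ℂ a f) := fun f => by
    simp only [Finsupp.linearCombination_apply, Finsupp.sum, map_sum, map_smul]
    exact continuous_finsetSum _ fun x _ => (h x).const_smul _
  refine Metric.continuous_iff'.2 fun y ε hε => ?_
  obtain ⟨f, hfv⟩ := ha.denseRange.exists_dist_lt v (show (0 : ℝ) < ε / 3 by positivity)
  filter_upwards [Metric.continuous_iff'.1 (hf f) y (ε / 3) (by positivity)] with z hz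
  have e : ∀ y, dist (U y v) (U y (Finsupp.linearCombination ℂ a f)) < ε / 3 := fun y => by
    rwa [(U y).dist_map]
  have e2 := e y
  rw [dist_comm] at e2
  linarith [e z, dist_triangle4 (U z v) (U z (Finsupp.linearCombination ℂ a f))
    (U y (Finsupp.linearCombination ℂ a f)) (U y v)]

end Total

theorem expI_zero : expI 0 = 1 := by simpa using expI_int 0

theorem continuous_expI : Continuous expI := by
  unfold expI
  fun_prop

theorem expI_half : (expI (1 / 2) : ℂ) = -1 := by
  rw [expI, Circle.coe_exp, show ((2 * Real.pi * (1 / 2) : ℝ) : ℂ) = Real.pi by push_cast; ring]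
  exact Complex.exp_pi_mul_I

/-! ### Diagonal representations of the rotation group -/

section Diagonal

variable {H I : Type*} [NormedAddCommGroup H] [InnerProductSpace ℂ H]
  {m : ℕ} {R : Rot m →* (H ≃ₗᵢ[ℂ] H)} {b : HilbertBasis I ℂ H} {e : I → ℝ}

/-- Distinct energies give distinct characters of the rotations, hence orthogonal eigenvectors; an
eigenvector of energy `a` has coefficients only along basis vectors of that energy. -/
theorem mem_energySpace_iff (hR : ∀ θ i, R (Rot.mk m θ) (b i) = (expI (e i * θ) : ℂ) • b i)
    (a : ℝ) (v : H) : v ∈ energySpace R a ↔ ∀ i, e i ≠ a → ⟪b i, v⟫_ℂ = 0 := by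
  have hin : ∀ θ i, ⟪b i, R (Rot.mk m θ) v⟫_ℂ = (expI (e i * θ) : ℂ) * ⟪b i, v⟫_ℂ := fun θ i => by
    have h1 := (R (Rot.mk m θ)).inner_map_map (b i) v
    rw [hR, inner_smul_left] at h1
    rw [← h1, ← mul_assoc, Complex.mul_conj, Complex.normSq_eq_norm_sq, Circle.norm_coe]
    simp
  constructor
  · intro hv i hi
    -- At this angle the characters of energies `e i` and `a` differ by the sign $-1$, so the
    -- coefficient along `b i` equals its own negative.
    set θ : ℝ := 1 / 2 / (e i - a) with hθ
    have h := hin θ i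
    rw [hv θ, inner_smul_right, show e i * θ = a * θ + 1 / 2 by
      rw [hθ]; field_simp [sub_ne_zero.2 hi]; ring, expI_add, Circle.coe_mul, expI_half] at h
    have h2 : (expI (a * θ) : ℂ) * (2 * ⟪b i, v⟫_ℂ) = 0 := by linear_combination h
    simpa using h2
  · intro h θ
    refine b.repr.injective (lp.ext (funext fun i => ?_))
    rw [b.repr_apply_apply, b.repr_apply_apply, hin, inner_smul_right]
    by_cases hi : e i = a
    · rw [hi]
    · rw [h i hi, mul_zero, mul_zero]

/-- With only finitely many basis vectors of energy `a`, the Hilbert expansion of an eigenvector is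
a finite sum, so no closure of the span is needed. -/
theorem energySpace_eq_span (hR : ∀ θ i, R (Rot.mk m θ) (b i) = (expI (e i * θ) : ℂ) • b i)
    {a : ℝ} (hfin : {i | e i = a}.Finite) :
    energySpace R a = Submodule.span ℂ (range fun i : {i // e i = a} => b i) := by
  refine le_antisymm (fun v hv => ?_) (Submodule.span_le.2 ?_)
  · rw [mem_energySpace_iff hR] at hv
    have h := b.hasSum_repr v
    have h2 : HasSum (fun i => b.repr v i • b i) (∑ i ∈ hfin.toFinset, b.repr v i • b i) :=
      hasSum_sum_of_ne_finset_zero fun i hi => by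
        rw [b.repr_apply_apply, hv i (by simpa using hi), zero_smul]
    rw [h.unique h2]
    exact Submodule.sum_mem _ fun i hi => Submodule.smul_mem _ _
      (Submodule.subset_span ⟨⟨i, by simpa using hi⟩, rfl⟩)
  · rintro _ ⟨i, rfl⟩
    refine fun θ => ?_
    dsimp only
    rw [hR, i.2]

theorem finrank_energySpace (hR : ∀ θ i, R (Rot.mk m θ) (b i) = (expI (e i * θ) : ℂ) • b i)
    {a : ℝ} (hfin : {i | e i = a}.Finite) :
    FiniteDimensional ℂ (energySpace R a) ∧
      Module.finrank ℂ (energySpace R a) = Nat.card {i // e i = a} := by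
  have : Fintype {i // e i = a} := hfin.fintype
  rw [energySpace_eq_span hR hfin]
  refine ⟨FiniteDimensional.span_of_finite ℂ (finite_range _), ?_⟩
  rw [finrank_span_eq_card, Nat.card_eq_fintype_card]
  exact b.orthonormal.linearIndependent.comp _ Subtype.val_injective

theorem Total.of_hilbertBasis (b : HilbertBasis I ℂ H) : Total b := fun v hv => by
  refine b.repr.injective (lp.ext (funext fun i => ?_))
  rw [b.repr_apply_apply, hv, map_zero]
  rfl

end Diagonal

/-! ### Symmetric powers -/

section SymPower

variable {H : Type*} [NormedAddCommGroup H] [InnerProductSpace ℂ H]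

/-- The monomial `x₀ x₁ ⋯ x_{k-1}` as a vector of the symmetric power. -/
def SymPower.of {k : ℕ} (x : Fin k → H) : SymPower H k := (MonomialSpace.of x : MonomialSpace H k)

theorem MonomialSpace.inner_of {k : ℕ} (x y : Fin k → H) :
    ⟪MonomialSpace.of x, MonomialSpace.of y⟫_ℂ = monomialPairing x y := by
  change monomialForm (Finsupp.single x 1) (Finsupp.single y 1) = _
  simp [monomialForm]

theorem SymPower.inner_of {k : ℕ} (x y : Fin k → H) :
    ⟪SymPower.of x, SymPower.of y⟫_ℂ = monomialPairing x y :=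
  (UniformSpace.Completion.inner_coe _ _).trans (MonomialSpace.inner_of x y)

omit [NormedAddCommGroup H] [InnerProductSpace ℂ H] in
theorem MonomialSpace.span_of (k : ℕ) :
    Submodule.span ℂ (range (MonomialSpace.of : (Fin k → H) → MonomialSpace H k)) = ⊤ := by
  refine Submodule.eq_top_iff'.2 fun f => ?_
  have h : ∀ f : (Fin k → H) →₀ ℂ, (show MonomialSpace H k from f) ∈
      Submodule.span ℂ (range (MonomialSpace.of : (Fin k → H) → MonomialSpace H k)) := fun f => by
    induction f using Finsupp.induction_linear with
    | zero => exact zero_mem _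
    | add f g hf hg => exact add_mem hf hg
    | single x a =>
      have : (show MonomialSpace H k from Finsupp.single x a) = a • MonomialSpace.of x :=
        (Finsupp.smul_single_one x a).symm
      rw [this]
      exact Submodule.smul_mem _ _ (Submodule.subset_span (mem_range_self x))
  exact h f

theorem SymPower.total_of (k : ℕ) : Total (SymPower.of : (Fin k → H) → SymPower H k) := by
  intro v hv
  have h : ∀ f : MonomialSpace H k, ⟪(f : SymPower H k), v⟫_ℂ = 0 := fun f => by
    have hf : f ∈ Submodule.span ℂ (range (MonomialSpace.of : (Fin k → H) → MonomialSpace H k)) := by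
      rw [MonomialSpace.span_of]; trivial
    induction hf using Submodule.span_induction with
    | mem x hx => obtain ⟨x, rfl⟩ := hx; exact hv x
    | zero => rw [UniformSpace.Completion.coe_zero, inner_zero_left]
    | add x y _ _ hx hy => rw [UniformSpace.Completion.coe_add, inner_add_left, hx, hy, add_zero]
    | smul a x _ hx => rw [UniformSpace.Completion.coe_smul, inner_smul_left, hx, mul_zero]
  have : ∀ w : SymPower H k, ⟪w, v⟫_ℂ = 0 := fun w =>
    UniformSpace.Completion.induction_on w (isClosed_eq (by fun_prop) (by fun_prop)) h
  exact inner_self_eq_zero.1 (this v)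

/-- Multilinearity and commutativity of monomials hold only modulo null vectors of the form. Testing
against monomials is how these relations are obtained in the completion. -/
theorem SymPower.ext_inner {k : ℕ} {v w : SymPower H k}
    (h : ∀ x : Fin k → H, ⟪SymPower.of x, v⟫_ℂ = ⟪SymPower.of x, w⟫_ℂ) : v = w :=
  sub_eq_zero.1 (SymPower.total_of k _ fun x => by rw [inner_sub_right, h, sub_self])

/-- Reindexing each product by $\sigma^{-1}$ isolates the slots of `y` and exhibits the pairing as a
sum of multilinear maps, from which linearity in each slot follows. -/
theorem monomialPairing_eq_sum {k : ℕ} (x y : Fin k → H) : monomialPairing x y =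
    ∑ σ : Equiv.Perm (Fin k), ((MultilinearMap.mkPiAlgebra ℂ (Fin k) ℂ).compLinearMap
      fun j => (innerSL ℂ (x (σ⁻¹ j)) : H →ₗ[ℂ] ℂ)) y := by
  refine Finset.sum_congr rfl fun σ _ => ?_
  rw [← Equiv.prod_comp σ⁻¹]
  simp

theorem SymPower.of_update_add {k : ℕ} (x : Fin k → H) (i : Fin k) (a b : H) :
    SymPower.of (Function.update x i (a + b)) =
      SymPower.of (Function.update x i a) + SymPower.of (Function.update x i b) := by
  refine SymPower.ext_inner fun y => ?_
  rw [inner_add_right]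
  simp only [SymPower.inner_of, monomialPairing_eq_sum, MultilinearMap.map_update_add,
    Finset.sum_add_distrib]

theorem SymPower.of_update_smul {k : ℕ} (x : Fin k → H) (i : Fin k) (c : ℂ) (a : H) :
    SymPower.of (Function.update x i (c • a)) = c • SymPower.of (Function.update x i a) := by
  refine SymPower.ext_inner fun y => ?_
  rw [inner_smul_right]
  simp only [SymPower.inner_of, monomialPairing_eq_sum, MultilinearMap.map_update_smul,
    smul_eq_mul, Finset.mul_sum]

theorem monomialPairing_comp_perm {k : ℕ} (x y : Fin k → H) (τ : Equiv.Perm (Fin k)) :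
    monomialPairing x (y ∘ τ) = monomialPairing x y := by
  unfold monomialPairing
  rw [← Equiv.sum_comp (Equiv.mulLeft τ) (fun σ => ∏ i, ⟪x i, y (σ i)⟫_ℂ)]
  rfl

theorem SymPower.of_comp_perm {k : ℕ} (x : Fin k → H) (τ : Equiv.Perm (Fin k)) :
    SymPower.of (x ∘ τ) = SymPower.of x :=
  SymPower.ext_inner fun y => by simp only [SymPower.inner_of, monomialPairing_comp_perm]

/-- Cauchy–Schwarz bounds each of the $k!$ terms of the pairing of `x` with itself by
$\prod_i\|x_i\|\|x_{\sigma i}\|=(\prod_i\|x_i\|)^2$. -/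
theorem SymPower.norm_of_le {k : ℕ} (x : Fin k → H) :
    ‖SymPower.of x‖ ≤ √(k.factorial) * ∏ i, ‖x i‖ := by
  have h : ‖SymPower.of x‖ ^ 2 ≤ (√(k.factorial) * ∏ i, ‖x i‖) ^ 2 := by
    have e : ‖SymPower.of x‖ ^ 2 = ‖monomialPairing x x‖ := by
      rw [← SymPower.inner_of, inner_self_eq_norm_sq_to_K]
      simp
    rw [e, mul_pow, Real.sq_sqrt (by positivity)]
    refine (norm_sum_le _ _).trans ?_
    have : ∀ σ : Equiv.Perm (Fin k), ‖∏ i, ⟪x i, x (σ i)⟫_ℂ‖ ≤ (∏ i, ‖x i‖) ^ 2 := fun σ => by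
      rw [norm_prod]
      refine (Finset.prod_le_prod (fun _ _ => norm_nonneg _)
        fun i _ => norm_inner_le_norm (𝕜 := ℂ) (x i) (x (σ i))).trans (le_of_eq ?_)
      rw [Finset.prod_mul_distrib, Equiv.prod_comp σ (fun i => ‖x i‖), sq]
    refine (Finset.sum_le_sum fun σ _ => this σ).trans (le_of_eq ?_)
    simp [Fintype.card_perm]
  exact le_of_sq_le_sq h (by positivity)

variable (H) in
/-- The monomials as a continuous multilinear function of their factors. -/
def SymPower.ofMultilinear (k : ℕ) :
    ContinuousMultilinearMap ℂ (fun _ : Fin k => H) (SymPower H k) :=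
  MultilinearMap.mkContinuous
    { toFun := SymPower.of
      map_update_add' := fun {inst} x i a b => by
        -- The fields of `MultilinearMap` quantify over an arbitrary decidability instance on `Fin
        -- k`.
        rw [Subsingleton.elim inst (instDecidableEqFin k)]
        exact SymPower.of_update_add x i a b
      map_update_smul' := fun {inst} x i c a => by
        rw [Subsingleton.elim inst (instDecidableEqFin k)]
        exact SymPower.of_update_smul x i c a }
    (√(k.factorial)) SymPower.norm_of_le

theorem SymPower.of_smul {k : ℕ} (c : Fin k → ℂ) (x : Fin k → H) :
    SymPower.of (fun i => c i • x i) = (∏ i, c i) • SymPower.of x :=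
  (SymPower.ofMultilinear H k).map_smul_univ c x

/-- A symmetric continuous multilinear form is determined by its values on the diagonal; in
particular the powers `κ^k` are total in the symmetric power. -/
theorem SymPower.total_pow (k : ℕ) : Total fun κ : H => (SymPower.of fun _ : Fin k => κ) := by
  intro v hv
  refine SymPower.total_of k v fun x => ?_
  rw [← inner_conj_symm, map_eq_zero]
  let φ := (innerSL ℂ v).compContinuousMultilinearMap (SymPower.ofMultilinear H k)
  have hφ : ∀ x, φ x = ⟪v, SymPower.of x⟫_ℂ := fun x => rfl
  have h0 : (fun κ : H => φ fun _ => κ) = fun _ => 0 := funext fun κ => by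
    rw [hφ, ← inner_conj_symm, hv, map_zero]
  -- Polarisation: the $k$-th derivative of $\kappa\mapsto\varphi(\kappa,\dots,\kappa)$ in the
  -- directions `x` is $\sum_\sigma\varphi(x\circ\sigma)$, which is $k!\,\varphi(x)$ by symmetry,
  -- while the function vanishes identically.
  have h := φ.iteratedFDeriv_comp_diagonal 0 x
  rw [h0, iteratedFDeriv_fun_zero] at h
  have hs : ∀ σ : Equiv.Perm (Fin k), φ (fun i => x (σ i)) = ⟪v, SymPower.of x⟫_ℂ := fun σ => by
    rw [hφ]
    exact congrArg _ (SymPower.of_comp_perm x σ)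
  simp only [hs, Finset.sum_const, Finset.card_univ, Fintype.card_perm, Fintype.card_fin,
    nsmul_eq_mul] at h
  exact (mul_eq_zero.1 h.symm).resolve_left (by exact_mod_cast k.factorial_ne_zero)

/-- Monomials in the vectors of a total family are total. -/
theorem SymPower.total_of_total {ι : Type*} [CompleteSpace H] {e : ι → H} (he : Total e) (k : ℕ) :
    Total fun x : Fin k → ι => SymPower.of fun i => e (x i) := by
  intro v hv
  refine SymPower.total_of k v fun x => ?_
  rw [← inner_conj_symm, map_eq_zero]
  let φ := (innerSL ℂ v).compContinuousMultilinearMap (SymPower.ofMultilinear H k)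
  have hφ : ∀ x, φ x = ⟪v, SymPower.of x⟫_ℂ := fun x => rfl
  -- Induction on the set of slots that may hold arbitrary vectors: freeing one more slot uses that
  -- `φ` is linear and continuous in it and vanishes when it holds a member of the total family.
  have key : ∀ (s : Finset (Fin k)) (x : Fin k → H), (∀ i ∉ s, x i ∈ range e) → φ x = 0 := by
    intro s
    induction s using Finset.induction_on with
    | empty =>
      intro x hx
      choose y hy using fun i => hx i (by simp)
      rw [hφ, ← inner_conj_symm, show x = fun i => e (y i) from funext fun i => (hy i).symm, hv,
        map_zero]
    | insert a s ha ih =>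
      intro x hx
      have h : φ.toContinuousLinearMap x a = 0 := he.ext fun j => by
        refine ih (Function.update x a (e j)) fun i hi => ?_
        rcases eq_or_ne i a with rfl | hne
        · simp
        · rw [Function.update_of_ne hne]
          exact hx i (by simp [hne, hi])
      simpa using congrArg (fun T : H →L[ℂ] ℂ => T (x a)) h
  exact key Finset.univ x (by simp)

end SymPower

/-! ### Coherent vectors and Weyl operators -/

section FockOperators

variable {H : Type*} [NormedAddCommGroup H] [InnerProductSpace ℂ H]

theorem Fock.monomial_eq {k : ℕ} (x : Fin k → H) :
    (Fock.monomial ⟨k, x⟩ : Fock H) = lp.single 2 k (SymPower.of x) := rfl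

theorem Fock.inner_monomial {k : ℕ} (x y : Fin k → H) :
    ⟪(Fock.monomial ⟨k, x⟩ : Fock H), Fock.monomial ⟨k, y⟩⟫_ℂ = monomialPairing x y := by
  rw [Fock.monomial_eq, Fock.monomial_eq, lp.inner_single_left, lp.single_apply_self,
    SymPower.inner_of]

theorem Fock.inner_monomial_ne {j k : ℕ} (h : j ≠ k) (x : Fin j → H) (y : Fin k → H) :
    ⟪(Fock.monomial ⟨j, x⟩ : Fock H), Fock.monomial ⟨k, y⟩⟫_ℂ = 0 := by
  rw [Fock.monomial_eq, Fock.monomial_eq, lp.inner_single_left, lp.single_apply_ne _ _ _ h,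
    inner_zero_right]

theorem Fock.total_monomial : Total (Fock.monomial : (Σ k : ℕ, Fin k → H) → Fock H) := by
  intro v hv
  refine lp.ext (funext fun k => SymPower.total_of k _ fun x => ?_)
  rw [← hv ⟨k, x⟩, Fock.monomial_eq, lp.inner_single_left]

theorem Fock.inner_monomial_map (g : H →ₗᵢ[ℂ] H) (x y : Σ k : ℕ, Fin k → H) :
    ⟪(Fock.monomial ⟨x.1, fun i => g (x.2 i)⟩ : Fock H),
      Fock.monomial ⟨y.1, fun i => g (y.2 i)⟩⟫_ℂ = ⟪Fock.monomial x, Fock.monomial y⟫_ℂ := by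
  obtain ⟨j, x⟩ := x
  obtain ⟨k, y⟩ := y
  rcases eq_or_ne j k with rfl | h
  · simp only [Fock.inner_monomial, monomialPairing, g.inner_map_map]
  · simp only [Fock.inner_monomial_ne h]

theorem Fock.map_monomial (g : H →ₗᵢ[ℂ] H) (x : Σ k : ℕ, Fin k → H) :
    Fock.map g (Fock.monomial x) = Fock.monomial ⟨x.1, fun i => g (x.2 i)⟩ :=
  extendOfNorm_gram Fock.total_monomial (Fock.inner_monomial_map g) x

theorem Fock.inner_map_map (g : H →ₗᵢ[ℂ] H) (v w : Fock H) :
    ⟪Fock.map g v, Fock.map g w⟫_ℂ = ⟪v, w⟫_ℂ :=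
  inner_map_map_of_gram Fock.total_monomial (Fock.inner_monomial_map g) (Fock.map_monomial g) v w

theorem Fock.map_map (g h : H →ₗᵢ[ℂ] H) (v : Fock H) :
    Fock.map g (Fock.map h v) = Fock.map (g.comp h) v := by
  have : (Fock.map g).comp (Fock.map h) = Fock.map (g.comp h) :=
    Fock.total_monomial.ext fun x => by
      rw [ContinuousLinearMap.comp_apply, Fock.map_monomial, Fock.map_monomial, Fock.map_monomial]
      rfl
  exact congrArg (fun T : Fock H →L[ℂ] Fock H => T v) this

theorem Fock.map_id (v : Fock H) : Fock.map LinearIsometry.id v = v := by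
  have : Fock.map (LinearIsometry.id : H →ₗᵢ[ℂ] H) = ContinuousLinearMap.id ℂ (Fock H) :=
    Fock.total_monomial.ext fun x => by
      rw [Fock.map_monomial]
      rfl
  exact congrArg (fun T : Fock H →L[ℂ] Fock H => T v) this

theorem monomialPairing_pow {k : ℕ} (κ μ : H) :
    monomialPairing (fun _ : Fin k => κ) (fun _ => μ) = k.factorial * ⟪κ, μ⟫_ℂ ^ k := by
  simp [monomialPairing, Fintype.card_perm]

theorem hasSum_complex_exp (z : ℂ) : HasSum (fun k : ℕ => (k.factorial : ℂ)⁻¹ * z ^ k)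
    (Complex.exp z) := by
  have := NormedSpace.expSeries_div_hasSum_exp z
  rw [← Complex.exp_eq_exp_ℂ] at this
  simpa only [div_eq_inv_mul] using this

/-- Since $\|\kappa^k\|^2=k!\,\|\kappa\|^{2k}$, the squared norms of $\kappa^k/k!$ are the terms of
the exponential series of $\|\kappa\|^2$. -/
theorem Fock.memℓp_coherent (κ : H) : Memℓp (fun k : ℕ =>
    ((k.factorial : ℂ)⁻¹ • SymPower.of fun _ : Fin k => κ : SymPower H k)) 2 := by
  refine memℓp_gen ?_
  have h := (hasSum_complex_exp ((‖κ‖ ^ 2 : ℝ) : ℂ)).summable.norm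
  refine h.congr fun k => ?_
  have e : ‖(SymPower.of fun _ : Fin k => κ)‖ ^ 2 = k.factorial * (‖κ‖ ^ 2) ^ k := by
    have h1 := SymPower.inner_of (fun _ : Fin k => κ) (fun _ => κ)
    rw [inner_self_eq_norm_sq_to_K, monomialPairing_pow, inner_self_eq_norm_sq_to_K] at h1
    refine Complex.ofReal_injective ?_
    push_cast
    exact h1
  have hk : (k.factorial : ℝ) ≠ 0 := by exact_mod_cast k.factorial_ne_zero
  simp only [ENNReal.toReal_ofNat, Real.rpow_ofNat, norm_smul, mul_pow, e, norm_mul, norm_inv,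
    Complex.norm_natCast, norm_pow, Complex.norm_real, norm_norm]
  field_simp

/-- `Fock.coherent` is a `tsum`, with value $0$ in the absence of summability; this shows that the
value is the intended one. -/
theorem Fock.hasSum_coherent (κ : H) : HasSum (fun k : ℕ =>
    ((k.factorial : ℂ)⁻¹) • (Fock.monomial ⟨k, fun _ => κ⟩ : Fock H)) (Fock.coherent κ) := by
  refine Summable.hasSum ⟨⟨_, Fock.memℓp_coherent κ⟩, ?_⟩
  refine (lp.hasSum_single (p := 2) (by simp) (⟨_, Fock.memℓp_coherent κ⟩ : Fock H)).congr_fun ?_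
  intro k
  rw [Fock.monomial_eq, ← lp.single_smul]

theorem Fock.coherent_apply (κ : H) (k : ℕ) :
    (Fock.coherent κ : Fock H) k = (k.factorial : ℂ)⁻¹ • SymPower.of fun _ : Fin k => κ := by
  have h : Fock.coherent κ = (⟨_, Fock.memℓp_coherent κ⟩ : Fock H) := by
    refine (Fock.hasSum_coherent κ).unique ?_
    refine (lp.hasSum_single (p := 2) (by simp) (⟨_, Fock.memℓp_coherent κ⟩ : Fock H)).congr_fun ?_
    intro k
    rw [Fock.monomial_eq, ← lp.single_smul]
  rw [h]

theorem Fock.inner_coherent (κ μ : H) :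
    ⟪(Fock.coherent κ : Fock H), Fock.coherent μ⟫_ℂ = Complex.exp ⟪κ, μ⟫_ℂ := by
  refine (lp.hasSum_inner (Fock.coherent κ : Fock H) (Fock.coherent μ)).unique ?_
  refine (hasSum_complex_exp ⟪κ, μ⟫_ℂ).congr_fun fun k => ?_
  have hk : (k.factorial : ℂ) ≠ 0 := by exact_mod_cast k.factorial_ne_zero
  rw [Fock.coherent_apply, Fock.coherent_apply, inner_smul_left, inner_smul_right,
    SymPower.inner_of, monomialPairing_pow, map_inv₀, Complex.conj_natCast]
  field_simp

/-- The identity theorem: a power series representing the zero function near $0$ has zero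
coefficients. -/
theorem eq_zero_of_hasSum_pow_eq_zero {c : ℕ → ℂ}
    (h : ∀ z : ℂ, HasSum (fun k => z ^ k • c k) 0) (k : ℕ) : c k = 0 := by
  let p : FormalMultilinearSeries ℂ ℂ ℂ := fun k => ContinuousMultilinearMap.mkPiRing ℂ (Fin k) (c k)
  have hp : ∀ k, p.coeff k = c k := fun k => by simp [p, FormalMultilinearSeries.coeff]
  have h0 : HasFPowerSeriesAt (0 : ℂ → ℂ) p 0 :=
    hasFPowerSeriesAt_iff.2 (Filter.Eventually.of_forall fun z => by
      simp only [hp, Pi.zero_apply]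
      exact h z)
  rw [← hp, h0.eq_zero]
  simp [FormalMultilinearSeries.coeff]

/-- Scaling $\kappa$ by $z$ turns $\langle v,e^{z\kappa}\rangle$ into a power series in $z$ with
coefficients $\langle v_k,\kappa^k\rangle/k!$. If it vanishes for all $z$ then `v k` is orthogonal
to all powers $\kappa^k$, and these are total by `SymPower.total_pow`. -/
theorem Fock.total_coherent : Total (Fock.coherent : H → Fock H) := by
  intro v hv
  refine lp.ext (funext fun k => SymPower.total_pow k _ fun κ => ?_)
  have h : ∀ z : ℂ, HasSum (fun k => z ^ k • ((k.factorial : ℂ)⁻¹ *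
      ⟪v k, SymPower.of fun _ : Fin k => κ⟫_ℂ)) 0 := fun z => by
    have h1 := lp.hasSum_inner (𝕜 := ℂ) v (Fock.coherent (z • κ))
    rw [← inner_conj_symm, hv, map_zero] at h1
    refine h1.congr_fun fun k => ?_
    rw [Fock.coherent_apply, SymPower.of_smul, inner_smul_right, inner_smul_right]
    simp [mul_left_comm]
  have hk := eq_zero_of_hasSum_pow_eq_zero h k
  rw [← inner_conj_symm,
    (mul_eq_zero.1 hk).resolve_left (inv_ne_zero (by exact_mod_cast k.factorial_ne_zero)), map_zero]

theorem Fock.map_coherent (g : H →ₗᵢ[ℂ] H) (κ : H) :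
    Fock.map g (Fock.coherent κ) = Fock.coherent (g κ) := by
  have h := (Fock.hasSum_coherent κ).mapL (Fock.map g)
  simp only [map_smul, Fock.map_monomial] at h
  exact h.unique (Fock.hasSum_coherent (g κ))

/-- The prefactors are those that make the exponents cancel:
$\langle\kappa+\xi,\mu+\xi\rangle-\langle\xi,\xi\rangle-\langle\kappa,\xi\rangle-\langle\xi,\mu\rangle=\langle\kappa,\mu\rangle$.
This is the Gram identity behind the existence and unitarity of Weyl operators. -/
theorem Fock.inner_weyl_coherent (ξ : H) (z : Circle) (κ μ : H) :
    ⟪((z : ℂ) * Complex.exp (-(1 / 2) * ⟪ξ, ξ⟫_ℂ - ⟪ξ, κ⟫_ℂ)) • (Fock.coherent (κ + ξ) : Fock H),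
      ((z : ℂ) * Complex.exp (-(1 / 2) * ⟪ξ, ξ⟫_ℂ - ⟪ξ, μ⟫_ℂ)) • Fock.coherent (μ + ξ)⟫_ℂ =
    ⟪(Fock.coherent κ : Fock H), Fock.coherent μ⟫_ℂ := by
  rw [inner_smul_left, inner_smul_right]
  simp only [Fock.inner_coherent, map_mul, ← Complex.exp_conj, map_sub, inner_conj_symm, map_neg,
    map_div₀, map_one, map_ofNat]
  have hz : (starRingEnd ℂ) (z : ℂ) * z = 1 := by
    rw [mul_comm, Complex.mul_conj, Complex.normSq_eq_norm_sq, Circle.norm_coe]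
    simp
  calc _ = ((starRingEnd ℂ) (z : ℂ) * z) * (Complex.exp (-(1 / 2) * ⟪ξ, ξ⟫_ℂ - ⟪κ, ξ⟫_ℂ) *
        (Complex.exp (-(1 / 2) * ⟪ξ, ξ⟫_ℂ - ⟪ξ, μ⟫_ℂ) * Complex.exp ⟪κ + ξ, μ + ξ⟫_ℂ)) := by ring
    _ = _ := by
      rw [hz, one_mul, ← Complex.exp_add, ← Complex.exp_add]
      congr 1
      simp only [inner_add_left, inner_add_right]
      ring

theorem Fock.weyl_coherent (ξ : H) (z : Circle) (κ : H) :
    Fock.weyl ξ z (Fock.coherent κ) =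
      ((z : ℂ) * Complex.exp (-(1 / 2) * ⟪ξ, ξ⟫_ℂ - ⟪ξ, κ⟫_ℂ)) • Fock.coherent (κ + ξ) :=
  extendOfNorm_gram Fock.total_coherent (Fock.inner_weyl_coherent ξ z) κ

theorem Fock.inner_weyl_weyl (ξ : H) (z : Circle) (v w : Fock H) :
    ⟪Fock.weyl ξ z v, Fock.weyl ξ z w⟫_ℂ = ⟪v, w⟫_ℂ :=
  inner_map_map_of_gram Fock.total_coherent (Fock.inner_weyl_coherent ξ z)
    (Fock.weyl_coherent ξ z) v w

theorem Fock.weyl_zero (z : Circle) (v : Fock H) : Fock.weyl (0 : H) z v = (z : ℂ) • v := by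
  have : Fock.weyl (0 : H) z = (z : ℂ) • ContinuousLinearMap.id ℂ (Fock H) :=
    Fock.total_coherent.ext fun κ => by
      rw [Fock.weyl_coherent]
      simp
  exact congrArg (fun T : Fock H →L[ℂ] Fock H => T v) this

/-- The Weyl relation. Composing produces the exponent $-\langle\xi,\eta\rangle$, whereas
$-\frac12\|\xi+\eta\|^2$ accounts only for its symmetric part; the remainder
$-\frac12(\langle\xi,\eta\rangle-\langle\eta,\xi\rangle)$ is the phase
$-i\,\mathrm{Im}\langle\xi,\eta\rangle$. -/
theorem Fock.weyl_weyl (ξ η : H) (z w : Circle) (v : Fock H) :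
    Fock.weyl ξ z (Fock.weyl η w v) =
      Fock.weyl (ξ + η) (z * w * Circle.exp (-(⟪ξ, η⟫_ℂ).im)) v := by
  have : (Fock.weyl ξ z).comp (Fock.weyl η w) =
      Fock.weyl (ξ + η) (z * w * Circle.exp (-(⟪ξ, η⟫_ℂ).im)) :=
    Fock.total_coherent.ext fun κ => by
      have him : (((-(⟪ξ, η⟫_ℂ).im : ℝ) : ℂ)) * Complex.I =
          -(1 / 2) * (⟪ξ, η⟫_ℂ - ⟪η, ξ⟫_ℂ) := by
        rw [← inner_conj_symm η ξ, Complex.sub_conj]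
        push_cast
        ring
      rw [ContinuousLinearMap.comp_apply, Fock.weyl_coherent, map_smul, Fock.weyl_coherent,
        Fock.weyl_coherent, smul_smul, Circle.coe_mul, Circle.coe_mul, Circle.coe_exp, him,
        show κ + η + ξ = κ + (ξ + η) by abel]
      congr 1
      rw [mul_mul_mul_comm, ← Complex.exp_add, mul_assoc ((z : ℂ) * w), ← Complex.exp_add,
        mul_comm (w : ℂ) (z : ℂ)]
      congr 2
      simp only [inner_add_left, inner_add_right]
      ring
  exact congrArg (fun T : Fock H →L[ℂ] Fock H => T v) this

theorem Fock.map_weyl (g : H →ₗᵢ[ℂ] H) (ξ : H) (z : Circle) (v : Fock H) :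
    Fock.map g (Fock.weyl ξ z v) = Fock.weyl (g ξ) z (Fock.map g v) := by
  have : (Fock.map g).comp (Fock.weyl ξ z) = (Fock.weyl (g ξ) z).comp (Fock.map g) :=
    Fock.total_coherent.ext fun κ => by
      simp only [ContinuousLinearMap.comp_apply, Fock.weyl_coherent, map_smul, Fock.map_coherent,
        map_add, g.inner_map_map]
  exact congrArg (fun T : Fock H →L[ℂ] Fock H => T v) this

end FockOperators

/-! ### The occupation number basis of the Fock space -/

section OccupationBasis

/-- Equal multisets of values mean fibres of equal cardinality; bijections between the fibres glue
to a permutation. -/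
theorem exists_perm_of_map_eq {ι : Type*} {k : ℕ} {x y : Fin k → ι}
    (h : (Finset.univ.val.map x : Multiset ι) = Finset.univ.val.map y) :
    ∃ σ : Equiv.Perm (Fin k), x = y ∘ σ := by
  classical
  have hc : ∀ (x : Fin k → ι) (c : ι),
      Fintype.card {a // x a = c} = (Finset.univ.val.map x).count c := fun x c => by
    rw [Fintype.card_subtype, Multiset.count_map, Finset.card_def, Finset.filter_val]
    simp only [eq_comm]
  have he : ∀ c, Nonempty ({a // x a = c} ≃ {a // y a = c}) := fun c =>
    ⟨Fintype.equivOfCardEq (by rw [hc, hc, h])⟩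
  exact ⟨Equiv.ofFiberEquiv fun c => (he c).some,
    funext fun a => (Equiv.ofFiberEquiv_map _ a).symm⟩

variable {H ι : Type*} [NormedAddCommGroup H] [InnerProductSpace ℂ H]

theorem Fock.monomial_comp_perm {k : ℕ} (x : Fin k → H) (τ : Equiv.Perm (Fin k)) :
    (Fock.monomial ⟨k, x ∘ τ⟩ : Fock H) = Fock.monomial ⟨k, x⟩ := by
  rw [Fock.monomial_eq, Fock.monomial_eq, SymPower.of_comp_perm]

/-- The monomial in the members of a family indexed by a multiset. -/
def Fock.multisetMonomial (e : ι → H) (s : Multiset ι) : Fock H :=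
  Fock.monomial ⟨s.toList.length, fun i => e (s.toList.get i)⟩

theorem Fock.monomial_eq_multisetMonomial (e : ι → H) {k : ℕ} (x : Fin k → ι) :
    (Fock.monomial ⟨k, fun i => e (x i)⟩ : Fock H) =
      Fock.multisetMonomial e (Finset.univ.val.map x) := by
  set s := (Finset.univ.val.map x : Multiset ι) with hs
  have hk : s.toList.length = k := by simp [hs]
  unfold Fock.multisetMonomial
  -- The length of `s.toList` equals `k` only propositionally, so it is generalised to a variable
  -- that can be substituted.
  have h : ∀ {j : ℕ} (y : Fin j → ι), j = k → (Finset.univ.val.map y : Multiset ι) = s →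
      (Fock.monomial ⟨k, fun i => e (x i)⟩ : Fock H) = Fock.monomial ⟨j, fun i => e (y i)⟩ := by
    rintro j y rfl hy
    obtain ⟨σ, rfl⟩ := exists_perm_of_map_eq (hs.symm.trans hy.symm)
    exact Fock.monomial_comp_perm (fun i => e (y i)) σ
  exact h _ hk (by rw [Fin.univ_val_map, List.ofFn_get, Multiset.coe_toList])

/-- By orthonormality each term is $1$ if $\sigma$ fixes `x` and $0$ otherwise, so the pairing is
the order of the stabiliser of `x`, which contains the identity. -/
theorem monomialPairing_orthonormal_self_ne_zero {e : ι → H} (he : Orthonormal ℂ e) {k : ℕ}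
    (x : Fin k → ι) : monomialPairing (fun i => e (x i)) (fun i => e (x i)) ≠ 0 := by
  classical
  have h : ∀ σ : Equiv.Perm (Fin k), ∏ i, ⟪e (x i), e (x (σ i))⟫_ℂ =
      ((if x = x ∘ σ then 1 else 0 : ℕ) : ℂ) := fun σ => by
    simp only [orthonormal_iff_ite.1 he]
    by_cases hx : x = x ∘ σ
    · rw [if_pos hx, Nat.cast_one]
      exact Finset.prod_eq_one fun i _ => if_pos (congrFun hx i)
    · rw [if_neg hx]
      obtain ⟨i, hi⟩ := Function.ne_iff.1 hx
      rw [Finset.prod_eq_zero (Finset.mem_univ i) (if_neg hi), Nat.cast_zero]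
  simp only [monomialPairing, h]
  rw [← Nat.cast_sum, Nat.cast_ne_zero]
  refine (Finset.sum_pos' (fun _ _ => Nat.zero_le _) ⟨1, Finset.mem_univ _, ?_⟩).ne'
  rw [if_pos (by simp)]
  exact one_pos

/-- A nonzero pairing has a nonzero term, and by orthonormality the permutation of that term carries
one index sequence to the other. So monomials for different multisets are orthogonal. -/
theorem map_eq_of_inner_monomial_ne_zero {e : ι → H} (he : Orthonormal ℂ e) {j k : ℕ}
    {x : Fin j → ι} {y : Fin k → ι} (h : ⟪(Fock.monomial ⟨j, fun i => e (x i)⟩ : Fock H),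
      Fock.monomial ⟨k, fun i => e (y i)⟩⟫_ℂ ≠ 0) :
    (Finset.univ.val.map x : Multiset ι) = Finset.univ.val.map y := by
  classical
  have hjk : j = k := by
    by_contra hne
    exact h (Fock.inner_monomial_ne hne _ _)
  subst hjk
  rw [Fock.inner_monomial] at h
  obtain ⟨σ, -, hσ⟩ := Finset.exists_ne_zero_of_sum_ne_zero h
  have hx : x = y ∘ σ := funext fun i => by
    have := Finset.prod_ne_zero_iff.1 hσ i (Finset.mem_univ i)
    rw [orthonormal_iff_ite.1 he] at this
    by_contra hne
    exact this (if_neg hne)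
  rw [hx, ← Multiset.map_map, Multiset.map_univ_val_equiv]

theorem Fock.multisetMonomial_ne_zero {e : ι → H} (he : Orthonormal ℂ e) (s : Multiset ι) :
    Fock.multisetMonomial e s ≠ 0 := fun h => by
  refine monomialPairing_orthonormal_self_ne_zero he s.toList.get ?_
  rw [← Fock.inner_monomial]
  exact inner_self_eq_zero.2 h

/-- The normalised monomials in the vectors of a Hilbert basis form a Hilbert basis of the Fock
space. -/
theorem Fock.exists_hilbertBasis [CompleteSpace H] (e : HilbertBasis ι ℂ H) :
    ∃ b : HilbertBasis (Multiset ι) ℂ (Fock H), ∀ s,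
      b s = ((‖Fock.multisetMonomial e s‖ : ℂ)⁻¹) • Fock.multisetMonomial e s := by
  have ho : Orthonormal ℂ fun s : Multiset ι =>
      ((‖Fock.multisetMonomial e s‖ : ℂ)⁻¹) • Fock.multisetMonomial e s := by
    refine ⟨fun s => norm_smul_inv_norm (Fock.multisetMonomial_ne_zero e.orthonormal s),
      fun s t hst => ?_⟩
    dsimp only
    rw [inner_smul_left, inner_smul_right]
    by_contra hne
    refine hst ?_
    have h1 := map_eq_of_inner_monomial_ne_zero e.orthonormal
      (right_ne_zero_of_mul (right_ne_zero_of_mul hne))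
    simpa only [Fin.univ_val_map, List.ofFn_get, Multiset.coe_toList] using h1
  refine ⟨HilbertBasis.mkOfOrthogonalEqBot ho (Total.orthogonal_eq_bot fun v hv => ?_), fun s => by
    rw [HilbertBasis.coe_mkOfOrthogonalEqBot]⟩
  refine lp.ext (funext fun k => SymPower.total_of_total (Total.of_hilbertBasis e) k _ fun x => ?_)
  rw [← lp.inner_single_left, ← Fock.monomial_eq, Fock.monomial_eq_multisetMonomial]
  have h := hv (Finset.univ.val.map x)
  rw [inner_smul_left, mul_eq_zero] at h
  refine h.resolve_left ?_
  simp [Fock.multisetMonomial_ne_zero e.orthonormal]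

theorem Fock.map_multisetMonomial (g : H →ₗᵢ[ℂ] H) (e : ι → H) (c : ι → ℂ)
    (hg : ∀ i, g (e i) = c i • e i) (s : Multiset ι) :
    Fock.map g (Fock.multisetMonomial e s) = (s.map c).prod • Fock.multisetMonomial e s := by
  have hp : (s.map c).prod = ∏ i : Fin s.toList.length, c (s.toList.get i) := by
    conv_lhs => rw [← Multiset.coe_toList s, Multiset.map_coe, Multiset.prod_coe,
      ← List.ofFn_get s.toList]
    rw [List.map_ofFn, List.prod_ofFn]
    rfl
  rw [Fock.multisetMonomial, Fock.map_monomial, Fock.monomial_eq, Fock.monomial_eq, hp,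
    ← lp.single_smul, ← SymPower.of_smul]
  simp only [hg]

end OccupationBasis

/-! ### Parseval's identity for the one-particle space -/

section Parseval

/-- The Fourier coefficient `∫₀¹ e^{2πi(k+1)t} f(t) dt`. -/
def expCoeff (f : ℝ → ℂ) (k : ℕ) : ℂ :=
  ∫ t in (0 : ℝ)..1, Complex.exp (2 * Real.pi * Complex.I * (k + 1) * t) * f t

/-- A continuous periodic function as a function on the circle. -/
def circleLift (f : ℝ → ℂ) (hf : Continuous f) (hp : Function.Periodic f 1) :
    C(UnitAddCircle, ℂ) where
  toFun := hp.lift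
  continuous_toFun := continuous_coinduced_dom.2 hf

theorem fourierCoeff_circleLift {f : ℝ → ℂ} (hf : Continuous f) (hp : Function.Periodic f 1)
    (n : ℤ) : fourierCoeff (circleLift f hf hp) n =
      ∫ t in (0 : ℝ)..1, Complex.exp (2 * Real.pi * Complex.I * (-n) * t) * f t := by
  rw [fourierCoeff_eq_intervalIntegral _ _ 0]
  simp only [zero_add, one_div, inv_one, one_smul, smul_eq_mul]
  refine intervalIntegral.integral_congr fun t _ => ?_
  rw [fourier_coe_apply]
  simp [circleLift]

theorem hasSum_parseval {f g : ℝ → ℂ} (hf : Continuous f) (hfp : Function.Periodic f 1)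
    (hg : Continuous g) (hgp : Function.Periodic g 1) :
    HasSum (fun n : ℤ => (starRingEnd ℂ) (fourierCoeff (circleLift f hf hfp) n) *
      fourierCoeff (circleLift g hg hgp) n) (∫ t in (0 : ℝ)..1, (starRingEnd ℂ) (f t) * g t) := by
  have h := (fourierBasis (T := (1 : ℝ))).hasSum_inner_mul_inner
    (ContinuousMap.toLp (E := ℂ) 2 AddCircle.haarAddCircle ℂ (circleLift f hf hfp))
    (ContinuousMap.toLp (E := ℂ) 2 AddCircle.haarAddCircle ℂ (circleLift g hg hgp))
  rw [MeasureTheory.ContinuousMap.inner_toLp, AddCircle.integral_haarAddCircle,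
    ← AddCircle.intervalIntegral_preimage 1 0] at h
  simp only [zero_add, inv_one, one_smul] at h
  have e : ∫ t in (0 : ℝ)..1, (starRingEnd ℂ) (f t) * g t =
      ∫ t in (0 : ℝ)..1, circleLift g hg hgp t * (starRingEnd ℂ) (circleLift f hf hfp t) :=
    intervalIntegral.integral_congr fun t _ => by
      rw [mul_comm]
      rfl
  rw [e]
  refine h.congr_fun fun n => ?_
  rw [← inner_conj_symm _ (fourierBasis n), ← HilbertBasis.repr_apply_apply,
    ← HilbertBasis.repr_apply_apply, fourierBasis_repr, fourierBasis_repr, fourierCoeff_toLp,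
    fourierCoeff_toLp]

theorem fourierCoeff_circleLift_neg {f : ℝ → ℂ} (hf : Continuous f) (hp : Function.Periodic f 1)
    (k : ℕ) : fourierCoeff (circleLift f hf hp) (-(k + 1 : ℕ)) = expCoeff f k := by
  rw [fourierCoeff_circleLift]
  simp [expCoeff]

theorem fourierCoeff_circleLift_pos {f : ℝ → ℝ} (hf : Continuous fun t => (f t : ℂ))
    (hp : Function.Periodic (fun t => (f t : ℂ)) 1) (k : ℕ) :
    fourierCoeff (circleLift _ hf hp) (k + 1 : ℕ) =
      (starRingEnd ℂ) (expCoeff (fun t => (f t : ℂ)) k) := by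
  rw [fourierCoeff_circleLift, expCoeff, ← intervalIntegral.intervalIntegral_conj]
  refine intervalIntegral.integral_congr fun t _ => ?_
  have e : (starRingEnd ℂ) (2 * Real.pi * Complex.I * (k + 1) * t) =
      2 * Real.pi * Complex.I * (-((k + 1 : ℕ) : ℤ)) * t := by
    simp only [map_mul, map_add, map_ofNat, map_one, Complex.conj_ofReal, Complex.conj_I,
      Complex.conj_natCast]
    push_cast
    ring
  rw [map_mul, ← Complex.exp_conj, Complex.conj_ofReal, e]

/-- Parseval's identity for real functions, one of which has mean zero. -/
theorem hasSum_parseval_real {f g : ℝ → ℝ} (hf : Continuous f) (hfp : Function.Periodic f 1)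
    (hg : Continuous g) (hgp : Function.Periodic g 1) (h0 : ∫ t in (0 : ℝ)..1, f t = 0) :
    HasSum (fun k : ℕ => 2 * ((starRingEnd ℂ) (expCoeff (fun t => (f t : ℂ)) k) *
      expCoeff (fun t => (g t : ℂ)) k).re) (∫ t in (0 : ℝ)..1, f t * g t) := by
  have cf : Continuous fun t => (f t : ℂ) := Complex.continuous_ofReal.comp hf
  have cg : Continuous fun t => (g t : ℂ) := Complex.continuous_ofReal.comp hg
  have pf : Function.Periodic (fun t => (f t : ℂ)) 1 := hfp.comp Complex.ofReal
  have pg : Function.Periodic (fun t => (g t : ℂ)) 1 := hgp.comp Complex.ofReal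
  -- The terms for $n$ and $-n$ are combined. For real functions they are complex conjugates, whence
  -- twice a real part; the term $n=0$ drops out because `f` has mean zero.
  have h := (hasSum_parseval cf pf cg pg).nat_add_neg
  have z : fourierCoeff (circleLift _ cf pf) 0 = 0 := by
    rw [fourierCoeff_circleLift]
    simp [intervalIntegral.integral_ofReal, h0]
  rw [z, map_zero, zero_mul, add_zero, ← hasSum_nat_add_iff' 1] at h
  simp only [Finset.range_one, Finset.sum_singleton, Nat.cast_zero, neg_zero, z, map_zero, zero_mul,
    add_zero, sub_zero, fourierCoeff_circleLift_neg, fourierCoeff_circleLift_pos,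
    Complex.conj_conj, Complex.conj_ofReal, ← Complex.ofReal_mul,
    intervalIntegral.integral_ofReal] at h
  refine Complex.hasSum_ofReal.1 (h.congr_fun fun k => ?_)
  have := Complex.add_conj ((starRingEnd ℂ) (expCoeff (fun t => (f t : ℂ)) k) *
      expCoeff (fun t => (g t : ℂ)) k)
  rw [map_mul, Complex.conj_conj] at this
  rw [← this, add_comm]

end Parseval

/-! ### Fourier modes of loops: additivity, rotations and the symplectic form -/

section Modes

variable [FiniteDimensional ℝ E]

theorem modes_apply {ξ : ℝ → E} (hξ : ContDiff ℝ ∞ ξ) (hp : Function.Periodic ξ 1)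
    (p : ℕ × Fin (Module.finrank ℝ E)) : modes ξ p = modeCoord ξ p := by
  rw [modes, dif_pos (memℓp_modeCoord hξ hp)]

theorem modeCoord_eq (ξ : ℝ → E) (p : ℕ × Fin (Module.finrank ℝ E)) :
    modeCoord ξ p = 2 * Real.pi * Real.sqrt (p.1 + 1) *
      expCoeff (fun t => (⟪stdOrthonormalBasis ℝ E p.2, ξ t⟫_ℝ : ℂ)) p.1 := rfl

theorem modes_add {ξ η : ℝ → E} (hξ : ContDiff ℝ ∞ ξ) (hξp : Function.Periodic ξ 1)
    (hη : ContDiff ℝ ∞ η) (hηp : Function.Periodic η 1) :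
    modes (fun t => ξ t + η t) = modes ξ + modes η := by
  refine lp.ext (funext fun p => ?_)
  rw [lp.coeFn_add, Pi.add_apply, modes_apply hξ hξp, modes_apply hη hηp,
    modes_apply (hξ.add hη) (hξp.add hηp), modeCoord, modeCoord, modeCoord, ← mul_add,
    ← intervalIntegral.integral_add]
  · simp only [inner_add_right, Complex.ofReal_add, mul_add]
  · have := hξ.continuous
    exact Continuous.intervalIntegrable (by fun_prop) _ _
  · have := hη.continuous
    exact Continuous.intervalIntegrable (by fun_prop) _ _

theorem modes_zero : modes (fun _ => (0 : E)) = 0 := by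
  refine lp.ext (funext fun p => ?_)
  rw [modes_apply contDiff_const (fun _ => rfl)]
  simp [modeCoord]

theorem modes_shift {ξ : ℝ → E} (hξ : ContDiff ℝ ∞ ξ) (hp : Function.Periodic ξ 1) (θ : ℝ) :
    modes (fun t => ξ (t - θ)) = rotMode θ (modes ξ) := by
  refine lp.ext (funext fun p => ?_)
  change _ = (expI ((p.1 + 1) * θ) : ℂ) * modes ξ p
  have hs : ContDiff ℝ ∞ fun t => ξ (t - θ) := hξ.comp (by fun_prop)
  have hsp : Function.Periodic (fun t => ξ (t - θ)) 1 := fun t => by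
    change ξ (t + 1 - θ) = ξ (t - θ)
    rw [← hp (t - θ)]
    congr 1
    ring
  rw [modes_apply hξ hp, modes_apply hs hsp, modeCoord, modeCoord]
  set h : ℝ → ℂ := fun s => Complex.exp (2 * Real.pi * Complex.I * (p.1 + 1) * s) *
    (⟪stdOrthonormalBasis ℝ E p.2, ξ s⟫_ℝ : ℂ) with hh
  have hper : Function.Periodic h 1 := fun s => by
    simp only [hh]
    rw [hp, show (2 * Real.pi * Complex.I * (p.1 + 1) * ((s + 1 : ℝ) : ℂ) : ℂ) =
      2 * Real.pi * Complex.I * (p.1 + 1) * s + ((p.1 + 1 : ℕ) : ℂ) * (2 * Real.pi * Complex.I) by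
        push_cast; ring, Complex.exp_add, Complex.exp_nat_mul_two_pi_mul_I, mul_one]
  have e : ∀ t : ℝ, Complex.exp (2 * Real.pi * Complex.I * (p.1 + 1) * t) *
      (⟪stdOrthonormalBasis ℝ E p.2, ξ (t - θ)⟫_ℝ : ℂ) =
      (expI ((p.1 + 1) * θ) : ℂ) * h (t - θ) := fun t => by
    rw [hh, expI, Circle.coe_exp, ← mul_assoc, ← Complex.exp_add]
    congr 2
    push_cast
    ring
  have i := hper.intervalIntegral_add_eq (0 - θ) 0
  rw [zero_add, show 0 - θ + 1 = 1 - θ by ring] at i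
  simp only [e, intervalIntegral.integral_const_mul]
  rw [intervalIntegral.integral_comp_sub_right (f := h), i]
  ring

omit [FiniteDimensional ℝ E] in
theorem hasDerivAt_inner_basis {ξ : ℝ → E} (hξ : ContDiff ℝ ∞ ξ) (b : E) (t : ℝ) :
    HasDerivAt (fun t => ⟪b, ξ t⟫_ℝ) ⟪b, deriv ξ t⟫_ℝ t := by
  simpa using (hasDerivAt_const t b).inner ℝ (hξ.differentiable (by simp) t).hasDerivAt

omit [FiniteDimensional ℝ E] in
theorem periodic_deriv {ξ : ℝ → E} {v : E} (hp : ∀ t, ξ (t + 1) = ξ t + v) :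
    Function.Periodic (deriv ξ) 1 := fun t => by
  rw [← deriv_comp_add_const, show (fun t => ξ (t + 1)) = fun t => ξ t + v from funext hp,
    deriv_add_const]

omit [FiniteDimensional ℝ E] in
theorem expCoeff_deriv {ξ : ℝ → E} (hξ : ContDiff ℝ ∞ ξ) (hp : Function.Periodic ξ 1) (b : E)
    (k : ℕ) : expCoeff (fun t => (⟪b, deriv ξ t⟫_ℝ : ℂ)) k =
      -(2 * Real.pi * Complex.I * (k + 1)) * expCoeff (fun t => (⟪b, ξ t⟫_ℝ : ℂ)) k := by
  have h := integral_exp_mul_periodic (f := fun t => (⟪b, ξ t⟫_ℝ : ℂ))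
    (f' := fun t => (⟪b, deriv ξ t⟫_ℝ : ℂ))
    (fun t => (hasDerivAt_inner_basis hξ b t).ofReal_comp)
    (by have := hξ.continuous_deriv (by simp); fun_prop) (by simp [← hp 0]) k
  have hk : (k + 1 : ℂ) ≠ 0 := by exact_mod_cast k.succ_ne_zero
  have hc : (2 * Real.pi * Complex.I * (k + 1) : ℂ) ≠ 0 := by
    simp [Real.pi_ne_zero, Complex.I_ne_zero, hk]
  rw [expCoeff, expCoeff, h, neg_mul, neg_mul, mul_neg, neg_neg, mul_inv_cancel_left₀ hc]

/-- The imaginary part of the inner product of the one-particle space is a multiple of the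
symplectic form on loops. -/
theorem im_inner_modes {ξ η : ℝ → E} (hξ : ContDiff ℝ ∞ ξ) (hξp : Function.Periodic ξ 1)
    (hη : ContDiff ℝ ∞ η) (hηp : Function.Periodic η 1) :
    (⟪modes ξ, modes η⟫_ℂ).im = -Real.pi * ∫ t in (0 : ℝ)..1, ⟪deriv ξ t, η t⟫_ℝ := by
  set b := stdOrthonormalBasis ℝ E with hb
  have c1 := hξ.continuous_deriv (by simp)
  have c2 := hη.continuous
  have hi : ∀ i, HasSum (fun k : ℕ => ((starRingEnd ℂ) (modeCoord ξ (k, i)) *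
      modeCoord η (k, i)).im) (-Real.pi * ∫ t in (0 : ℝ)..1, ⟪b i, deriv ξ t⟫_ℝ * ⟪b i, η t⟫_ℝ) := by
    intro i
    -- The derivative of a periodic function has mean zero, which is what Parseval's identity needs
    -- here; no condition on the mean of `η` arises.
    have hz : ∫ t in (0 : ℝ)..1, ⟪b i, deriv ξ t⟫_ℝ = 0 := by
      rw [intervalIntegral.integral_eq_sub_of_hasDerivAt
        (fun t _ => hasDerivAt_inner_basis hξ (b i) t)
        (Continuous.intervalIntegrable (by fun_prop) _ _), ← hξp 0]
      simp
    -- Parseval for $\xi'$ and $\eta$. Differentiation multiplies the coefficient $x$ by $-2\pi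
    -- i(k+1)$, and $\mathrm{Re}(iz)=-\mathrm{Im}\,z$; the factor $-\pi$ then yields
    -- $4\pi^2(k+1)\,\mathrm{Im}(\bar xy)$, matching the weights $2\pi\sqrt{k+1}$ of the two mode
    -- coordinates.
    have h := (hasSum_parseval_real (f := fun t => ⟪b i, deriv ξ t⟫_ℝ) (g := fun t => ⟪b i, η t⟫_ℝ)
      (by fun_prop) ((periodic_deriv (v := 0) (by simpa using hξp)).comp _) (by fun_prop)
      (hηp.comp _) hz).mul_left (-Real.pi)
    refine h.congr_fun fun k => ?_
    rw [expCoeff_deriv hξ hξp, modeCoord_eq, modeCoord_eq]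
    simp only [← hb]
    generalize expCoeff (fun t => (⟪b i, ξ t⟫_ℝ : ℂ)) k = x
    generalize expCoeff (fun t => (⟪b i, η t⟫_ℝ : ℂ)) k = y
    have hs : (Real.sqrt ((k : ℝ) + 1) : ℂ) * Real.sqrt ((k : ℝ) + 1) = k + 1 := by
      rw [← Complex.ofReal_mul, Real.mul_self_sqrt (by positivity)]
      push_cast
      rfl
    have e1 : (starRingEnd ℂ) (2 * Real.pi * Real.sqrt ((k : ℝ) + 1) * x) *
        (2 * Real.pi * Real.sqrt ((k : ℝ) + 1) * y) =
        ((4 * Real.pi ^ 2 * (k + 1) : ℝ) : ℂ) * ((starRingEnd ℂ) x * y) := by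
      simp only [map_mul, Complex.conj_ofReal, map_ofNat]
      push_cast
      linear_combination (4 * Real.pi ^ 2 * ((starRingEnd ℂ) x * y)) * hs
    have e2 : (starRingEnd ℂ) (-(2 * Real.pi * Complex.I * (k + 1)) * x) * y =
        ((2 * Real.pi * (k + 1) : ℝ) : ℂ) * (((starRingEnd ℂ) x * y) * Complex.I) := by
      simp only [map_mul, map_neg, map_add, Complex.conj_ofReal, map_ofNat, Complex.conj_I,
        Complex.conj_natCast, map_one]
      push_cast
      ring
    rw [e1, e2, Complex.re_ofReal_mul, Complex.im_ofReal_mul, Complex.mul_I_re]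
    ring
  have hs := Complex.imCLM.hasSum (lp.hasSum_inner (𝕜 := ℂ) (modes ξ) (modes η))
  rw [← (Equiv.prodComm _ _).hasSum_iff] at hs
  have h2 := hs.prod_fiberwise (g := fun i => -Real.pi * ∫ t in (0 : ℝ)..1,
    ⟪b i, deriv ξ t⟫_ℝ * ⟪b i, η t⟫_ℝ) fun i => (hi i).congr_fun fun k => by
      simp only [Function.comp, Equiv.prodComm_apply, Prod.swap_prod_mk, Complex.imCLM_apply]
      rw [modes_apply hξ hξp, modes_apply hη hηp, RCLike.inner_apply']
  have h3 := h2.unique (hasSum_fintype _)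
  rw [Complex.imCLM_apply] at h3
  rw [h3, ← Finset.mul_sum, ← intervalIntegral.integral_finsetSum]
  · congr 1
    refine intervalIntegral.integral_congr fun t _ => ?_
    rw [← b.sum_inner_mul_inner (deriv ξ t) (η t)]
    exact Finset.sum_congr rfl fun i _ => by rw [real_inner_comm (deriv ξ t)]
  · exact fun i _ => Continuous.intervalIntegrable (by fun_prop) _ _

/-- The bridge between the two cocycles: for periodic functions the boundary term of $S'$ vanishes,
and what remains is the phase of the Weyl relation. -/
theorem expI_actionForm_periodic {ξ η : ℝ → E} (hξ : ContDiff ℝ ∞ ξ) (hξp : Function.Periodic ξ 1)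
    (hη : ContDiff ℝ ∞ η) (hηp : Function.Periodic η 1) :
    expI (LatticeSpan.actionForm ξ η) = Circle.exp (-(⟪modes ξ, modes η⟫_ℂ).im) := by
  have h : ξ 1 = ξ 0 := by simpa using hξp 0
  rw [im_inner_modes hξ hξp hη hηp, LatticeSpan.actionForm, expI, h, sub_self, inner_zero_left]
  congr 1
  ring

end Modes

/-! ### Lifts, rotations and the central extension -/

namespace LatticeSpan

variable {L : LatticeSpan E}

theorem lift_add_one (γ : L.loops) (t : ℝ) : lift γ (t + 1) = lift γ t + (winding γ : E) :=
  (isLift_lift γ).quasi t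

theorem IsLift.add_one {γ : L.loops} {Ξ : ℝ → E} (h : IsLift γ Ξ) (t : ℝ) :
    Ξ (t + 1) = Ξ t + (winding γ : E) := by
  rw [h.quasi, h.diff_eq]
  rfl

theorem IsLift.sub_eq_winding {γ : L.loops} {Ξ : ℝ → E} (h : IsLift γ Ξ) :
    Ξ 1 - Ξ 0 = (winding γ : E) := h.diff_eq

omit [InnerProductSpace ℝ E] in
theorem mk_eq_zero_of_mem {A B : AddSubgroup E} (h : A ≤ B) {ν : E} (hν : ν ∈ A) :
    (ν : E ⧸ B) = 0 := (QuotientAddGroup.eq_zero_iff ν).2 (h hν)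

theorem IsLift.add_const {γ : L.loops} {Ξ : ℝ → E} (h : IsLift γ Ξ) {ν : E} (hν : ν ∈ L.Γ) :
    IsLift γ fun t => Ξ t + ν where
  smooth := h.smooth.add contDiff_const
  quasi t := by
    rw [h.quasi]
    abel
  lift_w t := by
    rw [QuotientAddGroup.mk_add, mk_eq_zero_of_mem L.le_w hν, add_zero, h.lift_w]
  lift_b t := by
    rw [QuotientAddGroup.mk_add, mk_eq_zero_of_mem L.le_b hν, add_zero, h.lift_b]
  lift_p := by
    rw [QuotientAddGroup.mk_add, mk_eq_zero_of_mem le_rfl hν, add_zero, h.lift_p]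

theorem isLift_rotLoop_lift (θ : ℝ) (γ : L.loops) :
    IsLift (rotLoop θ γ) fun t => lift γ (t - θ) where
  smooth := (isLift_lift γ).smooth.comp (by fun_prop)
  quasi t := by
    rw [show t + 1 - θ = t - θ + 1 by ring, show 1 - θ = 0 - θ + 1 by ring, lift_add_one,
      lift_add_one]
    abel
  lift_w _ := rfl
  lift_b _ := rfl
  lift_p := rfl

/-- `rotLoop` is defined through a chosen lift. Any other lift differs by a constant in $\Gamma$,
which is invisible in all three tori. -/
theorem IsLift.rot {γ : L.loops} {Ξ : ℝ → E} (h : IsLift γ Ξ) (θ : ℝ) :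
    IsLift (rotLoop θ γ) fun t => Ξ (t - θ) := by
  obtain ⟨ν, hν, e⟩ := (isLift_lift γ).unique h
  simp only [e]
  exact (isLift_rotLoop_lift θ γ).add_const hν

theorem IsLift.midQ_rot {γ : L.loops} {Ξ : ℝ → E} (h : IsLift γ Ξ) (θ : ℝ) :
    midQ (rotLoop θ γ) = midQ γ - (Ξ 0 : E) + (Ξ (-θ) : E) := by
  obtain ⟨ν, hν, e⟩ := (isLift_lift γ).unique h
  change midQ γ - (lift γ 0 : E) + (lift γ (-θ) : E) = _
  rw [e, e, QuotientAddGroup.mk_add, QuotientAddGroup.mk_add, mk_eq_zero_of_mem le_rfl hν,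
    add_zero, add_zero]

theorem winding_rotLoop (θ : ℝ) (γ : L.loops) : winding (rotLoop θ γ) = winding γ := by
  refine Subtype.ext ?_
  rw [← (isLift_rotLoop_lift θ γ).sub_eq_winding, show 1 - θ = 0 - θ + 1 by ring, lift_add_one]
  abel

/-- A lift determines both arcs and the value at $p$, but not the value at $q$, where a class in
$(\Lambda_\circ\cap\Lambda_\bullet)/\Gamma$ remains free. -/
theorem loops_ext {γ ρ : L.loops} {Ξ : ℝ → E} (h : IsLift γ Ξ) (k : IsLift ρ Ξ)
    (hq : midQ γ = midQ ρ) : γ = ρ := by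
  refine Subtype.ext (Prod.ext ?_ (Prod.ext ?_ (Prod.ext ?_ hq)))
  · exact funext fun t => (h.lift_w t).symm.trans (k.lift_w t)
  · exact funext fun t => (h.lift_b t).symm.trans (k.lift_b t)
  · exact h.lift_p.symm.trans k.lift_p

theorem rotLoop_add (θ : ℝ) (γ ρ : L.loops) :
    rotLoop θ (γ + ρ) = rotLoop θ γ + rotLoop θ ρ := by
  have h := (isLift_lift γ).add (isLift_lift ρ)
  refine loops_ext (h.rot θ) (((isLift_lift γ).rot θ).add ((isLift_lift ρ).rot θ)) ?_
  rw [h.midQ_rot]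
  change midQ γ + midQ ρ - _ + _ = midQ (rotLoop θ γ) + midQ (rotLoop θ ρ)
  rw [(isLift_lift γ).midQ_rot, (isLift_lift ρ).midQ_rot, QuotientAddGroup.mk_add,
    QuotientAddGroup.mk_add]
  abel

theorem rotLoop_zero (γ : L.loops) : rotLoop 0 γ = γ := by
  refine loops_ext ((isLift_lift γ).rot 0) (by simpa using isLift_lift γ) ?_
  rw [(isLift_lift γ).midQ_rot, neg_zero, sub_add_cancel]

theorem rotLoop_rotLoop (θ φ : ℝ) (γ : L.loops) :
    rotLoop (θ + φ) γ = rotLoop θ (rotLoop φ γ) := by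
  have h := (isLift_lift γ).rot φ
  refine loops_ext ((isLift_lift γ).rot (θ + φ)) (by simpa only [sub_sub] using h.rot θ) ?_
  rw [h.midQ_rot, (isLift_lift γ).midQ_rot, (isLift_lift γ).midQ_rot,
    show -(θ + φ) = -θ - φ by ring, zero_sub]
  abel

theorem intervalIntegral_deriv_inner {Ξ : ℝ → E} (hΞ : ContDiff ℝ ∞ Ξ) (v : E) (a b : ℝ) :
    ∫ t in a..b, ⟪deriv Ξ t, v⟫_ℝ = ⟪Ξ b - Ξ a, v⟫_ℝ := by
  have hd : ∀ t ∈ uIcc a b, HasDerivAt (fun t => ⟪Ξ t, v⟫_ℝ) ⟪deriv Ξ t, v⟫_ℝ t :=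
    fun t _ => by
      simpa using (hΞ.differentiable (by simp) t).hasDerivAt.inner ℝ (hasDerivAt_const t v)
  have hc := hΞ.continuous_deriv (by simp)
  rw [intervalIntegral.integral_eq_sub_of_hasDerivAt hd
    (Continuous.intervalIntegrable (by fun_prop) _ _), inner_sub_left]

/-- The behaviour of the form `S'` under rotations. -/
theorem actionForm_shift {Ξ Ψ : ℝ → E} {v w : E} (hΞ : ContDiff ℝ ∞ Ξ) (hΨ : ContDiff ℝ ∞ Ψ)
    (qΞ : ∀ t, Ξ (t + 1) = Ξ t + v) (qΨ : ∀ t, Ψ (t + 1) = Ψ t + w) (θ : ℝ) :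
    actionForm (fun t => Ξ (t - θ)) (fun t => Ψ (t - θ)) = actionForm Ξ Ψ +
      1 / 2 * ⟪Ξ (-θ) - Ξ 0, w⟫_ℝ + 1 / 2 * ⟪Ψ (-θ) - Ψ 0, v⟫_ℝ := by
  have hc := hΞ.continuous_deriv (by simp)
  have hc' := hΨ.continuous
  set f : ℝ → ℝ := fun t => ⟪deriv Ξ t, Ψ t⟫_ℝ with hf
  have fi : ∀ a b, IntervalIntegrable f MeasureTheory.volume a b := fun a b =>
    Continuous.intervalIntegrable (by fun_prop) _ _
  have e1 : ∫ t in (0 : ℝ)..1, ⟪deriv (fun t => Ξ (t - θ)) t, Ψ (t - θ)⟫_ℝ =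
      ∫ t in (-θ)..(1 - θ), f t := by
    simp only [deriv_comp_sub_const]
    rw [intervalIntegral.integral_comp_sub_right (f := f), zero_sub]
  -- Translation by a period fixes $\Xi'$ and adds `w` to $\Psi$; the extra integrand
  -- $\langle\Xi',w\rangle$ integrates to the last term.
  have e2 : ∫ t in (1 : ℝ)..(1 - θ), f t = (∫ t in (0 : ℝ)..(-θ), f t) + ⟪Ξ (-θ) - Ξ 0, w⟫_ℝ := by
    have h := intervalIntegral.integral_comp_add_right (a := 0) (b := -θ) (f := f) 1
    rw [zero_add, show -θ + 1 = 1 - θ by ring] at h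
    rw [← h, ← intervalIntegral_deriv_inner hΞ, ← intervalIntegral.integral_add (fi _ _)
      (Continuous.intervalIntegrable (by fun_prop) _ _)]
    refine intervalIntegral.integral_congr fun t _ => ?_
    simp only [hf]
    rw [periodic_deriv qΞ, qΨ, inner_add_right]
  have e3 : ∫ t in (-θ)..(1 - θ), f t = (∫ t in (0 : ℝ)..1, f t) + ⟪Ξ (-θ) - Ξ 0, w⟫_ℝ := by
    rw [← intervalIntegral.integral_add_adjacent_intervals (fi (-θ) 0) (fi 0 (1 - θ)),
      ← intervalIntegral.integral_add_adjacent_intervals (fi 0 1) (fi 1 (1 - θ)), e2,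
      intervalIntegral.integral_symm]
    ring
  have h1 : Ξ (1 - θ) - Ξ (0 - θ) = v := by
    rw [show 1 - θ = 0 - θ + 1 by ring, qΞ]
    abel
  have h2 : Ξ 1 - Ξ 0 = v := by
    rw [← zero_add (1 : ℝ), qΞ]
    abel
  rw [actionForm, actionForm, e1, e3, h1, h2, zero_sub, real_inner_comm v (Ψ (-θ) - Ψ 0),
    inner_sub_right]
  ring

section Ext

variable {ε : L.WindingCocycle}

theorem Ext.rot_eq (θ : ℝ) (x : Ext ε) {Ξ : ℝ → E} (h : IsLift x.loop Ξ) :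
    Ext.rot θ x = ⟨rotLoop θ x.loop,
      expI (1 / 2 * ⟪Ξ (-θ) - Ξ 0, ((winding x.loop : L.diff) : E)⟫_ℝ) * x.phase⟩ := by
  obtain ⟨ν, hν, e⟩ := (isLift_lift x.loop).unique h
  rw [Ext.rot, e, e, add_sub_add_right_eq_sub]

theorem expI_action_rot (θ : ℝ) (γ ρ : L.loops) :
    expI (actionForm (lift (rotLoop θ γ)) (lift (rotLoop θ ρ))) =
      expI (actionForm (lift γ) (lift ρ)) *
      expI (1 / 2 * ⟪lift γ (-θ) - lift γ 0, (winding ρ : E)⟫_ℝ) *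
      expI (1 / 2 * ⟪lift ρ (-θ) - lift ρ 0, (winding γ : E)⟫_ℝ) := by
  rw [← (isLift_rotLoop_lift θ γ).expI_actionForm (isLift_rotLoop_lift θ ρ),
    actionForm_shift (isLift_lift γ).smooth (isLift_lift ρ).smooth (lift_add_one γ)
      (lift_add_one ρ), expI_add, expI_add]

/-- This is what the phase in `Ext.rot` is for. The phase is quadratic in the loop, and its two
cross terms for a product are exactly the change of $S'$ under rotation (`actionForm_shift`); the
factor $\varepsilon$ does not change because winding elements are rotation invariant. -/
theorem Ext.rot_mul (θ : ℝ) (x y : Ext ε) : Ext.rot θ (x * y) = Ext.rot θ x * Ext.rot θ y := by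
  rw [Ext.rot_eq θ (x * y) ((isLift_lift x.loop).add (isLift_lift y.loop))]
  refine Ext.ext (rotLoop_add θ _ _) ?_
  simp only [Ext.mul_def, Ext.rot, loopCocycle, winding_rotLoop, expI_action_rot, map_add,
    AddSubgroup.coe_add]
  generalize ε.ε (winding x.loop) (winding y.loop) = c
  generalize expI (actionForm (lift x.loop) (lift y.loop)) = d
  rw [show lift x.loop (-θ) + lift y.loop (-θ) - (lift x.loop 0 + lift y.loop 0) =
    (lift x.loop (-θ) - lift x.loop 0) + (lift y.loop (-θ) - lift y.loop 0) by abel]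
  simp only [inner_add_left, inner_add_right, mul_add, expI_add]
  generalize expI _ = a1
  generalize expI _ = a2
  generalize expI _ = a3
  generalize expI _ = a4
  ac_rfl

theorem Ext.rot_zero (x : Ext ε) : Ext.rot 0 x = x := by
  refine Ext.ext (rotLoop_zero _) ?_
  simp [Ext.rot, expI_zero]

/-- The winding element is the same before and after rotation, so the phases add: the displacement
of the lift from $0$ to $-\theta-\varphi$ is split at $-\varphi$. -/
theorem Ext.rot_add (θ φ : ℝ) (x : Ext ε) : Ext.rot (θ + φ) x = Ext.rot θ (Ext.rot φ x) := by
  rw [Ext.rot_eq θ (Ext.rot φ x) (isLift_rotLoop_lift φ x.loop)]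
  refine Ext.ext (rotLoop_rotLoop θ φ _) ?_
  simp only [Ext.rot, winding_rotLoop]
  rw [← mul_assoc, ← expI_add, ← mul_add, ← inner_add_left, show -(θ + φ) = -θ - φ by ring, zero_sub]
  congr 4
  abel

theorem Ext.rot_inv_mul (θ : ℝ) (x y : Ext ε) :
    (Ext.rot θ x)⁻¹ * Ext.rot θ y = Ext.rot θ (x⁻¹ * y) := by
  rw [inv_mul_eq_iff_eq_mul, ← Ext.rot_mul, mul_inv_cancel_left]

theorem Ext.mem_ker {x : Ext ε} : x ∈ Ext.ker ε ↔ winding x.loop = 0 := Iff.rfl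

theorem Ext.rot_mem_ker {θ : ℝ} {x : Ext ε} : Ext.rot θ x ∈ Ext.ker ε ↔ x ∈ Ext.ker ε := by
  rw [Ext.mem_ker, Ext.mem_ker, Ext.rot, winding_rotLoop]

theorem Ext.inv_mul_mem_ker {x y : Ext ε} :
    x⁻¹ * y ∈ Ext.ker ε ↔ winding x.loop = winding y.loop := by
  change winding (-x.loop + y.loop) = 0 ↔ _
  rw [map_add, map_neg, neg_add_eq_zero]

end Ext

/-! ### Loops with a prescribed lift -/

/-- The converse of lifting. Quasi-periodicity makes the derivatives of order at least one periodic,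
which gives their agreement at $q$; the class of `y` is the value there, and the two membership
conditions say that it projects to the end points of the arcs. -/
theorem exists_isLift_of_quasiperiodic {Ξ : ℝ → E} {v y : E} (hs : ContDiff ℝ ∞ Ξ)
    (hq : ∀ t, Ξ (t + 1) = Ξ t + v) (hw : y - Ξ 1 ∈ L.Λw) (hb : y - Ξ 0 ∈ L.Λb) :
    ∃ γ : L.loops, IsLift γ Ξ ∧ midQ γ = y := by
  refine ⟨⟨(fun t => (Ξ t : E), fun t => (Ξ t : E), (Ξ (1 / 2) : E), (y : E)), rfl, rfl, ?_, ?_,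
    Ξ, Ξ, hs.contDiffOn, hs.contDiffOn, fun _ => rfl, fun _ => rfl, fun k hk => ?_,
    fun k hk => ?_⟩, ⟨hs, fun t => ?_, fun _ => rfl, fun _ => rfl, rfl⟩, rfl⟩
  · change ((_ : E) : E ⧸ L.Λw) = _
    exact QuotientAddGroup.eq_iff_sub_mem.2 hw
  · change ((_ : E) : E ⧸ L.Λb) = _
    exact QuotientAddGroup.eq_iff_sub_mem.2 hb
  · rw [iteratedDerivWithin_mono_Icc (c := 0) (d := 1) (by norm_num) (by norm_num)
      (Icc_subset_Icc (by norm_num) le_rfl) hs.contDiffOn ⟨le_rfl, by norm_num⟩,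
      iteratedDerivWithin_mono_Icc (c := 0) (d := 1) (by norm_num) (by norm_num)
      (Icc_subset_Icc le_rfl (by norm_num)) hs.contDiffOn ⟨by norm_num, le_rfl⟩]
  · have e := iteratedDerivWithin_Icc_shift (a := 1) (b := 2) (t := 1) (s := 1)
      (f := Ξ) (g := Ξ) (v := v) (fun t _ => by rw [← hq, sub_add_cancel]) hk
      ⟨le_rfl, by norm_num⟩
    norm_num only at e
    rw [iteratedDerivWithin_mono_Icc (c := 0) (d := 2) (by norm_num) (by norm_num)
      (Icc_subset_Icc (by norm_num) (by norm_num)) hs.contDiffOn ⟨by norm_num, le_rfl⟩,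
      ← iteratedDerivWithin_mono_Icc (a := 1) (b := 2) (by norm_num) (by norm_num)
      (Icc_subset_Icc (by norm_num) le_rfl) hs.contDiffOn ⟨le_rfl, by norm_num⟩, e,
      iteratedDerivWithin_mono_Icc (a := 0) (b := 1 / 2) (c := 0) (d := 1) (by norm_num)
      (by norm_num) (Icc_subset_Icc le_rfl (by norm_num)) hs.contDiffOn ⟨le_rfl, by norm_num⟩]
  · rw [hq t, ← zero_add (1 : ℝ), hq 0]
    abel

theorem exists_isLift_const (v : E) :
    ∃ γ : L.loops, IsLift γ (fun _ => v) ∧ midQ γ = v :=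
  exists_isLift_of_quasiperiodic (v := 0) contDiff_const (by simp) (by simp) (by simp)

/-- The geodesic loop of a given winding element. -/
theorem exists_isLift_linear (Δ : L.diff) :
    ∃ γ : L.loops, IsLift γ (fun t => t • (Δ : E)) ∧ winding γ = Δ := by
  obtain ⟨a, ha, b, hb, e⟩ := Δ.2
  -- For $\Delta=a-b$ the value $-b$ at $q$ works: it differs from the end value $\Delta$ by
  -- $-a\in\Lambda_\circ$ and from the initial value $0$ by $-b\in\Lambda_\bullet$.
  obtain ⟨γ, h, -⟩ := exists_isLift_of_quasiperiodic (L := L) (Ξ := fun t => t • (Δ : E))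
    (v := (Δ : E)) (y := -b) (contDiff_id.smul contDiff_const) (fun t => by rw [add_smul, one_smul])
    (by rw [one_smul, e, show -b - (a - b) = -a by abel]; exact neg_mem ha)
    (by rw [zero_smul, sub_zero]; exact neg_mem hb)
  refine ⟨γ, h, Subtype.ext ?_⟩
  rw [← h.sub_eq_winding]
  simp

/-- Rotation translates a geodesic by the constant $-\theta\Delta$. Its phase contributes
$-\frac12\theta\langle\Delta,\Delta\rangle$ and the cocycle of the product contributes
$-\theta\langle\Delta,\Delta\rangle$, so the kernel element must carry
$+\frac12\theta\langle\Delta,\Delta\rangle$. -/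
theorem exists_rot_linear {ε : L.WindingCocycle} {x : Ext ε}
    (hx : IsLift x.loop fun t => t • ((winding x.loop : L.diff) : E)) (θ : ℝ) :
    ∃ h : Ext.ker ε, Ext.rot θ x = x * h ∧
      IsLift h.1.loop (fun _ => -(θ • ((winding x.loop : L.diff) : E))) ∧
      midQ h.1.loop = ((-(θ • ((winding x.loop : L.diff) : E)) : E) : E ⧸ L.Γ) ∧
      h.1.phase = expI (1 / 2 * θ * ⟪(winding x.loop : E), (winding x.loop : E)⟫_ℝ) := by
  set Δ : E := ((winding x.loop : L.diff) : E) with hΔ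
  obtain ⟨γ, hγ, hq⟩ := exists_isLift_const (L := L) (-(θ • Δ))
  have hw : winding γ = 0 := Subtype.ext (by rw [← hγ.sub_eq_winding]; simp)
  refine ⟨⟨⟨γ, expI (1 / 2 * θ * ⟪Δ, Δ⟫_ℝ)⟩, hw⟩, ?_, hγ, hq, rfl⟩
  rw [Ext.rot_eq θ x hx]
  refine Ext.ext (loops_ext (hx.rot θ) (Ξ := fun t => (t - θ) • Δ) ?_ ?_) ?_
  · have h := hx.add hγ
    simp only [← sub_eq_add_neg, ← sub_smul] at h
    exact h
  · rw [hx.midQ_rot]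
    change _ = midQ x.loop + midQ γ
    rw [hq, zero_smul, QuotientAddGroup.mk_zero, sub_zero, neg_smul]
  · simp only [Ext.mul_def, loopCocycle, hw, ε.zero_right, one_mul]
    rw [← hx.expI_actionForm hγ, actionForm_const_right hx.smooth, mul_assoc, ← expI_add,
      mul_comm x.phase]
    congr 2
    simp only [zero_smul, one_smul, sub_zero, neg_smul, inner_neg_left, inner_neg_right,
      real_inner_smul_left, real_inner_smul_right, ← hΔ]
    ring

end LatticeSpan

/-! ### The representations `W_{χ,l}` -/

namespace LatticeSpan

variable [FiniteDimensional ℝ E] {L : LatticeSpan E} {ε : L.WindingCocycle}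
  (χ : AddChar L.interQuot Circle) {l : E}

omit [FiniteDimensional ℝ E] in
theorem IsLift.periodic {γ : L.loops} {Ξ : ℝ → E} (h : IsLift γ Ξ) (hw : winding γ = 0) :
    Function.Periodic Ξ 1 := fun t => by rw [h.add_one, hw]; simp

omit [FiniteDimensional ℝ E] in
theorem IsLift.coe_midDefect {γ : L.loops} {Ξ : ℝ → E} (h : IsLift γ Ξ) (hw : winding γ = 0) :
    (midDefect γ hw : E ⧸ L.Γ) = midQ γ - (Ξ 1 : E) := by
  obtain ⟨ν, hν, e⟩ := (isLift_lift γ).unique h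
  rw [e, QuotientAddGroup.mk_add, mk_eq_zero_of_mem le_rfl hν, add_zero]
  rfl

/-- Any lift may be used: a shift by $\nu\in\Gamma$ changes the mean by $\nu$, where $e^{2\pi
i\langle l,\nu\rangle}=1$, and leaves the mean-free part alone. -/
theorem repW_eq (hl : ∀ x ∈ L.Γ, ∃ k : ℤ, ⟪l, x⟫_ℝ = k) (x : Ext.ker ε) {Ξ : ℝ → E}
    (h : IsLift x.1.loop Ξ) : repW χ l x =
      ((χ (midDefect x.1.loop x.2) * expI ⟪l, ∫ t in (0 : ℝ)..1, Ξ t⟫_ℝ : Circle) : ℂ) •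
        Fock.weyl (modes fun t => Ξ t - ∫ t in (0 : ℝ)..1, Ξ t) x.1.phase := by
  obtain ⟨ν, hν, e⟩ := (isLift_lift x.1.loop).unique h
  obtain ⟨k, hk⟩ := hl ν hν
  have ha : ∫ t in (0 : ℝ)..1, Ξ t = avg x.1.loop + ν := by
    simp only [e]
    rw [intervalIntegral.integral_add
      ((isLift_lift x.1.loop).smooth.continuous.intervalIntegrable _ _) (by simp)]
    simp [avg]
  rw [repW, ha, inner_add_right, expI_add, hk, expI_int, mul_one]
  congr 3
  funext t
  rw [e, add_sub_add_right_eq_sub]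

theorem inner_repW (x : Ext.ker ε) (v w : Fock (OneParticle E)) :
    ⟪repW χ l x v, repW χ l x w⟫_ℂ = ⟪v, w⟫_ℂ := by
  simp only [repW, smul_apply]
  rw [inner_smul_left, inner_smul_right, Fock.inner_weyl_weyl, ← mul_assoc, mul_comm (starRingEnd ℂ _),
    Complex.mul_conj, Complex.normSq_eq_norm_sq, Circle.norm_coe]
  simp

/-- Over the kernel $\varepsilon$ equals $1$, and constants may be subtracted from both lifts
without changing $S'$ since the winding vanishes. So $c$ is the Weyl phase of the mean-free parts,
and the remaining factors are characters. -/
theorem repW_mul (hl : ∀ x ∈ L.Γ, ∃ k : ℤ, ⟪l, x⟫_ℝ = k) (x y : Ext.ker ε)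
    (v : Fock (OneParticle E)) : repW χ l (x * y) v = repW χ l x (repW χ l y v) := by
  have hx := isLift_lift x.1.loop
  have hy := isLift_lift y.1.loop
  have hxy : IsLift (x * y).1.loop fun t => lift x.1.loop t + lift y.1.loop t := hx.add hy
  have hd : midDefect (x * y).1.loop (x * y).2 =
      midDefect x.1.loop x.2 + midDefect y.1.loop y.2 := by
    refine Subtype.ext (((hxy.coe_midDefect (x * y).2).trans ?_).trans
      (congrArg₂ (· + ·) (hx.coe_midDefect x.2) (hy.coe_midDefect y.2)).symm)
    rw [QuotientAddGroup.mk_add, show midQ (x * y).1.loop = midQ x.1.loop + midQ y.1.loop from rfl]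
    exact add_sub_add_comm _ _ _ _
  have ha : ∫ t in (0 : ℝ)..1, (lift x.1.loop t + lift y.1.loop t) =
      avg x.1.loop + avg y.1.loop := by
    rw [intervalIntegral.integral_add (hx.smooth.continuous.intervalIntegrable _ _)
      (hy.smooth.continuous.intervalIntegrable _ _)]
    rfl
  have sm : ∀ z : Ext.ker ε, ContDiff ℝ ∞ fun t => lift z.1.loop t - avg z.1.loop := fun z =>
    (isLift_lift z.1.loop).smooth.sub contDiff_const
  have pe : ∀ z : Ext.ker ε, Function.Periodic (fun t => lift z.1.loop t - avg z.1.loop) 1 :=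
    fun z t => by
      change lift z.1.loop (t + 1) - _ = lift z.1.loop t - _
      rw [(isLift_lift z.1.loop).periodic z.2 t]
  have hm : (modes fun t => lift x.1.loop t + lift y.1.loop t -
      ∫ t in (0 : ℝ)..1, (lift x.1.loop t + lift y.1.loop t)) =
      modes (fun t => lift x.1.loop t - avg x.1.loop) +
        modes (fun t => lift y.1.loop t - avg y.1.loop) := by
    rw [← modes_add (sm x) (pe x) (sm y) (pe y), ha]
    congr 1
    funext t
    abel
  have hc : Circle.exp (-(⟪modes (fun t => lift x.1.loop t - avg x.1.loop),
      modes (fun t => lift y.1.loop t - avg y.1.loop)⟫_ℂ).im) =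
      expI (actionForm (lift x.1.loop) (lift y.1.loop)) := by
    rw [← expI_actionForm_periodic (sm x) (pe x) (sm y) (pe y)]
    simp only [sub_eq_add_neg]
    rw [actionForm_add_left hx.smooth contDiff_const (hy.smooth.add contDiff_const),
      actionForm_const_left, add_zero, actionForm_add_right hx.smooth hy.smooth contDiff_const,
      actionForm_const_right hx.smooth, hx.sub_eq_winding, Ext.mem_ker.1 x.2]
    simp
  have hp : (x * y).1.phase = x.1.phase * y.1.phase *
      expI (actionForm (lift x.1.loop) (lift y.1.loop)) := by
    change x.1.phase * y.1.phase * loopCocycle ε x.1.loop y.1.loop = _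
    rw [loopCocycle, Ext.mem_ker.1 x.2, ε.zero_left, one_mul]
  rw [repW_eq χ hl (x * y) hxy, repW, repW, hm, ha, hp, hd]
  simp only [smul_apply, map_smul, smul_smul]
  rw [Fock.weyl_weyl, hc, inner_add_right, expI_add, AddChar.map_add_eq_mul]
  congr 1
  push_cast
  ring

/-- Loops with a constant lift and trivial component act by scalars. -/
theorem repW_const (hl : ∀ x ∈ L.Γ, ∃ k : ℤ, ⟪l, x⟫_ℝ = k) (x : Ext.ker ε) {w : E}
    (h : IsLift x.1.loop fun _ => w) (hq : midQ x.1.loop = (w : E ⧸ L.Γ))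
    (v : Fock (OneParticle E)) :
    repW χ l x v = ((expI ⟪l, w⟫_ℝ * x.1.phase : Circle) : ℂ) • v := by
  have hd : midDefect x.1.loop x.2 = 0 := 
    Subtype.ext ((h.coe_midDefect x.2).trans (sub_eq_zero.2 hq))
  have ha : ∫ _ in (0 : ℝ)..1, w = w := by simp
  rw [repW_eq χ hl x h, hd, ha]
  simp only [sub_self, modes_zero, AddChar.map_zero_eq_one, one_mul, smul_apply,
    Fock.weyl_zero, smul_smul, Circle.coe_mul]

theorem repW_one (hl : ∀ x ∈ L.Γ, ∃ k : ℤ, ⟪l, x⟫_ℝ = k) (v : Fock (OneParticle E)) :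
    repW χ l (1 : Ext.ker ε) v = v := by
  have h : IsLift (1 : Ext.ker ε).1.loop (fun _ => (0 : E)) :=
    ⟨contDiff_const, by simp, fun _ => rfl, fun _ => rfl, rfl⟩
  rw [repW_const χ hl 1 h rfl, inner_zero_right, expI_zero]
  simp [Ext.one_def]

omit [FiniteDimensional ℝ E] in
theorem rotMode_zero_apply (x : OneParticle E) : rotMode 0 x = x := by
  refine lp.ext (funext fun p => ?_)
  change (expI ((p.1 + 1) * 0) : ℂ) * x p = x p
  rw [mul_zero, expI_zero, Circle.coe_one, one_mul]

omit [FiniteDimensional ℝ E] in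
theorem rotMode_comp (θ φ : ℝ) :
    (rotMode θ).comp (rotMode φ) = (rotMode (θ + φ) : OneParticle E →ₗᵢ[ℂ] OneParticle E) := by
  ext x p
  change (expI ((p.1 + 1) * θ) : ℂ) * ((expI ((p.1 + 1) * φ) : ℂ) * x p) =
    (expI ((p.1 + 1) * (θ + φ)) : ℂ) * x p
  rw [mul_add, expI_add, Circle.coe_mul, mul_assoc]

omit [FiniteDimensional ℝ E] in
theorem inner_repR (θ : ℝ) (v w : Fock (OneParticle E)) :
    ⟪repR l θ v, repR l θ w⟫_ℂ = ⟪v, w⟫_ℂ := by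
  simp only [repR, smul_apply]
  rw [inner_smul_left, inner_smul_right, Fock.inner_map_map, ← mul_assoc,
    mul_comm (starRingEnd ℂ _), Complex.mul_conj, Complex.normSq_eq_norm_sq, Circle.norm_coe]
  simp

omit [FiniteDimensional ℝ E] in
theorem repR_zero (v : Fock (OneParticle E)) : repR l 0 v = v := by
  have h : (rotMode 0 : OneParticle E →ₗᵢ[ℂ] OneParticle E) = LinearIsometry.id :=
    LinearIsometry.ext rotMode_zero_apply
  rw [repR, h, mul_zero, expI_zero, Circle.coe_one, one_smul, Fock.map_id]

omit [FiniteDimensional ℝ E] in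
theorem repR_add (θ φ : ℝ) (v : Fock (OneParticle E)) :
    repR l (θ + φ) v = repR l θ (repR l φ v) := by
  simp only [repR, smul_apply, map_smul, Fock.map_map, rotMode_comp, smul_smul]
  rw [← Circle.coe_mul, ← expI_add, ← mul_add, add_comm φ]

/-- The intertwining relation between `W_{χ,l}` and `R_{χ,l}`. -/
theorem repR_repW (hl : ∀ x ∈ L.Γ, ∃ k : ℤ, ⟪l, x⟫_ℝ = k) (θ : ℝ) (x y : Ext.ker ε)
    (hy : y.1 = Ext.rot θ x.1) (v : Fock (OneParticle E)) :
    repR l θ (repW χ l x v) = repW χ l y (repR l θ v) := by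
  obtain ⟨y, hyk⟩ := y
  obtain rfl : y = Ext.rot θ x.1 := hy
  have hx := isLift_lift x.1.loop
  have hxp := hx.periodic x.2
  have hr : IsLift (Ext.rot θ x.1).loop fun t => lift x.1.loop (t - θ) :=
    isLift_rotLoop_lift θ x.1.loop
  have ha : ∫ t in (0 : ℝ)..1, lift x.1.loop (t - θ) = avg x.1.loop := by
    rw [intervalIntegral.integral_comp_sub_right (f := lift x.1.loop)]
    have i := hxp.intervalIntegral_add_eq (0 - θ) 0
    rwa [zero_add, show 0 - θ + 1 = 1 - θ by ring] at i
  have hd : midDefect (Ext.rot θ x.1).loop hyk = midDefect x.1.loop x.2 := by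
    refine Subtype.ext (((hr.coe_midDefect hyk).trans ?_).trans (hx.coe_midDefect x.2).symm)
    rw [show (Ext.rot θ x.1).loop = rotLoop θ x.1.loop from rfl,
      hx.midQ_rot, show 1 - θ = -θ + 1 by ring, hxp (-θ),
      show lift x.1.loop 1 = lift x.1.loop 0 by simpa using hxp 0]
    abel
  have hp : (Ext.rot θ x.1).phase = x.1.phase := by
    simp [Ext.rot, Ext.mem_ker.1 x.2, expI_zero]
  have hm := modes_shift (ξ := fun t => lift x.1.loop t - avg x.1.loop)
    (hx.smooth.sub contDiff_const) (fun t => by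
      change lift x.1.loop (t + 1) - _ = lift x.1.loop t - _
      rw [hxp t]) θ
  rw [repW_eq χ hl ⟨_, hyk⟩ hr, repW]
  simp only [repR, smul_apply, map_smul, smul_smul, Fock.map_weyl, ha, hd, hp, hm]
  rw [mul_comm]

/-! ### The induced representation -/

-- The coset is kept as a variable `σ`, so that two vectors in the same coset can be written with
-- one common representative although the kernel membership proof depends on it.
open Classical in
theorem Ind.mk_eq_single {x : Ext ε} {σ : Ext ε ⧸ Ext.ker ε} (h : (x : Ext ε ⧸ Ext.ker ε) = σ)
    (v : Fock (OneParticle E)) : ∃ hk : σ.out⁻¹ * x ∈ Ext.ker ε,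
      Ind.mk χ l x v = lp.single 2 σ (repW χ l ⟨σ.out⁻¹ * x, hk⟩ v) := by
  subst h
  exact ⟨_, rfl⟩

/-- With $\sigma$ the chosen representative, $W(\sigma^{-1}y)=W(\sigma^{-1}x)W(x^{-1}y)$, and
$W(\sigma^{-1}x)$ preserves inner products. The choice drops out and only $x^{-1}y$ is left. -/
theorem Ind.inner_mk (hl : ∀ x ∈ L.Γ, ∃ k : ℤ, ⟪l, x⟫_ℝ = k) {x y : Ext ε}
    (h : x⁻¹ * y ∈ Ext.ker ε) (v w : Fock (OneParticle E)) :
    ⟪Ind.mk χ l x v, Ind.mk χ l y w⟫_ℂ = ⟪v, repW χ l ⟨x⁻¹ * y, h⟩ w⟫_ℂ := by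
  classical
  obtain ⟨hx, ex⟩ := Ind.mk_eq_single χ (l := l) (QuotientGroup.eq.2 h) v
  obtain ⟨hy, ey⟩ := Ind.mk_eq_single χ (l := l) (x := y) rfl w
  have e : (⟨_, hy⟩ : Ext.ker ε) = ⟨_, hx⟩ * ⟨x⁻¹ * y, h⟩ := Subtype.ext (by
    change _ = _ * _
    group)
  rw [ex, ey, lp.inner_single_left, lp.single_apply_self, e, repW_mul χ hl, inner_repW]

theorem Ind.inner_mk_of_not_mem {x y : Ext ε} (h : x⁻¹ * y ∉ Ext.ker ε)
    (v w : Fock (OneParticle E)) : ⟪Ind.mk χ l x v, Ind.mk χ l y w⟫_ℂ = 0 := by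
  classical
  rw [Ind.mk, Ind.mk, lp.inner_single_left, lp.single_apply_ne _ _ _ fun e => h (QuotientGroup.eq.1 e),
    inner_zero_right]

theorem Ind.total_mk (hl : ∀ x ∈ L.Γ, ∃ k : ℤ, ⟪l, x⟫_ℝ = k) :
    Total fun p : Ext ε × Fock (OneParticle E) => Ind.mk χ l p.1 p.2 := by
  classical
  intro v hv
  refine lp.ext (funext fun σ => ?_)
  obtain ⟨hk, e⟩ := Ind.mk_eq_single χ (l := l) (QuotientGroup.out_eq' σ) (v σ)
  have h1 : (⟨_, hk⟩ : Ext.ker ε) = 1 := Subtype.ext (inv_mul_cancel _)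
  have h : ⟪Ind.mk χ l σ.out (v σ), v⟫_ℂ = 0 := hv (σ.out, v σ)
  rw [e, lp.inner_single_left, h1, repW_one χ hl] at h
  exact inner_self_eq_zero.1 h

theorem Ind.mk_mul (hl : ∀ x ∈ L.Γ, ∃ k : ℤ, ⟪l, x⟫_ℝ = k) (x : Ext ε) (h : Ext.ker ε)
    (v : Fock (OneParticle E)) : Ind.mk χ l (x * h.1) v = Ind.mk χ l x (repW χ l h v) := by
  classical
  have hc : ((x * h.1 : Ext ε) : Ext ε ⧸ Ext.ker ε) = x := by
    rw [QuotientGroup.eq]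
    simp
  obtain ⟨hk, e⟩ := Ind.mk_eq_single χ (l := l) hc v
  have e1 : (⟨_, hk⟩ : Ext.ker ε) =
      ⟨(x : Ext ε ⧸ Ext.ker ε).out⁻¹ * x, QuotientGroup.eq.1 (QuotientGroup.out_eq' _)⟩ * h :=
    Subtype.ext (mul_assoc _ _ _).symm
  rw [e, Ind.mk, e1, repW_mul χ hl]

open Classical in
variable (l) in
/-- The map `v ↦ [x, v]` as a continuous linear map. -/
def Ind.mkL (x : Ext ε) : Fock (OneParticle E) →L[ℂ] Ind ε :=
  (lp.singleContinuousLinearMap ℂ (fun _ : Ext ε ⧸ Ext.ker ε => Fock (OneParticle E)) 2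
    (x : Ext ε ⧸ Ext.ker ε)).comp (repW χ l
      ⟨((x : Ext ε ⧸ Ext.ker ε).out)⁻¹ * x, QuotientGroup.eq.1 (QuotientGroup.out_eq' _)⟩)

theorem Ind.mkL_apply (x : Ext ε) (v : Fock (OneParticle E)) :
    Ind.mkL χ l x v = Ind.mk χ l x v := rfl

/-- The representation `Ind W_{χ,l}`. -/
theorem Ind.exists_repW (hl : ∀ x ∈ L.Γ, ∃ k : ℤ, ⟪l, x⟫_ℝ = k) :
    ∃ Q : Ext ε →* (Ind ε ≃ₗᵢ[ℂ] Ind ε), ∀ g x v, Q g (Ind.mk χ l x v) = Ind.mk χ l (g * x) v := by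
  obtain ⟨Q, hQ⟩ := exists_rep_of_gram (Ind.total_mk χ hl)
    (fun (g : Ext ε) (p : Ext ε × Fock (OneParticle E)) => (g * p.1, p.2)) (fun g p q => by
      have e : (g * p.1)⁻¹ * (g * q.1) = p.1⁻¹ * q.1 := by group
      by_cases h : p.1⁻¹ * q.1 ∈ Ext.ker ε
      · rw [Ind.inner_mk χ hl h, Ind.inner_mk χ hl (by rwa [e])]
        simp only [e]
      · rw [Ind.inner_mk_of_not_mem χ h, Ind.inner_mk_of_not_mem χ (by rwa [e])])
    (fun p => by rw [one_mul]) (fun g h p => by rw [mul_assoc])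
  exact ⟨Q, fun g x v => hQ g (x, v)⟩

/-- The rotation `Ind R_{χ,l}` as a representation of the universal covering group `ℝ`. -/
theorem Ind.exists_repR (hl : ∀ x ∈ L.Γ, ∃ k : ℤ, ⟪l, x⟫_ℝ = k) :
    ∃ R : Multiplicative ℝ →* (Ind ε ≃ₗᵢ[ℂ] Ind ε), ∀ (θ : ℝ) x v,
      R (Multiplicative.ofAdd θ) (Ind.mk χ l x v) = Ind.mk χ l (Ext.rot θ x) (repR l θ v) := by
  obtain ⟨R, hR⟩ := exists_rep_of_gram (Ind.total_mk χ hl)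
    (fun (θ : Multiplicative ℝ) (p : Ext ε × Fock (OneParticle E)) =>
      (Ext.rot θ.toAdd p.1, repR l θ.toAdd p.2)) (fun θ p q => by
      -- Rotation carries $x^{-1}y$ to its rotate, and the intertwining relation on $\mathcal S$
      -- compensates for this in the Gram matrix.
      have e := Ext.rot_inv_mul θ.toAdd p.1 q.1
      by_cases h : p.1⁻¹ * q.1 ∈ Ext.ker ε
      · rw [Ind.inner_mk χ hl h, Ind.inner_mk χ hl (by rwa [e, Ext.rot_mem_ker]),
          ← repR_repW χ hl θ.toAdd ⟨_, h⟩ _ e, inner_repR]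
      · rw [Ind.inner_mk_of_not_mem χ h,
          Ind.inner_mk_of_not_mem χ (by rwa [e, Ext.rot_mem_ker])])
    (fun p => by simp only [toAdd_one, Ext.rot_zero, repR_zero])
    (fun θ φ p => by simp only [toAdd_mul, Ext.rot_add, repR_add])
  exact ⟨R, fun θ x v => hR (Multiplicative.ofAdd θ) (x, v)⟩

/-! ### An eigenbasis of the rotations -/

variable (E) in
/-- The standard Hilbert basis of the one-particle space. -/
def modeBasis : HilbertBasis (ℕ × Fin (Module.finrank ℝ E)) ℂ (OneParticle E) :=
  HilbertBasis.ofRepr (LinearIsometryEquiv.refl ℂ _)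

omit [FiniteDimensional ℝ E] in
theorem rotMode_modeBasis (θ : ℝ) (p : ℕ × Fin (Module.finrank ℝ E)) :
    rotMode θ (modeBasis E p) = (expI ((p.1 + 1) * θ) : ℂ) • modeBasis E p := by
  classical
  have hb : modeBasis E p = lp.single 2 p (1 : ℂ) := by
    rw [← (modeBasis E).repr_symm_single]
    rfl
  refine lp.ext (funext fun q => ?_)
  change (expI ((q.1 + 1) * θ) : ℂ) * modeBasis E p q = (expI ((p.1 + 1) * θ) : ℂ) * modeBasis E p q
  rcases eq_or_ne q p with rfl | hne
  · rfl
  · rw [hb, lp.single_apply_ne _ _ _ hne, mul_zero, mul_zero]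

/-- The energy `∑ (j + 1)` of a finite multiset of modes `(j, i)`. -/
def modeEnergy {κ : Type*} (s : Multiset (ℕ × κ)) : ℕ := (s.map fun p => p.1 + 1).sum

theorem prod_map_expI {κ : Type*} (s : Multiset (ℕ × κ)) (θ : ℝ) :
    (s.map fun p : ℕ × κ => (expI ((p.1 + 1) * θ) : ℂ)).prod = expI (modeEnergy s * θ) := by
  induction s using Multiset.induction_on with
  | empty => simp [modeEnergy, expI_zero]
  | cons p s ih =>
    rw [Multiset.map_cons, Multiset.prod_cons, ih, ← Circle.coe_mul, ← expI_add, ← add_mul]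
    simp [modeEnergy]

/-- The induced representation has a Hilbert basis that diagonalises the rotations. -/
theorem Ind.exists_eigenbasis (hl : ∀ x ∈ L.Γ, ∃ k : ℤ, ⟪l, x⟫_ℝ = k) :
    ∃ b : HilbertBasis (L.diff × Multiset (ℕ × Fin (Module.finrank ℝ E))) ℂ (Ind ε),
      ∀ i, ∃ x v, b i = Ind.mk χ l x v ∧ ∀ θ, Ind.mk χ l (Ext.rot θ x) (repR l θ v) =
        (expI ((⟪l - (i.1 : E), l - (i.1 : E)⟫_ℝ / 2 + modeEnergy i.2) * θ) : ℂ) •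
          Ind.mk χ l x v := by
  obtain ⟨β, hβ⟩ := Fock.exists_hilbertBasis (modeBasis E)
  choose γ hγ hw using exists_isLift_linear (L := L)
  let x : L.diff → Ext ε := fun Δ => ⟨γ Δ, 1⟩
  have hx : ∀ Δ, winding (x Δ).loop = Δ := hw
  have ho : Orthonormal ℂ fun i : L.diff × Multiset (ℕ × Fin (Module.finrank ℝ E)) =>
      Ind.mk χ l (x i.1) (β i.2) := by
    classical
    rw [orthonormal_iff_ite]
    rintro ⟨Δ, s⟩ ⟨Δ', t⟩
    dsimp only
    by_cases hΔ : Δ = Δ'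
    · subst hΔ
      rw [Ind.inner_mk χ hl (x := x Δ) (y := x Δ) (by simp)]
      have h1 : (⟨(x Δ)⁻¹ * x Δ, by simp⟩ : Ext.ker ε) = 1 := Subtype.ext (inv_mul_cancel _)
      rw [h1, repW_one χ hl, orthonormal_iff_ite.1 β.orthonormal]
      simp
    · rw [Ind.inner_mk_of_not_mem χ (fun h => hΔ ?_), if_neg (fun h => hΔ (congrArg Prod.fst h))]
      rwa [Ext.inv_mul_mem_ker, hx, hx] at h
  -- Every `y` is $x_\Delta h$ with $\Delta$ its winding element and $h$ in the kernel, so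
  -- $[y,w]=[x_\Delta,W(h)w]$, and the vector $W(h)w$ is approximated in the basis `β`.
  have ht : Total fun i : L.diff × Multiset (ℕ × Fin (Module.finrank ℝ E)) =>
      Ind.mk χ l (x i.1) (β i.2) := by
    intro v hv
    refine Ind.total_mk χ hl v fun ⟨y, w⟩ => ?_
    have hy : (x (winding y.loop))⁻¹ * y ∈ Ext.ker ε := by rw [Ext.inv_mul_mem_ker, hx]
    have e := Ind.mk_mul χ hl (x (winding y.loop)) ⟨_, hy⟩ w
    rw [show x (winding y.loop) * ((x (winding y.loop))⁻¹ * y) = y from mul_inv_cancel_left _ _] at e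
    dsimp only
    rw [e, ← inner_conj_symm, map_eq_zero]
    have hz : (innerSL ℂ v).comp (Ind.mkL χ l (x (winding y.loop))) = 0 :=
      (Total.of_hilbertBasis β).ext fun s => by
        rw [ContinuousLinearMap.comp_apply, Ind.mkL_apply, innerSL_apply_apply, ← inner_conj_symm,
          hv (winding y.loop, s), map_zero]
        rfl
    exact congrArg (fun T : Fock (OneParticle E) →L[ℂ] ℂ => T _) hz
  refine ⟨HilbertBasis.mkOfOrthogonalEqBot ho ht.orthogonal_eq_bot, fun ⟨Δ, s⟩ =>
    ⟨x Δ, β s, by rw [HilbertBasis.coe_mkOfOrthogonalEqBot], fun θ => ?_⟩⟩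
  have hlin : IsLift (x Δ).loop fun t => t • ((winding (x Δ).loop : L.diff) : E) := by
    rw [hx]
    exact hγ Δ
  obtain ⟨h, e1, e2, e3, e4⟩ := exists_rot_linear hlin θ
  rw [hx] at e2 e3 e4
  have hR : repR l θ (β s) = (expI ((⟪l, l⟫_ℝ / 2 + modeEnergy s) * θ) : ℂ) • β s := by
    rw [repR, smul_apply, hβ, map_smul,
      Fock.map_multisetMonomial _ _ _ (rotMode_modeBasis θ), prod_map_expI, add_mul, expI_add,
      show ⟪l, l⟫_ℝ / 2 * θ = 1 / 2 * ⟪l, l⟫_ℝ * θ by ring, Circle.coe_mul]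
    simp only [smul_smul]
    congr 1
    ring
  -- The exponents $-\langle l,\Delta\rangle$, $\frac12\langle\Delta,\Delta\rangle$ and
  -- $\frac12\langle l,l\rangle$ meet here and complete the square.
  rw [e1, Ind.mk_mul χ hl, repW_const χ hl h e2 e3, hR, smul_smul, e4, ← expI_add,
    ← Circle.coe_mul, ← expI_add, ← Ind.mkL_apply, ← Ind.mkL_apply, map_smul]
  congr 3
  simp only [inner_sub_left, inner_sub_right, inner_neg_right, real_inner_smul_right]
  rw [real_inner_comm (Δ : E) l]
  ring

end LatticeSpan

/-! ### Counting multisets of modes -/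

section Counting

open PowerSeries

variable {κ : Type*}

open LatticeSpan in
theorem modeEnergy_cons (p : ℕ × κ) (s : Multiset (ℕ × κ)) :
    modeEnergy (p ::ₘ s) = p.1 + 1 + modeEnergy s := by
  simp [modeEnergy]

open LatticeSpan in
theorem lt_modeEnergy_of_mem {p : ℕ × κ} {s : Multiset (ℕ × κ)} (h : p ∈ s) :
    p.1 < modeEnergy s := by
  obtain ⟨t, rfl⟩ := Multiset.exists_cons_of_mem h
  rw [modeEnergy_cons]
  omega

open LatticeSpan in
theorem card_le_modeEnergy (s : Multiset (ℕ × κ)) : s.card ≤ modeEnergy s := by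
  induction s using Multiset.induction_on with
  | empty => simp
  | cons p s ih =>
    rw [modeEnergy_cons, Multiset.card_cons]
    omega

/-- The multisets of modes from a given set of total energy `N`. -/
def modeMultisets (F : Finset (ℕ × κ)) (N : ℕ) : Set (Multiset (ℕ × κ)) :=
  {s | (∀ p ∈ s, p ∈ F) ∧ LatticeSpan.modeEnergy s = N}

/-- Every mode has energy at least $1$, so no multiplicity exceeds `N` and the multiset lies below
`N • F.val`. -/
theorem finite_modeMultisets (F : Finset (ℕ × κ)) (N : ℕ) : (modeMultisets F N).Finite := by
  classical
  refine (Set.finite_Iic (N • F.val)).subset fun s hs => Multiset.le_iff_count.2 fun p => ?_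
  rw [Multiset.count_nsmul]
  by_cases hp : p ∈ s
  · have h1 : 1 ≤ F.val.count p := Multiset.one_le_count_iff_mem.2 (hs.1 p hp)
    have h2 := (Multiset.count_le_card p s).trans (card_le_modeEnergy s)
    rw [hs.2] at h2
    exact h2.trans (Nat.le_mul_of_pos_right _ h1)
  · rw [Multiset.count_eq_zero_of_notMem hp]
    exact Nat.zero_le _

/-- The generating function of the multisets of modes from a given finite set. -/
def modeSeries (F : Finset (ℕ × κ)) : PowerSeries ℚ :=
  PowerSeries.mk fun N => ((modeMultisets F N).ncard : ℚ)

theorem modeSeries_empty : modeSeries (∅ : Finset (ℕ × κ)) = 1 := by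
  ext N
  rw [modeSeries, coeff_mk, coeff_one]
  have h : modeMultisets (∅ : Finset (ℕ × κ)) N = if N = 0 then {0} else ∅ := by
    ext s
    constructor
    · rintro ⟨h1, h2⟩
      obtain rfl : s = 0 := Multiset.eq_zero_of_forall_notMem fun p hp => by simpa using h1 p hp
      have : N = 0 := by simpa [LatticeSpan.modeEnergy] using h2.symm
      simp [this]
    · split_ifs with hN
      · rintro rfl
        exact ⟨by simp, by simp [LatticeSpan.modeEnergy, hN]⟩
      · exact fun h => h.elim
  rw [h]
  split_ifs <;> simp

/-- Euler's recursion: a multiset either avoids `p`, or is `p` added to a smaller multiset whose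
energy is less by `p.1 + 1`. -/
theorem modeSeries_insert [DecidableEq (ℕ × κ)] {p : ℕ × κ} {F : Finset (ℕ × κ)} (hp : p ∉ F) :
    modeSeries (insert p F) = modeSeries F + X ^ (p.1 + 1) * modeSeries (insert p F) := by
  ext N
  rw [map_add, coeff_X_pow_mul']
  simp only [modeSeries, coeff_mk]
  have hu : modeMultisets (insert p F) N = modeMultisets F N ∪
      {s ∈ modeMultisets (insert p F) N | p ∈ s} := by
    ext s
    constructor
    · intro hs
      by_cases h : p ∈ s
      · exact Or.inr ⟨hs, h⟩
      · exact Or.inl ⟨fun q hq => (Finset.mem_insert.1 (hs.1 q hq)).resolve_left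
          fun e => h (e ▸ hq), hs.2⟩
    · rintro (hs | hs)
      · exact ⟨fun q hq => Finset.mem_insert_of_mem (hs.1 q hq), hs.2⟩
      · exact hs.1
  have hd : Disjoint (modeMultisets F N) {s ∈ modeMultisets (insert p F) N | p ∈ s} :=
    Set.disjoint_left.2 fun s hs hs' => hp (hs.1 p hs'.2)
  rw [hu, Set.ncard_union_eq hd (finite_modeMultisets _ _)
    ((finite_modeMultisets _ _).subset (Set.sep_subset _ _)), Nat.cast_add, add_right_inj]
  split_ifs with hN
  · have him : {s ∈ modeMultisets (insert p F) N | p ∈ s} =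
        (fun s => p ::ₘ s) '' modeMultisets (insert p F) (N - (p.1 + 1)) := by
      ext s
      constructor
      · rintro ⟨⟨h1, h2⟩, h3⟩
        obtain ⟨t, rfl⟩ := Multiset.exists_cons_of_mem h3
        rw [modeEnergy_cons] at h2
        exact ⟨t, ⟨fun q hq => h1 q (Multiset.mem_cons_of_mem hq), by omega⟩, rfl⟩
      · rintro ⟨t, ⟨h1, h2⟩, rfl⟩
        refine ⟨⟨fun q hq => ?_, ?_⟩, Multiset.mem_cons_self p t⟩
        · rcases Multiset.mem_cons.1 hq with rfl | hq
          · exact Finset.mem_insert_self _ _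
          · exact h1 q hq
        · rw [modeEnergy_cons, h2]
          omega
    rw [him, Set.ncard_image_of_injective _ (fun _ _ h => (Multiset.cons_inj_right p).1 h)]
  · have he : {s ∈ modeMultisets (insert p F) N | p ∈ s} = ∅ := by
      refine Set.eq_empty_of_forall_notMem fun s hs => hN ?_
      have := lt_modeEnergy_of_mem hs.2
      rw [hs.1.2] at this
      omega
    rw [he]
    simp

theorem modeSeries_mul_prod (F : Finset (ℕ × κ)) :
    modeSeries F * ∏ p ∈ F, (1 - (X : PowerSeries ℚ) ^ (p.1 + 1)) = 1 := by
  classical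
  induction F using Finset.induction_on with
  | empty => rw [modeSeries_empty, Finset.prod_empty, mul_one]
  | insert p F hp ih =>
    rw [Finset.prod_insert hp, ← mul_assoc, mul_sub, mul_one, mul_comm (modeSeries _) (X ^ _),
      show modeSeries (insert p F) - X ^ (p.1 + 1) * modeSeries (insert p F) = modeSeries F from
        sub_eq_iff_eq_add.2 (modeSeries_insert hp), ih]

/-- Factors with $j>n$ do not affect the coefficient of $X^n$. Congruences modulo $X^{N+1}$ take the
place of convergence of infinite products. -/
theorem X_pow_dvd_eulerProduct_sub (N : ℕ) :
    (X : PowerSeries ℚ) ^ (N + 1) ∣ eulerProduct - ∏ j ∈ Finset.Icc 1 N, (1 - X ^ j) := by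
  refine X_pow_dvd_iff.2 fun n hn => ?_
  rw [map_sub, eulerProduct, coeff_mk, sub_eq_zero]
  have hnN : n ≤ N := by omega
  clear hn
  induction N, hnN using Nat.le_induction with
  | base => rfl
  | succ N hN ih =>
    rw [Finset.prod_Icc_succ_top (by omega), mul_sub, mul_one, mul_comm _ (X ^ (N + 1)), map_sub,
      coeff_X_pow_mul', if_neg (by omega), sub_zero]
    exact ih

variable (κ) in
/-- The generating function of all finite multisets of modes. -/
def fockSeries : PowerSeries ℚ :=
  PowerSeries.mk fun N =>
    (Nat.card {s : Multiset (ℕ × κ) // LatticeSpan.modeEnergy s = N} : ℚ)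

variable [Fintype κ]

theorem modeMultisets_eq {i N : ℕ} (h : i ≤ N) :
    modeMultisets (Finset.range N ×ˢ (Finset.univ : Finset κ)) i =
      {s | LatticeSpan.modeEnergy s = i} := by
  ext s
  refine ⟨fun hs => hs.2, fun hs => ⟨fun p hp => ?_, hs⟩⟩
  have := lt_modeEnergy_of_mem hp
  rw [show LatticeSpan.modeEnergy s = i from hs] at this
  simp only [Finset.mem_product, Finset.mem_range, Finset.mem_univ, and_true]
  omega

theorem finite_modeEnergy_eq (N : ℕ) :
    {s : Multiset (ℕ × κ) | LatticeSpan.modeEnergy s = N}.Finite := by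
  rw [← modeMultisets_eq le_rfl]
  exact finite_modeMultisets _ _

theorem X_pow_dvd_fockSeries_sub (N : ℕ) : (X : PowerSeries ℚ) ^ (N + 1) ∣
    fockSeries κ - modeSeries (Finset.range N ×ˢ (Finset.univ : Finset κ)) := by
  refine X_pow_dvd_iff.2 fun n hn => ?_
  rw [map_sub, fockSeries, modeSeries, coeff_mk, coeff_mk, modeMultisets_eq (by omega), sub_eq_zero]
  rfl

/-- The generating function of the occupation numbers is a power of Euler's partition function. -/
theorem fockSeries_mul_eulerProduct_pow :
    fockSeries κ * eulerProduct ^ Fintype.card κ = 1 := by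
  ext N
  set F : Finset (ℕ × κ) := Finset.range N ×ˢ Finset.univ
  set Q : PowerSeries ℚ := ∏ j ∈ Finset.Icc 1 N, (1 - X ^ j) with hQ
  -- The product over modes groups by colour into $|\kappa|$ copies of the truncated Euler product;
  -- mode index $j$ carries the factor $1-X^{j+1}$, hence the shift from `range N` to `Icc 1 N`.
  have hF : modeSeries F * Q ^ Fintype.card κ = 1 := by
    rw [← modeSeries_mul_prod F, Finset.prod_product]
    congr 1
    simp only [Finset.prod_const, Finset.card_univ]
    rw [Finset.prod_pow, hQ, Finset.range_eq_Ico, Finset.prod_Ico_add' (fun j =>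
      (1 : PowerSeries ℚ) - X ^ j)]
    rfl
  have h : (X : PowerSeries ℚ) ^ (N + 1) ∣ fockSeries κ * eulerProduct ^ Fintype.card κ - 1 := by
    have e : fockSeries κ * eulerProduct ^ Fintype.card κ - 1 =
        (fockSeries κ - modeSeries F) * eulerProduct ^ Fintype.card κ +
          modeSeries F * (eulerProduct ^ Fintype.card κ - Q ^ Fintype.card κ) := by
      rw [← hF]
      ring
    rw [e]
    exact dvd_add ((X_pow_dvd_fockSeries_sub N).mul_right _)
      (((X_pow_dvd_eulerProduct_sub N).trans (sub_dvd_pow_sub_pow _ _ _)).mul_left _)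
  have := X_pow_dvd_iff.1 h N (by omega)
  rwa [map_sub, sub_eq_zero] at this

end Counting

/-! ### Hahn series that count elements by energy -/

section HahnCounting

/-- Products of Hahn series that count elements of given weight count pairs of given weight. -/
theorem HahnSeries_coeff_mul_card {A B : Type*} {α : A → ℝ} {β : B → ℝ} {x y : HahnSeries ℝ ℚ}
    (hA : ∀ c, {a | α a = c}.Finite) (hB : ∀ c, {b | β b = c}.Finite)
    (hx : ∀ c, x.coeff c = (Nat.card {a // α a = c} : ℚ))
    (hy : ∀ c, y.coeff c = (Nat.card {b // β b = c} : ℚ)) (c : ℝ) :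
    {p : A × B | α p.1 + β p.2 = c}.Finite ∧
      (x * y).coeff c = (Nat.card {p : A × B // α p.1 + β p.2 = c} : ℚ) := by
  classical
  -- Fibres are finite and nonempty, so `Nat.card` is positive and every weight that occurs lies in
  -- the support; the sum over the antidiagonal misses no pair.
  have hxs : ∀ a, α a ∈ x.support := fun a => by
    have : Finite {b // α b = α a} := (hA (α a)).to_subtype
    have : Nonempty {b // α b = α a} := ⟨⟨a, rfl⟩⟩
    rw [HahnSeries.mem_support, hx]
    exact_mod_cast (Nat.card_pos (α := {b // α b = α a})).ne'
  have hys : ∀ a, β a ∈ y.support := fun a => by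
    have : Finite {b // β b = β a} := (hB (β a)).to_subtype
    have : Nonempty {b // β b = β a} := ⟨⟨a, rfl⟩⟩
    rw [HahnSeries.mem_support, hy]
    exact_mod_cast (Nat.card_pos (α := {b // β b = β a})).ne'
  set D := Finset.antidiagonal x.isPWO_support y.isPWO_support c with hD
  have hf : {p : A × B | α p.1 + β p.2 = c}.Finite := by
    refine (D.finite_toSet.biUnion fun d _ => (hA d.1).prod (hB d.2)).subset fun p hp => ?_
    refine Set.mem_biUnion (x := (α p.1, β p.2)) ?_ ⟨rfl, rfl⟩
    exact Finset.mem_coe.2 (Finset.mem_antidiagonal.2 ⟨hxs _, hys _, hp⟩)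
  refine ⟨hf, ?_⟩
  have hc : Nat.card {p : A × B // α p.1 + β p.2 = c} = hf.toFinset.card :=
    Nat.card_eq_card_finite_toFinset hf
  rw [HahnSeries.coeff_mul, hc, Finset.card_eq_sum_card_fiberwise (t := D)
    (f := fun p : A × B => (α p.1, β p.2)) fun p hp => Finset.mem_coe.2 (Finset.mem_antidiagonal.2
      ⟨hxs _, hys _, hf.mem_toFinset.1 (Finset.mem_coe.1 hp)⟩), Nat.cast_sum]
  refine Finset.sum_congr rfl fun d hd => ?_
  have hd' : d.1 + d.2 = c := (Finset.mem_antidiagonal.1 hd).2.2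
  rw [hx, hy, ← Nat.cast_mul, Nat.cast_inj]
  have e : (hf.toFinset.filter fun p => (α p.1, β p.2) = d) =
      (hA d.1).toFinset ×ˢ (hB d.2).toFinset := by
    ext p
    simp only [Finset.mem_filter, Set.Finite.mem_toFinset, Set.mem_ofPred_eq, Finset.mem_product,
      Prod.ext_iff]
    constructor
    · exact fun h => h.2
    · exact fun h => ⟨by rw [h.1, h.2, hd'], h⟩
  rw [e, Finset.card_product]
  exact congrArg₂ _ (Nat.card_eq_card_finite_toFinset (hA d.1))
    (Nat.card_eq_card_finite_toFinset (hB d.2))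

theorem coeff_ofPowerSeries_fockSeries {κ : Type*} (c : ℝ) :
    (HahnSeries.ofPowerSeries ℝ ℚ (fockSeries κ)).coeff c =
      (Nat.card {s : Multiset (ℕ × κ) // (LatticeSpan.modeEnergy s : ℝ) = c} : ℚ) := by
  by_cases h : ∃ n : ℕ, (n : ℝ) = c
  · obtain ⟨n, rfl⟩ := h
    rw [HahnSeries.ofPowerSeries_apply_coeff, fockSeries, PowerSeries.coeff_mk]
    simp only [Nat.cast_inj]
  · have : IsEmpty {s : Multiset (ℕ × κ) // (LatticeSpan.modeEnergy s : ℝ) = c} :=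
      ⟨fun s => h ⟨_, s.2⟩⟩
    rw [Nat.card_of_isEmpty, HahnSeries.ofPowerSeries_apply, HahnSeries.embDomain_of_notMem_range,
      Nat.cast_zero]
    rintro ⟨n, hn⟩
    exact h ⟨n, hn⟩

variable [FiniteDimensional ℝ E] (L : LatticeSpan E)

theorem LatticeSpan.finite_diff_energy (l : E) (c : ℝ) :
    {Δ : L.diff | ⟪l - (Δ : E), l - (Δ : E)⟫_ℝ / 2 = c}.Finite := by
  refine Set.Finite.of_injOn (f := fun Δ : L.diff => l - (Δ : E)) (fun Δ hΔ => ?_)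
    (fun Δ _ Δ' _ h => Subtype.ext (sub_right_injective h)) (L.finite_coset_ball l (√(2 * c)))
  refine ⟨by rw [sub_sub_cancel_left]; exact neg_mem Δ.2, Real.le_sqrt_of_sq_le ?_⟩
  rw [← real_inner_self_eq_norm_sq]
  have : ⟪l - (Δ : E), l - (Δ : E)⟫_ℝ / 2 = c := hΔ
  linarith

/-- The energies of the eigenbasis involve $l-\Delta$ rather than $l+\Delta$; both run over the same
coset because $\Lambda_\circ-\Lambda_\bullet$ is closed under negation. -/
theorem LatticeSpan.coeff_thetaSeries (l : E) (c : ℝ) : (L.thetaSeries l).coeff c =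
    (Nat.card {Δ : L.diff // ⟪l - (Δ : E), l - (Δ : E)⟫_ℝ / 2 = c} : ℚ) := by
  change (Nat.card {x : E // x - l ∈ L.diff ∧ ⟪x, x⟫_ℝ / 2 = c} : ℚ) = _
  rw [Nat.cast_inj]
  refine Nat.card_congr
    { toFun := fun x => ⟨⟨l - x.1, by rw [← neg_sub]; exact neg_mem x.2.1⟩, by
        simpa using x.2.2⟩
      invFun := fun Δ => ⟨l - Δ.1, by rw [sub_sub_cancel_left]; exact neg_mem Δ.1.2, Δ.2⟩
      left_inv := fun x => by simp
      right_inv := fun Δ => by simp }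

theorem etaSeries_pow (d : ℕ) : etaSeries ^ d =
    HahnSeries.single ((d : ℝ) / 24) 1 * HahnSeries.ofPowerSeries ℝ ℚ (eulerProduct ^ d) := by
  rw [etaSeries, mul_pow, HahnSeries.single_pow, one_pow, nsmul_eq_mul, mul_one_div,
    map_pow (HahnSeries.ofPowerSeries ℝ ℚ)]

/-- The character formula as an identity of formal series. -/
theorem thetaSeries_mul_etaSeries_inv (x : HahnSeries ℝ ℚ) (d : ℕ) :
    HahnSeries.single ((d : ℝ) / 24) 1 * x * (etaSeries ^ d)⁻¹ =
      x * HahnSeries.ofPowerSeries ℝ ℚ (fockSeries (Fin d)) := by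
  have h1 : HahnSeries.ofPowerSeries ℝ ℚ (fockSeries (Fin d)) *
      HahnSeries.ofPowerSeries ℝ ℚ (eulerProduct ^ d) = 1 := by
    have := fockSeries_mul_eulerProduct_pow (κ := Fin d)
    rw [Fintype.card_fin] at this
    rw [← map_mul, this, map_one]
  have h0 : etaSeries ^ d ≠ 0 := by
    rw [etaSeries_pow]
    exact mul_ne_zero (HahnSeries.single_ne_zero one_ne_zero) (right_ne_zero_of_mul_eq_one h1)
  rw [mul_inv_eq_iff_eq_mul₀ h0, etaSeries_pow]
  linear_combination (-(HahnSeries.single ((d : ℝ) / 24) (1 : ℚ) * x)) * h1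

end HahnCounting

/-! ### The main theorem -/

theorem Total.isometryEquiv_ext {X F : Type*} [NormedAddCommGroup F] [InnerProductSpace ℂ F]
    [CompleteSpace F] {a : X → F} (ha : Total a) {S T : F ≃ₗᵢ[ℂ] F} (h : ∀ x, S (a x) = T (a x)) :
    S = T := by
  have := ha.ext (S := (S.toContinuousLinearEquiv : F →L[ℂ] F))
    (T := (T.toContinuousLinearEquiv : F →L[ℂ] F)) h
  exact LinearIsometryEquiv.ext fun v => congrArg (fun T : F →L[ℂ] F => T v) this

/-- A representation of `ℝ` that is trivial at `m` descends to `ℝ/mℤ`. -/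
theorem exists_rot_rep {G : Type*} [Group G] {m : ℕ} (f : Multiplicative ℝ →* G)
    (hm : f (Multiplicative.ofAdd (m : ℝ)) = 1) :
    ∃ R : Rot m →* G, ∀ θ : ℝ, R (Rot.mk m θ) = f (Multiplicative.ofAdd θ) := by
  let f' : ℝ →+ Additive G := AddMonoidHom.toMultiplicativeLeft.symm f
  refine ⟨AddMonoidHom.toMultiplicativeLeft
    (QuotientAddGroup.lift (AddSubgroup.zmultiples (m : ℝ)) f' ?_), fun θ => rfl⟩
  rw [AddSubgroup.zmultiples_le]
  exact hm

theorem continuous_rot_of_real {Y : Type*} [TopologicalSpace Y] {m : ℕ} {f : Rot m → Y}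
    (h : Continuous fun θ : ℝ => f (Rot.mk m θ)) : Continuous f :=
  (continuous_coinduced_dom (f := fun θ : ℝ => (θ : AddCircle (m : ℝ)))
    (g := fun φ : AddCircle (m : ℝ) => f (Multiplicative.ofAdd φ))).2 h

namespace LatticeSpan

variable {L : LatticeSpan E} {l : E} {n m : ℕ}

/-- Expand with $\Delta=a-b$. The term $\frac m2\langle l,l\rangle$ is an integer by hypothesis, and
$\langle l,m\Delta\rangle$ because $m\Delta\in\Gamma$. In $\frac m2\langle\Delta,\Delta\rangle$ the
squares are integral by evenness, and the cross term is $\langle ma,b\rangle$ with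
$ma\in\Gamma\subseteq\Lambda_\bullet$, since $a=a-0$ itself lies in $\Lambda_\circ-\Lambda_\bullet$.
-/
theorem exists_int_energy (hn : ∀ x ∈ L.diff, n • x ∈ L.Γ) (hl : ∀ x ∈ L.Γ, ∃ k : ℤ, ⟪l, x⟫_ℝ = k)
    (hnm : n ∣ m) (hm : ∃ j : ℤ, m * ⟪l, l⟫_ℝ = 2 * j) (Δ : L.diff) :
    ∃ k : ℤ, m * (⟪l - (Δ : E), l - (Δ : E)⟫_ℝ / 2) = k := by
  have hmx : ∀ x ∈ L.diff, m • x ∈ L.Γ := fun x hx => by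
    obtain ⟨c, rfl⟩ := hnm
    rw [mul_comm, mul_smul]
    exact nsmul_mem (hn x hx) c
  obtain ⟨j, hj⟩ := hm
  obtain ⟨k1, hk1⟩ := hl _ (hmx _ Δ.2)
  obtain ⟨a, ha, b, hb, e⟩ := Δ.2
  obtain ⟨ka, hka⟩ := L.even_w a ha
  obtain ⟨kb, hkb⟩ := L.even_b b hb
  obtain ⟨k2, hk2⟩ := polar L.even_b (L.le_b (hmx a ⟨a, ha, 0, zero_mem _, by simp⟩)) hb
  rw [← Nat.cast_smul_eq_nsmul ℝ, real_inner_smul_right, e, inner_sub_right] at hk1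
  rw [← Nat.cast_smul_eq_nsmul ℝ, real_inner_smul_left] at hk2
  refine ⟨j - k1 + m * ka + m * kb - k2, ?_⟩
  rw [e]
  simp only [inner_sub_left, inner_sub_right]
  rw [real_inner_comm l a, real_inner_comm l b, real_inner_comm a b, hka, hkb]
  push_cast
  linear_combination (1 / 2) * hj - hk1 - hk2

end LatticeSpan

/-! ### Positive energy and graded character from an eigenbasis -/

section Spectrum

variable [FiniteDimensional ℝ E] {L : LatticeSpan E} {l : E} {H : Type*} [NormedAddCommGroup H]
  [InnerProductSpace ℂ H] {m : ℕ} {R : Rot m →* (H ≃ₗᵢ[ℂ] H)}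
  {b : HilbertBasis (L.diff × Multiset (ℕ × Fin (Module.finrank ℝ E))) ℂ H}

/-- The energies `½⟨l - Δ, l - Δ⟩ + N` of the induced representation, for winding elements `Δ` and
occupation energies `N`. -/
def totalEnergy (l : E) (i : L.diff × Multiset (ℕ × Fin (Module.finrank ℝ E))) : ℝ :=
  ⟪l - (i.1 : E), l - (i.1 : E)⟫_ℝ / 2 + LatticeSpan.modeEnergy i.2

theorem finite_totalEnergy_eq (c : ℝ) :
    {i : L.diff × Multiset (ℕ × Fin (Module.finrank ℝ E)) | totalEnergy l i = c}.Finite ∧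
    (L.thetaSeries l * HahnSeries.ofPowerSeries ℝ ℚ
      (fockSeries (Fin (Module.finrank ℝ E)))).coeff c =
      (Nat.card {i : L.diff × Multiset (ℕ × Fin (Module.finrank ℝ E)) // totalEnergy l i = c} : ℚ) :=
  HahnSeries_coeff_mul_card (L.finite_diff_energy l) (fun c => by
    by_cases h : ∃ N : ℕ, (N : ℝ) = c
    · obtain ⟨N, rfl⟩ := h
      simpa only [Nat.cast_inj] using finite_modeEnergy_eq N
    · convert Set.finite_empty
      exact Set.eq_empty_of_forall_notMem fun s hs => h ⟨_, hs⟩)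
    (L.coeff_thetaSeries l) coeff_ofPowerSeries_fockSeries c

omit [FiniteDimensional ℝ E] in
theorem exists_nat_energy (hm : 0 < m)
    (hint : ∀ Δ : L.diff, ∃ k : ℤ, m * (⟪l - (Δ : E), l - (Δ : E)⟫_ℝ / 2) = k)
    (i : L.diff × Multiset (ℕ × Fin (Module.finrank ℝ E))) : ∃ k : ℕ, totalEnergy l i = k / m := by
  obtain ⟨k, hk⟩ := hint i.1
  have hm' : (0 : ℝ) < m := by exact_mod_cast hm
  have h0 : (0 : ℝ) ≤ k := by
    rw [← hk]
    exact mul_nonneg hm'.le (div_nonneg real_inner_self_nonneg zero_le_two)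
  lift k to ℕ using by exact_mod_cast h0
  refine ⟨k + m * LatticeSpan.modeEnergy i.2, ?_⟩
  rw [eq_div_iff hm'.ne', totalEnergy]
  push_cast at hk ⊢
  linear_combination hk

theorem isPositiveEnergy_of_eigenbasis (hm : 0 < m)
    (hR : ∀ θ i, R (Rot.mk m θ) (b i) = (expI (totalEnergy l i * θ) : ℂ) • b i) :
    IsPositiveEnergy R := by
  refine fun k => ⟨fun hk => ?_, fun _ => (finrank_energySpace hR (finite_totalEnergy_eq _).1).1⟩
  refine (Submodule.eq_bot_iff _).2 fun v hv => Total.of_hilbertBasis b v fun i =>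
    (mem_energySpace_iff hR _ v).1 hv i (ne_of_gt (lt_of_lt_of_le ?_ (?_ : 0 ≤ totalEnergy l i)))
  · exact div_neg_of_neg_of_pos (by exact_mod_cast hk) (by exact_mod_cast hm)
  · exact add_nonneg (div_nonneg real_inner_self_nonneg zero_le_two) (Nat.cast_nonneg _)

/-- `gradedCharacter` is $0$ by definition at exponents outside $\frac1m\mathbb N$. By `hint` no
energy lies there, so the count of basis vectors agrees with it at every exponent. -/
theorem gradedCharacter_of_eigenbasis (hm : 0 < m)
    (hint : ∀ Δ : L.diff, ∃ k : ℤ, m * (⟪l - (Δ : E), l - (Δ : E)⟫_ℝ / 2) = k)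
    (hR : ∀ θ i, R (Rot.mk m θ) (b i) = (expI (totalEnergy l i * θ) : ℂ) • b i) :
    gradedCharacter R = HahnSeries.single ((Module.finrank ℝ E : ℝ) / 24) 1 *
      L.thetaSeries l * (etaSeries ^ Module.finrank ℝ E)⁻¹ := by
  rw [thetaSeries_mul_etaSeries_inv]
  ext c
  rw [(finite_totalEnergy_eq c).2]
  change (@ite _ (∃ k : ℕ, c = k / m) (Classical.propDecidable _)
    (Module.finrank ℂ (energySpace R c) : ℚ) 0) = _
  split_ifs with h
  · rw [(finrank_energySpace hR (finite_totalEnergy_eq c).1).2]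
  · have : IsEmpty {i : L.diff × Multiset (ℕ × Fin (Module.finrank ℝ E)) // totalEnergy l i = c} :=
      ⟨fun i => h (by
        obtain ⟨k, hk⟩ := exists_nat_energy hm hint i.1
        exact ⟨k, i.2.symm.trans hk⟩)⟩
    rw [Nat.card_of_isEmpty, Nat.cast_zero]

end Spectrum

end BicolouredTorus

end

open BicolouredTorus BicolouredTorus.LatticeSpan in
theorem mainTheorem7 {E : Type*} [NormedAddCommGroup E] [InnerProductSpace ℝ E]
    [FiniteDimensional ℝ E] (L : LatticeSpan E) (ε : L.WindingCocycle)
    (n : ℕ) (hn : IsLeast {k : ℕ | 0 < k ∧ ∀ x ∈ L.diff, k • x ∈ L.Γ} n)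
    (χ : AddChar L.interQuot Circle)
    (l : E) (hl : ∀ x ∈ L.Γ, ∃ k : ℤ, ⟪l, x⟫_ℝ = k)
    (m : ℕ) (hm : IsLeast {k : ℕ | 0 < k ∧ n ∣ k ∧ ∃ j : ℤ, k * ⟪l, l⟫_ℝ = 2 * j} m) :
    -- `Q = Ind W_{χ,l}` and `R = Ind R_{χ,l}`; the vectors `[x, v]` span a dense subspace, so
    -- that `Q` and `R` are uniquely determined by the first two clauses
    ∃ (Q : Ext ε →* (Ind ε ≃ₗᵢ[ℂ] Ind ε)) (R : Rot m →* (Ind ε ≃ₗᵢ[ℂ] Ind ε)),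
      (∀ g x v, Q g (Ind.mk χ l x v) = Ind.mk χ l (g * x) v) ∧
      (∀ θ x v, R (Rot.mk m θ) (Ind.mk χ l x v) = Ind.mk χ l (Ext.rot θ x) (repR l θ v)) ∧
      (∀ v, Continuous fun φ => R φ v) ∧
      (∀ θ g, R (Rot.mk m θ) * Q g * (R (Rot.mk m θ))⁻¹ = Q (Ext.rot θ g)) ∧
      IsPositiveEnergy R ∧
      gradedCharacter R = HahnSeries.single ((Module.finrank ℝ E : ℝ) / 24) 1 *
        L.thetaSeries l * (etaSeries ^ Module.finrank ℝ E)⁻¹ := by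
  obtain ⟨hm0, hnm, hml⟩ := hm.1
  have hint := exists_int_energy hn.1.2 hl hnm hml
  obtain ⟨Q, hQ⟩ := Ind.exists_repW (ε := ε) χ hl
  obtain ⟨S, hS⟩ := Ind.exists_repR (ε := ε) χ hl
  obtain ⟨b, hb⟩ := Ind.exists_eigenbasis (ε := ε) χ hl
  have hSb : ∀ (θ : ℝ) i, S (Multiplicative.ofAdd θ) (b i) =
      (expI (totalEnergy l i * θ) : ℂ) • b i := fun θ i => by
    obtain ⟨x, v, e, he⟩ := hb i
    rw [e, hS, he]
    rfl
  -- Every energy is $k/m$ with $k$ a natural number, so the rotation by $m$ fixes each vector of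
  -- the eigenbasis.
  have hSm : S (Multiplicative.ofAdd (m : ℝ)) = 1 :=
    (Total.of_hilbertBasis b).isometryEquiv_ext fun i => by
      obtain ⟨k, hk⟩ := exists_nat_energy hm0 hint i
      have hm' : (m : ℝ) ≠ 0 := by exact_mod_cast hm0.ne'
      rw [hSb, hk, div_mul_cancel₀ _ hm', ← Int.cast_natCast, expI_int, Circle.coe_one, one_smul]
      rfl
  obtain ⟨R, hR⟩ := exists_rot_rep S hSm
  have hRb : ∀ (θ : ℝ) i, R (Rot.mk m θ) (b i) = (expI (totalEnergy l i * θ) : ℂ) • b i :=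
    fun θ i => by rw [hR, hSb]
  have hRmk : ∀ θ x v, R (Rot.mk m θ) (Ind.mk χ l x v) =
      Ind.mk χ l (Ext.rot θ x) (repR l θ v) := fun θ x v => by rw [hR, hS]
  refine ⟨Q, R, hQ, hRmk, fun v => ?_, fun θ g => ?_, isPositiveEnergy_of_eigenbasis hm0 hRb,
    gradedCharacter_of_eigenbasis hm0 hint hRb⟩
  · refine continuous_orbit_of_total (U := fun φ => R φ) (Total.of_hilbertBasis b)
      (fun i => continuous_rot_of_real ?_) v
    simp only [hRb]
    exact (continuous_subtype_val.comp (continuous_expI.comp (by fun_prop))).smul continuous_const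
  -- On $[x,v]$ both sides give $[\Phi_\theta\cdot(gx),R_{\chi,l}[\Phi_\theta]v]$, as $\Phi_\theta$
  -- is multiplicative.
  · rw [mul_inv_eq_iff_eq_mul]
    refine (Ind.total_mk χ hl).isometryEquiv_ext fun p => ?_
    rw [LinearIsometryEquiv.coe_mul, LinearIsometryEquiv.coe_mul]
    simp only [Function.comp, hQ, hRmk, Ext.rot_mul]
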